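/- Let $A=\bigoplus_{k\ge 0}A_k$ be a positively graded Noetherian commutative ring, generated over $A_0$ by forms $x_1,\dots,x_n$ of positive degrees, and put $A_+=\bigoplus_{k>0}A_k$. Let $M$ be a finitely generated $\mathbf Z$-graded $A$-module, let $I$ be a graded ideal of $A$, and let $J\subseteq I$ be a graded ideal such that $JI^pM=I^{p+1}M$ for some $p\ge 0$. Assume that $J$ is generated by $r\ge 1$ forms $f_1,\dots,f_r$ of respective degrees $d=d_1=\cdots=d_m>d_{m+1}\ge\cdots\ge d_r$, where $1\le m\le r$. For a graded $A$-module $N$, let $H^i_{A_+}(N)$ be the local cohomology of $N$, graded as the cohomology of the Čech complex of $N$ on $x_1,\dots,x_n$, and set $$a^i(N):=\sup\{\mu\in\mathbf Z : H^i_{A_+}(N)_\mu\neq 0\},\qquad a^i(N):=-\infty \text{ if } H^i_{A_+}(N)=0 .$$ Let $\mathcal R_I:=\bigoplus_{t\ge 0}I^t(dt)$ and $M\mathcal R_I:=\bigoplus_{t\ge 0}MI^t(dt)$, so that the elements of degree $\mu$ of the $t$-th summand of $M\mathcal R_I$ are $(MI^t)_{\mu+td}$. Let $A[T_1,\dots,T_r]$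 act on $M\mathcal R_I$ through the $A$-algebra map $\psi: A[T_1,\dots,T_r]\to\mathcal R_I$ sending $T_j$ to $f_j\in I=(\mathcal R_I)_{t=1}$. Let $B:=A_0[T_1,\dots,T_m]$ and $B':=B/\operatorname{ann}_B(M\mathcal R_I)$, with the grading induced by $\deg T_j=1$, and let $\operatorname{Proj}(B')$ be the set of homogeneous prime ideals of $B'$ that do not contain $B'_+$. For $\mathfrak q\in\operatorname{Proj}(B')$, the $A$-module $M\mathcal R_I\otimes_{B'}B'_{\mathfrak q}$ is graded by the degree $\mu$ above, with $B'_{\mathfrak q}$ in degree $0$. Then, for every $i\ge 0$, the following limit exists in $\mathbf Z\cup\{-\infty\}$ and $$\lim_{t\to+\infty}\bigl(a^i(MI^t)-td\bigr)=\max_{\mathfrak q\in\operatorname{Proj}(B')} a^i\bigl(M\mathcal R_I\otimes_{B'}B'_{\mathfrak q}\bigr),$$ where the maximum is attained if $\operatorname{Proj}(B')\neq\emptyset$ and is read as $-\infty$ if $\operatorname{Proj}(B')=\emptyset$. -/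

import Mathlib

open scoped TensorProduct

noncomputable section

namespace PowersCohomology

/-! ### The graded Čech complex and the invariants `a^i`

`N` is a module over a commutative ring `A`, graded by the family `𝒩 : ℤ → AddSubgroup N`, and
`x_1, …, x_n ∈ A` are elements of degrees `w_1, …, w_n > 0`. -/

section Cech

variable {A : Type*} [CommRing A] {n : ℕ} (x : Fin n → A) (w : Fin n → ℕ)
  (N : Type*) [AddCommGroup N] [Module A N] (𝒩 : ℤ → AddSubgroup N)

/-- The localization `N_{x_{j_1} ⋯ x_{j_i}}`, where `s = {j_1, …, j_i}`. -/
abbrev CechLoc (s : Finset (Fin n)) : Type _ :=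
  LocalizedModule (Submonoid.powers (∏ j ∈ s, x j)) N

theorem isUnit_powers_of_subset {s t : Finset (Fin n)} (h : s ⊆ t)
    (y : Submonoid.powers (∏ j ∈ s, x j)) :
    IsUnit (algebraMap A (Module.End A (CechLoc x N t)) y) := by
  obtain ⟨y, k, rfl⟩ := y
  have h1 : IsUnit (algebraMap A (Module.End A (CechLoc x N t)) ((∏ j ∈ t, x j) ^ k)) :=
    IsLocalizedModule.map_units
      (LocalizedModule.mkLinearMap (Submonoid.powers (∏ j ∈ t, x j)) N)
      (⟨(∏ j ∈ t, x j) ^ k, k, rfl⟩ : Submonoid.powers (∏ j ∈ t, x j))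
  obtain ⟨c, hc⟩ : (∏ j ∈ s, x j) ∣ ∏ j ∈ t, x j := Finset.prod_dvd_prod_of_subset s t x h
  have h2 : (∏ j ∈ t, x j) ^ k = (∏ j ∈ s, x j) ^ k * c ^ k := by rw [hc, mul_pow]
  rw [h2, map_mul] at h1
  exact ((Algebra.commute_algebraMap_left _ _).isUnit_mul_iff.1 h1).1

/-- The natural map `N_{x_s} → N_{x_t}` for `s ⊆ t`. -/
def cechRes {s t : Finset (Fin n)} (h : s ⊆ t) : CechLoc x N s →ₗ[A] CechLoc x N t :=
  LocalizedModule.lift _ (LocalizedModule.mkLinearMap _ N) (isUnit_powers_of_subset x N h)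

/-- The Čech module `C^i = ⨁_{j_1 < ⋯ < j_i} N_{x_{j_1} ⋯ x_{j_i}}`; in particular `C^0 = N`. -/
abbrev CechTerm (i : ℕ) : Type _ :=
  (s : {s : Finset (Fin n) // s.card = i}) → CechLoc x N s.1

/-- The Čech differential: the component at `s = {j_0 < ⋯ < j_i}` of the image of `c` is
`∑_k (-1)^k c_{s ∖ {j_k}}`. -/
def cechD (i : ℕ) : CechTerm x N i →ₗ[A] CechTerm x N (i + 1) :=
  LinearMap.pi fun s => ∑ j : {j // j ∈ s.1},
    (-1 : A) ^ (s.1.filter (· < j.1)).card •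
      (cechRes x N (s.1.erase_subset j.1)).comp
        (LinearMap.proj (⟨s.1.erase j.1, by
          rw [Finset.card_erase_of_mem j.2, s.2, Nat.add_sub_cancel]⟩ :
            {s : Finset (Fin n) // s.card = i}))

/-- The homogeneous elements of degree `μ` of `N_{x_s}`: the fractions `u / x_s ^ k` with `u`
homogeneous of degree `μ + k deg x_s`. -/
def cechLocDeg (s : Finset (Fin n)) (μ : ℤ) : AddSubgroup (CechLoc x N s) :=
  AddSubgroup.closure {z | ∃ (k : ℕ) (u : N), u ∈ 𝒩 (μ + k * ∑ j ∈ s, (w j : ℤ)) ∧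
    z = LocalizedModule.mk u (⟨(∏ j ∈ s, x j) ^ k, k, rfl⟩ : Submonoid.powers (∏ j ∈ s, x j))}

/-- The degree `μ` part of the Čech module `C^i`. -/
def cechTermDeg (i : ℕ) (μ : ℤ) : AddSubgroup (CechTerm x N i) :=
  AddSubgroup.pi Set.univ fun s => cechLocDeg x w N 𝒩 s.1 μ

/-- The degree `μ` cocycles in `C^i`. -/
def cechCocycles (i : ℕ) (μ : ℤ) : AddSubgroup (CechTerm x N i) :=
  cechTermDeg x w N 𝒩 i μ ⊓ (cechD x N i).toAddMonoidHom.ker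

/-- The degree `μ` coboundaries in `C^i`. -/
def cechCoboundaries : (i : ℕ) → (μ : ℤ) → AddSubgroup (CechTerm x N i)
  | 0, _ => ⊥
  | i + 1, μ => (cechTermDeg x w N 𝒩 i μ).map (cechD x N i).toAddMonoidHom

/-- The degree `μ` part of the local cohomology module `H^i_{(x_1, …, x_n)}(N)`, computed by the
graded Čech complex. -/
abbrev CechCohomology (i : ℕ) (μ : ℤ) : Type _ :=
  cechCocycles x w N 𝒩 i μ ⧸
    (cechCoboundaries x w N 𝒩 i μ).addSubgroupOf (cechCocycles x w N 𝒩 i μ)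

/-- `a^i(N) = sup {μ | H^i(N)_μ ≠ 0}`, which is `-∞` if `H^i(N) = 0`. -/
def aInv (i : ℕ) : EReal :=
  ⨆ μ ∈ {μ : ℤ | Nontrivial (CechCohomology x w N 𝒩 i μ)}, ((μ : ℝ) : EReal)

end Cech

/-! ### The quotient grading -/

section QuotientGrading

variable {K R : Type*} [CommRing K] [CommRing R] [Algebra K R] (𝒢 : ℕ → Submodule K R)

/-- The grading induced on the quotient by an ideal: images of the homogeneous components. -/
def quotientGrading (I : Ideal R) (k : ℕ) : Submodule K (R ⧸ I) :=
  (𝒢 k).map (Ideal.Quotient.mkₐ K I).toLinearMap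

variable [GradedAlgebra 𝒢]

instance quotientGrading_gradedMonoid (I : Ideal R) :
    SetLike.GradedMonoid (quotientGrading 𝒢 I) where
  one_mem := ⟨1, SetLike.one_mem_graded 𝒢, map_one (Ideal.Quotient.mkₐ K I)⟩
  mul_mem := by
    rintro i j _ _ ⟨a, ha, rfl⟩ ⟨b, hb, rfl⟩
    exact ⟨a * b, SetLike.mul_mem_graded ha hb, map_mul (Ideal.Quotient.mkₐ K I) a b⟩

/-- The projection of a homogeneous component onto its image in the quotient. -/
def quotientGradingProj (I : Ideal R) (k : ℕ) : 𝒢 k →ₗ[K] quotientGrading 𝒢 I k :=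
  (Ideal.Quotient.mkₐ K I).toLinearMap.restrict fun a ha => ⟨a, ha, rfl⟩

/-- The decomposition of the quotient by a homogeneous ideal. -/
def quotientDecompose (I : Ideal R) (hI : I.IsHomogeneous 𝒢) :
    (R ⧸ I) →+ DirectSum ℕ fun k => quotientGrading 𝒢 I k :=
  QuotientAddGroup.lift I.toAddSubgroup
    (((DirectSum.lmap (quotientGradingProj 𝒢 I)).comp
      (DirectSum.decomposeLinearEquiv 𝒢).toLinearMap).toAddMonoidHom) (by
    intro a ha
    ext k
    simp only [LinearMap.toAddMonoidHom_coe, LinearMap.comp_apply, DirectSum.lmap_apply]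
    exact Ideal.Quotient.eq_zero_iff_mem.2 (hI k ha))

theorem quotientDecompose_mk (I : Ideal R) (hI : I.IsHomogeneous 𝒢) (a : R) :
    quotientDecompose 𝒢 I hI (Ideal.Quotient.mk I a) =
      DirectSum.lmap (quotientGradingProj 𝒢 I) (DirectSum.decompose 𝒢 a) := rfl

/-- The quotient of a graded algebra by a homogeneous ideal is graded. -/
abbrev quotientGradedAlgebra (I : Ideal R) (hI : I.IsHomogeneous 𝒢) :
    GradedAlgebra (quotientGrading 𝒢 I) where
  toDecomposition := DirectSum.Decomposition.ofAddHom _ (quotientDecompose 𝒢 I hI)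
    (by
      refine AddMonoidHom.ext fun a => ?_
      obtain ⟨a, rfl⟩ := Ideal.Quotient.mk_surjective a
      classical
      induction a using DirectSum.Decomposition.inductionOn 𝒢 with
      | zero => simp
      | homogeneous a =>
        rw [AddMonoidHom.comp_apply, quotientDecompose_mk, DirectSum.decompose_coe]
        erw [DirectSum.lmap_lof]
        erw [DirectSum.coeAddMonoidHom_of]
        rfl
      | add a b ha hb => rw [map_add, map_add, ha, hb, map_add])
    (by
      refine DirectSum.addHom_ext fun k y => ?_
      obtain ⟨_, a, ha, rfl⟩ := y
      rw [AddMonoidHom.comp_apply, DirectSum.coeAddMonoidHom_of]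
      erw [quotientDecompose_mk]
      rw [DirectSum.decompose_of_mem 𝒢 ha]
      erw [DirectSum.lmap_lof]
      rfl)

end QuotientGrading

/-! ### The Rees module and its stalks -/

section Rees

variable {A : Type*} [CommRing A]

/-- The map `ψ : A[T_1, …, T_r] → 𝓡_I = ⨁ I^t`, sending `T_i` to `f_i ∈ I = (𝓡_I)_1`.  The Rees
algebra is Mathlib's subalgebra `⨁ I^t X^t` of `A[X]`. -/
def reesMap {I : Ideal A} {r : ℕ} (f : Fin r → I) :
    MvPolynomial (Fin r) A →ₐ[A] reesAlgebra I :=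
  MvPolynomial.aeval fun i => ⟨Polynomial.monomial 1 (f i : A),
    reesAlgebra.monomial_mem.2 (by rw [pow_one]; exact (f i).2)⟩

variable (𝒜 : ℤ → AddSubgroup A) [GradedRing 𝒜]

/-- The subring `A_0` of `A`. -/
abbrev degZero : Subring A := SetLike.GradeZero.subring 𝒜

/-- `B = A_0[T_1, …, T_m]`. -/
abbrev BRing (m : ℕ) : Type _ := MvPolynomial (Fin m) (degZero 𝒜)

/-- The inclusion of `B = A_0[T_1, …, T_m]` into `A[T_1, …, T_r]`, where `m ≤ r`. -/
def bIncl {m r : ℕ} (hmr : m ≤ r) : BRing 𝒜 m →+* MvPolynomial (Fin r) A :=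
  (MvPolynomial.rename (Fin.castLE hmr)).toRingHom.comp
    (MvPolynomial.map (algebraMap (degZero 𝒜) A))

variable {m r : ℕ} (hmr : m ≤ r) {I : Ideal A} (f : Fin r → I)
  (M : Type*) [AddCommGroup M] [Module A M]

/-- The Rees module `M𝓡_I = ⨁_t M I^t`, realised as the set of `∑ u_t X^t ∈ M[X]` with
`u_t ∈ I^t M` for all `t`.  It is a module over `𝓡_I`, over `A[T_1, …, T_r]` through `ψ`, and so
over `A` and over `B = A_0[T_1, …, T_m]`. -/
@[nolint unusedArguments]
def ReesModule (_hmr : m ≤ r) {I : Ideal A} (_f : Fin r → I)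
    (M : Type*) [AddCommGroup M] [Module A M] : Type _ :=
  (I.stableFiltration (⊤ : Submodule A M)).submodule

namespace ReesModule

instance : AddCommGroup (ReesModule hmr f M) :=
  inferInstanceAs (AddCommGroup (I.stableFiltration (⊤ : Submodule A M)).submodule)

instance : Module (reesAlgebra I) (ReesModule hmr f M) :=
  inferInstanceAs (Module (reesAlgebra I) (I.stableFiltration (⊤ : Submodule A M)).submodule)

instance : Module (MvPolynomial (Fin r) A) (ReesModule hmr f M) :=
  Module.compHom _ (reesMap f).toRingHom

instance : Module A (ReesModule hmr f M) :=
  Module.compHom _ (MvPolynomial.C : A →+* MvPolynomial (Fin r) A)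

instance : Module (BRing 𝒜 m) (ReesModule hmr f M) :=
  Module.compHom _ (bIncl 𝒜 hmr)

end ReesModule

/-- `B' = B / ann_B(M𝓡_I)`. -/
abbrev BPrime : Type _ :=
  BRing 𝒜 m ⧸ Module.annihilator (BRing 𝒜 m) (ReesModule hmr f M)

instance : Module (BPrime 𝒜 hmr f M) (ReesModule hmr f M) := Module.quotientAnnihilator

instance : SMulCommClass (BPrime 𝒜 hmr f M) A (ReesModule hmr f M) where
  smul_comm b a u := by
    obtain ⟨b, rfl⟩ := Ideal.Quotient.mk_surjective b
    exact smul_comm (reesMap f (bIncl 𝒜 hmr b)) (reesMap f (MvPolynomial.C a)) u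

instance : SMulCommClass A (BPrime 𝒜 hmr f M) (ReesModule hmr f M) := SMulCommClass.symm _ _ _

/-- The first grading of `M𝓡_I = ⨁_t M I^t(dt)`: the elements of degree `μ` are the
`∑ u_t X^t` with `u_t ∈ (M I^t)_{μ + td}`. -/
def reesDeg {M : Type*} [AddCommGroup M] [Module A M] (ℳ : ℤ → AddSubgroup M) (d : ℕ) (μ : ℤ) :
    AddSubgroup (ReesModule hmr f M) where
  carrier := {u | ∀ t : ℕ, u.1.coeff t ∈ ℳ (μ + t * d)}
  add_mem' hu hv t := add_mem (hu t) (hv t)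
  zero_mem' t := zero_mem _
  neg_mem' {u} hu t := by
    have h : (-u).1.coeff t + u.1.coeff t = 0 :=
      congrArg (fun v : ReesModule hmr f M => v.1.coeff t) (neg_add_cancel u)
    rw [eq_neg_of_add_eq_zero_left h]
    exact neg_mem (hu t)

/-- The standard grading on `B'`, in which the classes of `T_1, …, T_m` have degree one. -/
def bPrimeGrading : ℕ → Submodule (degZero 𝒜) (BPrime 𝒜 hmr f M) :=
  quotientGrading (MvPolynomial.homogeneousSubmodule (Fin m) (degZero 𝒜)) _

theorem reesMap_bIncl_monomial (e : Fin m →₀ ℕ) (c : degZero 𝒜) :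
    (reesMap f (bIncl 𝒜 hmr (MvPolynomial.monomial e c)) : Polynomial A) =
      Polynomial.monomial e.degree
        (c * ∏ i, ((f (Fin.castLE hmr i) : I) : A) ^ e i) := by
  have h1 : bIncl 𝒜 hmr (MvPolynomial.monomial e c) =
      MvPolynomial.C (c : A) * ∏ i, MvPolynomial.X (Fin.castLE hmr i) ^ e i := by
    rw [MvPolynomial.monomial_eq, Finsupp.prod_fintype _ _ (fun i => pow_zero _)]
    simp [bIncl, map_prod]
    rfl
  rw [h1, map_mul, map_prod]
  simp only [map_pow, reesMap, MvPolynomial.aeval_X, MvPolynomial.aeval_C]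
  rw [Subalgebra.coe_mul, SubmonoidClass.coe_finsetProd]
  simp only [SubmonoidClass.coe_pow, Polynomial.monomial_pow, one_mul]
  have h2 : ∀ s : Finset (Fin m),
      (∏ i ∈ s, Polynomial.monomial (e i) ((f (Fin.castLE hmr i) : A) ^ e i)) =
        Polynomial.monomial (∑ i ∈ s, e i) (∏ i ∈ s, (f (Fin.castLE hmr i) : A) ^ e i) := by
    intro s
    induction s using Finset.induction_on with
    | empty => simp
    | insert a s ha ih =>
      rw [Finset.prod_insert ha, Finset.prod_insert ha, Finset.sum_insert ha, ih,
        Polynomial.monomial_mul_monomial]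
  rw [h2, Finsupp.degree_eq_sum]
  exact Polynomial.C_mul_monomial

theorem reesMap_bIncl_homogeneousComponent (b : BRing 𝒜 m) (k : ℕ) :
    (reesMap f (bIncl 𝒜 hmr (MvPolynomial.homogeneousComponent k b)) : Polynomial A) =
      Polynomial.monomial k ((reesMap f (bIncl 𝒜 hmr b) : Polynomial A).coeff k) := by
  induction b using MvPolynomial.induction_on' with
  | monomial e c =>
    rw [MvPolynomial.homogeneousComponent_of_mem (MvPolynomial.isHomogeneous_monomial c rfl)]
    rw [reesMap_bIncl_monomial, Polynomial.coeff_monomial]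
    split_ifs with h1 h2 h2
    · rw [reesMap_bIncl_monomial, h1]
    · exact absurd h1.symm h2
    · exact absurd h2.symm h1
    · simp
  | add p q hp hq =>
    simp only [map_add, Subalgebra.coe_add, hp, hq, Polynomial.coeff_add]

theorem mem_annihilator_iff (b : BRing 𝒜 m) :
    b ∈ Module.annihilator (BRing 𝒜 m) (ReesModule hmr f M) ↔
      ∀ u ∈ (I.stableFiltration (⊤ : Submodule A M)).submodule,
        (reesMap f (bIncl 𝒜 hmr b) : Polynomial A) • u = 0 := by
  rw [Module.mem_annihilator]
  exact ⟨fun h u hu => congrArg Subtype.val (h ⟨u, hu⟩), fun h u => Subtype.ext (h u.1 u.2)⟩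

theorem annihilator_isHomogeneous :
    letI := MvPolynomial.gradedAlgebra (σ := Fin m) (R := degZero 𝒜)
    (Module.annihilator (BRing 𝒜 m) (ReesModule hmr f M)).IsHomogeneous
      (MvPolynomial.homogeneousSubmodule (Fin m) (degZero 𝒜)) := by
  let _ := MvPolynomial.gradedAlgebra (σ := Fin m) (R := degZero 𝒜)
  intro k b hb
  have key : ((DirectSum.decompose (MvPolynomial.homogeneousSubmodule (Fin m) (degZero 𝒜)) b) k :
      BRing 𝒜 m) = MvPolynomial.homogeneousComponent k b :=
    MvPolynomial.decomposition.decompose'_apply b k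
  rw [key]
  rw [mem_annihilator_iff] at hb ⊢
  intro u hu
  rw [reesMap_bIncl_homogeneousComponent]
  ext j
  rw [PolynomialModule.monomial_smul_apply]
  split_ifs with hj
  · have hs : PolynomialModule.single A (j - k) (u.coeff (j - k)) ∈
        (I.stableFiltration (⊤ : Submodule A M)).submodule := by
      intro i
      rw [PolynomialModule.coeff_single, Finsupp.single_apply]
      split_ifs with h
      · exact h ▸ hu _
      · exact zero_mem _
    have h := congrArg (fun v => v.coeff j) (hb _ hs)
    simp only [PolynomialModule.smul_single_apply] at h
    rwa [if_pos (Nat.sub_le j k), Nat.sub_sub_self hj] at h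
  · rfl

instance : GradedAlgebra (bPrimeGrading 𝒜 hmr f M) :=
  letI := MvPolynomial.gradedAlgebra (σ := Fin m) (R := degZero 𝒜)
  quotientGradedAlgebra _ _ (annihilator_isHomogeneous 𝒜 hmr f M)

/-- `Proj(B')`: the homogeneous primes of `B'` that do not contain `B'_+`. -/
abbrev ProjBPrime : Type _ := ProjectiveSpectrum (bPrimeGrading 𝒜 hmr f M)

variable (q : ProjBPrime 𝒜 hmr f M)

/-- `M𝓡_I ⊗_{B'} B'_𝔮`, an `A`-module. -/
abbrev ReesStalk : Type _ :=
  ReesModule hmr f M ⊗[BPrime 𝒜 hmr f M] Localization.AtPrime q.asHomogeneousIdeal.toIdeal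

/-- The grading of `M𝓡_I ⊗_{B'} B'_𝔮` given by the first grading of `M𝓡_I`; here `B'_𝔮` is
concentrated in degree zero. -/
def reesStalkDeg (ℳ : ℤ → AddSubgroup M) (d : ℕ) (μ : ℤ) : AddSubgroup (ReesStalk 𝒜 hmr f M q) :=
  AddSubgroup.closure {z | ∃ u ∈ reesDeg hmr f ℳ d μ,
    ∃ c : Localization.AtPrime q.asHomogeneousIdeal.toIdeal, z = u ⊗ₜ c}

end Rees

section Powers

variable {A : Type*} [CommRing A] (I : Ideal A) {M : Type*} [AddCommGroup M] [Module A M]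

/-- The grading of `I^t M` induced from `M`. -/
def powDeg (ℳ : ℤ → AddSubgroup M) (t : ℕ) (μ : ℤ) :
    AddSubgroup (I ^ t • (⊤ : Submodule A M) : Submodule A M) :=
  (ℳ μ).comap (I ^ t • (⊤ : Submodule A M)).subtype.toAddMonoidHom

end Powers

end PowersCohomology

end

open PowersCohomology Filter Topology

/-! Write 𝓜 for the Rees module `M𝓡_I`. In its first grading, the degree `μ` part of the `t`-th
summand is `(MI^t)_{μ+td}`, so the Čech cohomology satisfies `H^i(𝓜)_μ = ⨁_t H^i(MI^t)_{μ+td}`. The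
variables `T_1, …, T_m` have degree `d - d = 0` for `μ` and raise `t` by one. For fixed `μ`, the
strand `H^i(𝓜)_μ` is therefore a `B`-module graded by `t`, and `a^i(MI^t) - td` is the largest `μ`
for which the `t`-th part of the strand is nonzero.

The theorem rests on three facts.

Finiteness: each strand is Noetherian over `B`, and the strands vanish for all `μ` above some bound.
The reduction hypothesis makes 𝓜 finite over `A[T_1, …, T_r]` (`ReesModule.finite`). There the `x_j`
have positive degree, the `T_l` with `l > m` have negative degree `d_l - d`, and `B` has degree
zero. The dévissage `finiteCohomology_of_finite` takes the kernel and cokernel of one `x_j` at a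
time: modulo them `x_j` is injective on cohomology, whereas every class is killed by a power of
`x_j`. Once all `x_j` act as zero, the module itself is the cohomology. It is bounded above, and its
components are Noetherian by a second dévissage along the `T_l` with `l > m`
(`isNoetherian_component`).

Stability: a finitely generated `B`-module graded by `t` is zero in all large `t` or nonzero in all
large `t` (`ReesModule.eventually_or_eventually`). Hence whether `μ` counts towards `a^i(MI^t) - td`
is eventually independent of `t`. With the uniform upper bound, the suprema converge to the supremum
of the set `G` of surviving degrees (`tendsto_iSup_int`).

Localization: Čech cohomology commutes with localization at `𝔮` (`cocycles_stalk_le_iff`). A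
finitely generated graded module is zero for large `t` exactly when all its localizations at points
of `Proj` vanish (`ReesModule.cocycles_stalk_le` and `ReesModule.exists_not_cocycles_stalk_le`). So
`G` is the union over `𝔮` of the degrees in which the stalk at `𝔮` has cohomology, and its largest
element, if any, is reached at one stalk. -/

noncomputable section

universe v

namespace PowersCohomology

/-! ### Explicit fractions in the Čech modules, and functoriality -/

section Fractions

variable {A : Type*} [CommRing A] {n : ℕ} (x : Fin n → A) (w : Fin n → ℕ)
  {N N' N'' : Type*} [AddCommGroup N] [Module A N] [AddCommGroup N'] [Module A N']
  [AddCommGroup N''] [Module A N'']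

/-- The fraction `u / x_s ^ k`. -/
def frac (s : Finset (Fin n)) (k : ℕ) : N →ₗ[A] CechLoc x N s where
  toFun u := LocalizedModule.mk u
    (⟨(∏ j ∈ s, x j) ^ k, k, rfl⟩ : Submonoid.powers (∏ j ∈ s, x j))
  map_add' u v := by
    rw [LocalizedModule.mk_add_mk, ← smul_add, LocalizedModule.mk_cancel_common_left]
  map_smul' a u := by rw [RingHom.id_apply, LocalizedModule.smul'_mk]

theorem frac_def (s : Finset (Fin n)) (k : ℕ) (u : N) : frac x s k u = LocalizedModule.mk u
    (⟨(∏ j ∈ s, x j) ^ k, k, rfl⟩ : Submonoid.powers (∏ j ∈ s, x j)) := rfl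

theorem exists_eq_frac (s : Finset (Fin n)) (z : CechLoc x N s) :
    ∃ k u, z = frac x s k u := by
  induction z using LocalizedModule.induction_on with
  | h u y =>
    obtain ⟨y, k, rfl⟩ := y
    exact ⟨k, u, rfl⟩

theorem frac_raise (s : Finset (Fin n)) (k l : ℕ) (u : N) :
    frac x s (k + l) ((∏ j ∈ s, x j) ^ l • u) = frac x s k u := by
  have := LocalizedModule.mk_cancel_common_left
    (⟨(∏ j ∈ s, x j) ^ l, l, rfl⟩ : Submonoid.powers (∏ j ∈ s, x j))
    (⟨(∏ j ∈ s, x j) ^ k, k, rfl⟩ : Submonoid.powers (∏ j ∈ s, x j)) u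
  rw [frac_def, frac_def, ← this]
  congr 1
  exact Subtype.ext ((pow_add _ k l).trans (mul_comm _ _))

theorem frac_eq_zero {s : Finset (Fin n)} {k : ℕ} {u : N} :
    frac x s k u = 0 ↔ ∃ l, (∏ j ∈ s, x j) ^ l • u = 0 := by
  rw [frac_def, ← LocalizedModule.zero_mk 1, LocalizedModule.mk_eq]
  constructor
  · rintro ⟨⟨_, l, rfl⟩, h⟩
    refine ⟨l, ?_⟩
    simpa [Submonoid.smul_def] using h
  · rintro ⟨l, h⟩
    refine ⟨⟨_, l, rfl⟩, ?_⟩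
    simpa [Submonoid.smul_def] using h

theorem prod_pow_smul_frac (s : Finset (Fin n)) (k : ℕ) (u : N) :
    (∏ j ∈ s, x j) ^ k • frac x s k u = frac x s 0 u := by
  rw [← map_smul, ← frac_raise x s 0 k u, zero_add]

/-- Multiplication by `x_s ^ k` is injective on `N_{x_t}` and turns both sides into `u / 1`, where
the universal property decides. With this formula every later computation takes place on numerators.
-/
theorem cechRes_frac {s t : Finset (Fin n)} (h : s ⊆ t) (k : ℕ) (u : N) :
    cechRes x N h (frac x s k u) = frac x t k ((∏ j ∈ t \ s, x j) ^ k • u) := by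
  have hinj : Function.Injective fun z : CechLoc x N t => (∏ j ∈ s, x j) ^ k • z :=
    ((Module.End.isUnit_iff _).1 (isUnit_powers_of_subset x N h
      ⟨(∏ j ∈ s, x j) ^ k, k, rfl⟩)).1
  have h0 : cechRes x N h (frac x s 0 u) = frac x t 0 u := by
    have := LinearMap.congr_fun (LocalizedModule.lift_comp (Submonoid.powers (∏ j ∈ s, x j))
      (LocalizedModule.mkLinearMap (Submonoid.powers (∏ j ∈ t, x j)) N)
      (isUnit_powers_of_subset x N h)) u
    have e : ∀ r : Finset (Fin n), frac x r 0 u =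
        LocalizedModule.mkLinearMap (Submonoid.powers (∏ j ∈ r, x j)) N u := by
      intro r
      rw [frac_def, LocalizedModule.mkLinearMap_apply]
      congr 1
      exact Subtype.ext (pow_zero _)
    rw [e, e]
    exact this
  apply hinj
  simp only
  rw [← map_smul, prod_pow_smul_frac, h0, ← map_smul, ← mul_smul, ← mul_pow,
    mul_comm (∏ j ∈ s, x j), Finset.prod_sdiff h, map_smul, prod_pow_smul_frac]

theorem cechRes_cechRes {s t r : Finset (Fin n)} (h : s ⊆ t) (h' : t ⊆ r) (z : CechLoc x N s) :
    cechRes x N h' (cechRes x N h z) = cechRes x N (h.trans h') z := by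
  obtain ⟨k, u, rfl⟩ := exists_eq_frac x s z
  rw [cechRes_frac, cechRes_frac, cechRes_frac, ← mul_smul, ← mul_pow]
  congr 3
  rw [← Finset.prod_union]
  · congr 1
    ext j
    simp only [Finset.mem_union, Finset.mem_sdiff]
    constructor
    · rintro (⟨a, b⟩ | ⟨a, b⟩)
      · exact ⟨a, fun hs => b (h hs)⟩
      · exact ⟨h' a, b⟩
    · rintro ⟨a, b⟩
      by_cases hj : j ∈ t
      · exact Or.inr ⟨hj, b⟩
      · exact Or.inl ⟨a, hj⟩
  · rw [Finset.disjoint_left]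
    intro j hj hj'
    exact (Finset.mem_sdiff.1 hj).2 (Finset.mem_sdiff.1 hj').1

theorem cechRes_self {s : Finset (Fin n)} (h : s ⊆ s) (z : CechLoc x N s) :
    cechRes x N h z = z := by
  obtain ⟨k, u, rfl⟩ := exists_eq_frac x s z
  rw [cechRes_frac, Finset.sdiff_self, Finset.prod_empty, one_pow, one_smul]

/-- The map of localizations induced by a linear map. -/
def locMap (s : Finset (Fin n)) (φ : N →ₗ[A] N') : CechLoc x N s →ₗ[A] CechLoc x N' s :=
  IsLocalizedModule.map (Submonoid.powers (∏ j ∈ s, x j))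
    (LocalizedModule.mkLinearMap _ N) (LocalizedModule.mkLinearMap _ N') φ

@[simp]
theorem locMap_frac (s : Finset (Fin n)) (φ : N →ₗ[A] N') (k : ℕ) (u : N) :
    locMap x s φ (frac x s k u) = frac x s k (φ u) :=
  IsLocalizedModule.map_LocalizedModules _ φ u _

theorem cechRes_locMap {s t : Finset (Fin n)} (h : s ⊆ t) (φ : N →ₗ[A] N') (z : CechLoc x N s) :
    cechRes x N' h (locMap x s φ z) = locMap x t φ (cechRes x N h z) := by
  obtain ⟨k, u, rfl⟩ := exists_eq_frac x s z
  rw [locMap_frac, cechRes_frac, cechRes_frac, locMap_frac, map_smul φ]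

/-- The action of linear maps on Čech modules. -/
def cechMap (i : ℕ) (φ : N →ₗ[A] N') : CechTerm x N i →ₗ[A] CechTerm x N' i :=
  LinearMap.pi fun s => (locMap x s.1 φ).comp (LinearMap.proj s)

@[simp]
theorem cechMap_apply (i : ℕ) (φ : N →ₗ[A] N') (c : CechTerm x N i) (s) :
    cechMap x i φ c s = locMap x s.1 φ (c s) := rfl

theorem locMap_id (s : Finset (Fin n)) (z : CechLoc x N s) :
    locMap x s (LinearMap.id : N →ₗ[A] N) z = z := by
  obtain ⟨k, u, rfl⟩ := exists_eq_frac x s z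
  simp

theorem locMap_comp (s : Finset (Fin n)) (ψ : N' →ₗ[A] N'') (φ : N →ₗ[A] N')
    (z : CechLoc x N s) : locMap x s (ψ ∘ₗ φ) z = locMap x s ψ (locMap x s φ z) := by
  obtain ⟨k, u, rfl⟩ := exists_eq_frac x s z
  simp

theorem locMap_add (s : Finset (Fin n)) (φ ψ : N →ₗ[A] N') (z : CechLoc x N s) :
    locMap x s (φ + ψ) z = locMap x s φ z + locMap x s ψ z := by
  obtain ⟨k, u, rfl⟩ := exists_eq_frac x s z
  simp

theorem locMap_zero (s : Finset (Fin n)) (z : CechLoc x N s) :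
    locMap x s (0 : N →ₗ[A] N') z = 0 := by
  obtain ⟨k, u, rfl⟩ := exists_eq_frac x s z
  simp

theorem locMap_smul_id (s : Finset (Fin n)) (a : A) (z : CechLoc x N s) :
    locMap x s (a • (LinearMap.id : N →ₗ[A] N)) z = a • z := by
  obtain ⟨k, u, rfl⟩ := exists_eq_frac x s z
  simp

theorem cechMap_id (i : ℕ) (c : CechTerm x N i) :
    cechMap x i (LinearMap.id : N →ₗ[A] N) c = c := by
  ext s : 1
  exact locMap_id x s.1 _

theorem cechMap_comp (i : ℕ) (ψ : N' →ₗ[A] N'') (φ : N →ₗ[A] N') (c : CechTerm x N i) :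
    cechMap x i (ψ ∘ₗ φ) c = cechMap x i ψ (cechMap x i φ c) := by
  ext s : 1
  exact locMap_comp x s.1 _ _ _

theorem cechMap_add (i : ℕ) (φ ψ : N →ₗ[A] N') (c : CechTerm x N i) :
    cechMap x i (φ + ψ) c = cechMap x i φ c + cechMap x i ψ c := by
  ext s : 1
  exact locMap_add x s.1 _ _ _

theorem cechMap_zero (i : ℕ) (c : CechTerm x N i) : cechMap x i (0 : N →ₗ[A] N') c = 0 := by
  ext s : 1
  exact locMap_zero x s.1 _

theorem cechMap_sum (i : ℕ) {ι : Type*} (F : Finset ι) (φ : ι → N →ₗ[A] N') (c : CechTerm x N i) :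
    cechMap x i (∑ a ∈ F, φ a) c = ∑ a ∈ F, cechMap x i (φ a) c := by
  classical
  induction F using Finset.induction_on with
  | empty => simpa using cechMap_zero x i c
  | insert a F ha ih => rw [Finset.sum_insert ha, Finset.sum_insert ha, cechMap_add, ih]

theorem cechD_apply (i : ℕ) (c : CechTerm x N i) (s : {s : Finset (Fin n) // s.card = i + 1}) :
    cechD x N i c s = ∑ j : {j // j ∈ s.1}, (-1 : A) ^ (s.1.filter (· < j.1)).card •
      cechRes x N (s.1.erase_subset j.1) (c ⟨s.1.erase j.1, by
          rw [Finset.card_erase_of_mem j.2, s.2, Nat.add_sub_cancel]⟩) := by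
  simp [cechD]

theorem cechD_cechMap (i : ℕ) (φ : N →ₗ[A] N') (c : CechTerm x N i) :
    cechD x N' i (cechMap x i φ c) = cechMap x (i + 1) φ (cechD x N i c) := by
  ext s : 1
  rw [cechD_apply, cechMap_apply, cechD_apply, map_sum]
  refine Finset.sum_congr rfl fun j _ => ?_
  rw [map_smul, cechMap_apply, cechRes_locMap]

/-! ### The square of the differential -/

/-- The image in `N_{x_t}` of the component `c_s` of a Čech cochain, read as `0` if it is not
defined. -/
def cechComp {i : ℕ} (c : CechTerm x N i) (s t : Finset (Fin n)) : CechLoc x N t :=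
  if h : s.card = i ∧ s ⊆ t then cechRes x N h.2 (c ⟨s, h.1⟩) else 0

theorem cechComp_self {i : ℕ} (c : CechTerm x N i) (s : {s : Finset (Fin n) // s.card = i}) :
    cechComp x c s.1 s.1 = c s := by
  rw [cechComp, dif_pos ⟨s.2, subset_rfl⟩, cechRes_self]

theorem cechComp_add {i : ℕ} (c c' : CechTerm x N i) (s t : Finset (Fin n)) :
    cechComp x (c + c') s t = cechComp x c s t + cechComp x c' s t := by
  unfold cechComp
  split_ifs <;> simp

theorem cechComp_zero {i : ℕ} (s t : Finset (Fin n)) :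
    cechComp x (0 : CechTerm x N i) s t = 0 := by
  unfold cechComp
  split_ifs <;> simp

/-- The sign of `j` in the Čech differential. -/
def cechSign (s : Finset (Fin n)) (j : Fin n) : A := (-1) ^ (s.filter (· < j)).card

theorem cechSign_mul_self (s : Finset (Fin n)) (j : Fin n) :
    (cechSign s j : A) * cechSign s j = 1 := by
  rw [cechSign, ← mul_pow]
  simp

/-- Extended components are indexed by arbitrary finite sets, without cardinality proofs. The
differential becomes an ordinary sum over `s`, read in any larger localization, which can be
reindexed freely. -/
theorem cechComp_cechD {i : ℕ} (c : CechTerm x N i) {s t : Finset (Fin n)} (hs : s.card = i + 1)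
    (h : s ⊆ t) : cechComp x (cechD x N i c) s t =
      ∑ j ∈ s, (cechSign s j : A) • cechComp x c (s.erase j) t := by
  rw [cechComp, dif_pos ⟨hs, h⟩, cechD_apply, map_sum, ← Finset.sum_coe_sort s]
  refine Finset.sum_congr rfl fun j _ => ?_
  rw [map_smul, cechRes_cechRes, cechComp, dif_pos ⟨by
    rw [Finset.card_erase_of_mem j.2, hs, Nat.add_sub_cancel], (s.erase_subset _).trans h⟩]
  rfl

theorem cechSign_erase_of_lt {s : Finset (Fin n)} {j k : Fin n} (hj : j ∈ s) (h : j < k) :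
    (cechSign (s.erase j) k : A) = - cechSign s k := by
  have : (s.filter (· < k)).card = ((s.erase j).filter (· < k)).card + 1 := by
    rw [Finset.filter_erase, Finset.card_erase_add_one]
    exact Finset.mem_filter.2 ⟨hj, h⟩
  rw [cechSign, cechSign, this, pow_succ]
  ring

theorem cechSign_erase_of_gt {s : Finset (Fin n)} {j k : Fin n} (h : k < j) :
    (cechSign (s.erase j) k : A) = cechSign s k := by
  rw [cechSign, cechSign, Finset.filter_erase, Finset.erase_eq_of_notMem]
  simp [h.le]

/-- Removing the smaller of two indices lowers the position of the larger by one, while removing the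
larger leaves the position of the smaller unchanged. The two orders of removal thus differ by one
sign. -/
theorem cechSign_erase {s : Finset (Fin n)} {j k : Fin n} (hj : j ∈ s) (hk : k ∈ s) (h : j ≠ k) :
    (cechSign s j : A) * cechSign (s.erase j) k = -(cechSign s k * cechSign (s.erase k) j) := by
  rcases lt_or_gt_of_ne h with h | h
  · rw [cechSign_erase_of_lt hj h, cechSign_erase_of_gt h]
    ring
  · rw [cechSign_erase_of_lt hk h, cechSign_erase_of_gt h]
    ring

theorem cechD_cechD (i : ℕ) (c : CechTerm x N i) : cechD x N (i + 1) (cechD x N i c) = 0 := by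
  ext s : 1
  refine (cechComp_self x _ s).symm.trans ?_
  rw [cechComp_cechD x _ s.2 subset_rfl]
  have h1 : ∀ j ∈ s.1, (cechSign s.1 j : A) • cechComp x (cechD x N i c) (s.1.erase j) s.1 =
      ∑ k ∈ s.1.erase j, ((cechSign s.1 j : A) * cechSign (s.1.erase j) k) •
        cechComp x c ((s.1.erase j).erase k) s.1 := by
    intro j hj
    rw [cechComp_cechD x c (by rw [Finset.card_erase_of_mem hj, s.2, Nat.add_sub_cancel])
      (s.1.erase_subset _), Finset.smul_sum]
    exact Finset.sum_congr rfl fun k _ => (mul_smul _ _ _).symm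
  rw [Finset.sum_congr rfl h1, Finset.sum_sigma']
  -- The pairs `(j, k)` and `(k, j)` remove the same two indices, and their terms cancel.
  refine Finset.sum_involution (fun p _ => ⟨p.2, p.1⟩) ?_ ?_ ?_ ?_
  · rintro ⟨j, k⟩ hp
    simp only [Finset.mem_sigma, Finset.mem_erase] at hp
    simp only
    rw [cechSign_erase hp.1 hp.2.2 (Ne.symm hp.2.1), Finset.erase_right_comm, neg_smul,
      neg_add_cancel]
  · rintro ⟨j, k⟩ hp _ heq
    simp only [Finset.mem_sigma, Finset.mem_erase] at hp
    simp only [Sigma.mk.injEq, heq_eq_eq] at heq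
    exact hp.2.1 heq.1
  · rintro ⟨j, k⟩ hp
    simp only [Finset.mem_sigma, Finset.mem_erase] at hp ⊢
    exact ⟨hp.2.2, Ne.symm hp.2.1, hp.1⟩
  · rintro ⟨j, k⟩ _
    rfl

end Fractions

/-! ### Degrees in the Čech complex -/

section Degrees

variable {A : Type*} [CommRing A] {n : ℕ} {x : Fin n → A} {w : Fin n → ℕ}
  {N N' N'' : Type*} [AddCommGroup N] [Module A N] [AddCommGroup N'] [Module A N']
  [AddCommGroup N''] [Module A N'']
  {𝒩 : ℤ → AddSubgroup N} {𝒩' : ℤ → AddSubgroup N'} {𝒩'' : ℤ → AddSubgroup N''}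

variable (x w 𝒩) in
/-- The elements `x_j` act with degree `w_j`. -/
def ActsWithDegree : Prop := ∀ j μ, ∀ u ∈ 𝒩 μ, x j • u ∈ 𝒩 (μ + w j)

theorem ActsWithDegree.prod_smul_mem (h : ActsWithDegree x w 𝒩) (s : Finset (Fin n)) {μ : ℤ}
    {u : N} (hu : u ∈ 𝒩 μ) : (∏ j ∈ s, x j) • u ∈ 𝒩 (μ + ∑ j ∈ s, (w j : ℤ)) := by
  induction s using Finset.induction_on with
  | empty => simpa using hu
  | insert a s ha ih =>
    rw [Finset.prod_insert ha, Finset.sum_insert ha, mul_smul, add_comm (w a : ℤ), ← add_assoc]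
    exact h a _ _ ih

theorem ActsWithDegree.prod_pow_smul_mem (h : ActsWithDegree x w 𝒩) (s : Finset (Fin n)) (k : ℕ)
    {μ : ℤ} {u : N} (hu : u ∈ 𝒩 μ) :
    (∏ j ∈ s, x j) ^ k • u ∈ 𝒩 (μ + k * ∑ j ∈ s, (w j : ℤ)) := by
  induction k with
  | zero => simpa using hu
  | succ k ih =>
    rw [pow_succ', mul_smul, Nat.cast_succ, add_mul, one_mul, ← add_assoc]
    exact h.prod_smul_mem s ih

theorem ActsWithDegree.pow_smul_mem (h : ActsWithDegree x w 𝒩) (j : Fin n) (k : ℕ)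
    {μ : ℤ} {u : N} (hu : u ∈ 𝒩 μ) : x j ^ k • u ∈ 𝒩 (μ + k * w j) := by
  simpa using h.prod_pow_smul_mem {j} k hu

theorem frac_mem_cechLocDeg (s : Finset (Fin n)) (k : ℕ) {μ : ℤ} {u : N}
    (hu : u ∈ 𝒩 (μ + k * ∑ j ∈ s, (w j : ℤ))) : frac x s k u ∈ cechLocDeg x w N 𝒩 s μ :=
  AddSubgroup.subset_closure ⟨k, u, hu, rfl⟩

/-- A sum of homogeneous fractions is brought to a common denominator by raising exponents. All
large exponents are allowed so that the finitely many components of a cochain can share one. -/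
theorem ActsWithDegree.exists_frac_of_mem (h : ActsWithDegree x w 𝒩) {s : Finset (Fin n)} {μ : ℤ}
    {z : CechLoc x N s} (hz : z ∈ cechLocDeg x w N 𝒩 s μ) :
    ∃ K : ℕ, ∀ k ≥ K, ∃ u ∈ 𝒩 (μ + k * ∑ j ∈ s, (w j : ℤ)), z = frac x s k u := by
  induction hz using AddSubgroup.closure_induction with
  | mem z hz =>
    obtain ⟨k, u, hu, rfl⟩ := hz
    refine ⟨k, fun k' hk => ?_⟩
    obtain ⟨l, rfl⟩ := Nat.exists_eq_add_of_le hk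
    refine ⟨_, ?_, (frac_raise x s k l u).symm⟩
    rw [Nat.cast_add, add_mul, ← add_assoc]
    exact h.prod_pow_smul_mem s l hu
  | zero => exact ⟨0, fun k _ => ⟨0, zero_mem _, (map_zero _).symm⟩⟩
  | add z z' _ _ hz hz' =>
    obtain ⟨K, hK⟩ := hz
    obtain ⟨K', hK'⟩ := hz'
    refine ⟨max K K', fun k hk => ?_⟩
    obtain ⟨u, hu, rfl⟩ := hK k (le_trans (le_max_left _ _) hk)
    obtain ⟨u', hu', rfl⟩ := hK' k (le_trans (le_max_right _ _) hk)
    exact ⟨u + u', add_mem hu hu', (map_add _ _ _).symm⟩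
  | neg z _ hz =>
    obtain ⟨K, hK⟩ := hz
    refine ⟨K, fun k hk => ?_⟩
    obtain ⟨u, hu, rfl⟩ := hK k hk
    exact ⟨-u, neg_mem hu, (map_neg _ _).symm⟩

theorem ActsWithDegree.cechRes_mem (h : ActsWithDegree x w 𝒩) {s t : Finset (Fin n)} (hst : s ⊆ t)
    {μ : ℤ} {z : CechLoc x N s} (hz : z ∈ cechLocDeg x w N 𝒩 s μ) :
    cechRes x N hst z ∈ cechLocDeg x w N 𝒩 t μ := by
  obtain ⟨k, hk⟩ := h.exists_frac_of_mem hz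
  obtain ⟨u, hu, rfl⟩ := hk k le_rfl
  rw [cechRes_frac]
  refine frac_mem_cechLocDeg t k ?_
  have := h.prod_pow_smul_mem (t \ s) k hu
  rwa [add_assoc, ← mul_add, add_comm (∑ j ∈ s, _), Finset.sum_sdiff hst] at this

theorem cechSign_smul_mem {H : AddSubgroup N} (s : Finset (Fin n)) (j : Fin n) {u : N}
    (hu : u ∈ H) : (cechSign s j : A) • u ∈ H := by
  rw [cechSign]
  rcases neg_one_pow_eq_or A (s.filter (· < j)).card with h | h <;> rw [h]
  · rwa [one_smul]
  · rw [neg_smul, one_smul]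
    exact neg_mem hu

theorem mem_cechTermDeg {i : ℕ} {μ : ℤ} {c : CechTerm x N i} :
    c ∈ cechTermDeg x w N 𝒩 i μ ↔ ∀ s, c s ∈ cechLocDeg x w N 𝒩 s.1 μ := by
  simp only [cechTermDeg, AddSubgroup.mem_pi, Set.mem_univ, true_imp_iff]

theorem ActsWithDegree.cechD_mem (h : ActsWithDegree x w 𝒩) {i : ℕ} {μ : ℤ}
    {c : CechTerm x N i} (hc : c ∈ cechTermDeg x w N 𝒩 i μ) :
    cechD x N i c ∈ cechTermDeg x w N 𝒩 (i + 1) μ := by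
  rw [mem_cechTermDeg] at hc ⊢
  intro s
  rw [cechD_apply]
  refine AddSubgroup.sum_mem _ fun j _ => ?_
  have hj : (s.1.erase j.1).card = i := by
    rw [Finset.card_erase_of_mem j.2, s.2, Nat.add_sub_cancel]
  have h1 := h.cechRes_mem (s.1.erase_subset j.1) (hc ⟨s.1.erase j.1, hj⟩)
  have h2 := cechSign_smul_mem (A := A) s.1 j.1 h1
  rw [cechSign] at h2
  exact h2

theorem ActsWithDegree.coboundaries_le (h : ActsWithDegree x w 𝒩) (i : ℕ) (μ : ℤ) :
    cechCoboundaries x w N 𝒩 i μ ≤ cechCocycles x w N 𝒩 i μ := by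
  cases i with
  | zero => exact bot_le
  | succ i =>
    rintro _ ⟨c, hc, rfl⟩
    exact ⟨h.cechD_mem hc, cechD_cechD x i c⟩

theorem mem_cechCocycles {i : ℕ} {μ : ℤ} {c : CechTerm x N i} :
    c ∈ cechCocycles x w N 𝒩 i μ ↔ c ∈ cechTermDeg x w N 𝒩 i μ ∧ cechD x N i c = 0 := Iff.rfl

theorem mem_cechCoboundaries_succ {i : ℕ} {μ : ℤ} {c : CechTerm x N (i + 1)} :
    c ∈ cechCoboundaries x w N 𝒩 (i + 1) μ ↔
      ∃ e ∈ cechTermDeg x w N 𝒩 i μ, cechD x N i e = c := Iff.rfl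

theorem mem_cechCoboundaries_zero {μ : ℤ} {c : CechTerm x N 0} :
    c ∈ cechCoboundaries x w N 𝒩 0 μ ↔ c = 0 := Iff.rfl

/-- A fraction of degree `μ` has a numerator of degree `μ + k deg x_s`, hence the hypothesis at all
shifts of `μ`. Allowing `μ' ≠ μ` covers multiplication by `x_j` and the passage between `MI^t` and
its shifted copy in the Rees module. -/
theorem locMap_mem (φ : N →ₗ[A] N') {μ μ' : ℤ}
    (hφ : ∀ k, ∀ u ∈ 𝒩 (μ + k), φ u ∈ 𝒩' (μ' + k)) {s : Finset (Fin n)} {z : CechLoc x N s}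
    (hz : z ∈ cechLocDeg x w N 𝒩 s μ) : locMap x s φ z ∈ cechLocDeg x w N' 𝒩' s μ' := by
  induction hz using AddSubgroup.closure_induction with
  | mem z hz =>
    obtain ⟨k, u, hu, rfl⟩ := hz
    exact (locMap_frac x s φ k u).symm ▸ frac_mem_cechLocDeg s k (hφ _ _ hu)
  | zero => rw [map_zero]; exact zero_mem _
  | add z z' _ _ hz hz' => rw [map_add]; exact add_mem hz hz'
  | neg z _ hz => rw [map_neg]; exact neg_mem hz

theorem cechMap_mem (φ : N →ₗ[A] N') {μ μ' : ℤ}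
    (hφ : ∀ k, ∀ u ∈ 𝒩 (μ + k), φ u ∈ 𝒩' (μ' + k)) {i : ℕ} {c : CechTerm x N i}
    (hc : c ∈ cechTermDeg x w N 𝒩 i μ) : cechMap x i φ c ∈ cechTermDeg x w N' 𝒩' i μ' :=
  fun s hs => locMap_mem φ hφ (hc s hs)

theorem cechMap_mem_cocycles (φ : N →ₗ[A] N') {μ μ' : ℤ}
    (hφ : ∀ k, ∀ u ∈ 𝒩 (μ + k), φ u ∈ 𝒩' (μ' + k)) {i : ℕ} {c : CechTerm x N i}
    (hc : c ∈ cechCocycles x w N 𝒩 i μ) : cechMap x i φ c ∈ cechCocycles x w N' 𝒩' i μ' :=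
  mem_cechCocycles.2 ⟨cechMap_mem φ hφ hc.1,
    by rw [cechD_cechMap, (mem_cechCocycles.1 hc).2, map_zero]⟩

theorem cechMap_mem_coboundaries (φ : N →ₗ[A] N') {μ μ' : ℤ}
    (hφ : ∀ k, ∀ u ∈ 𝒩 (μ + k), φ u ∈ 𝒩' (μ' + k)) {i : ℕ} {c : CechTerm x N i}
    (hc : c ∈ cechCoboundaries x w N 𝒩 i μ) :
    cechMap x i φ c ∈ cechCoboundaries x w N' 𝒩' i μ' := by
  cases i with
  | zero => rw [mem_cechCoboundaries_zero.1 hc, map_zero]; exact zero_mem _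
  | succ i =>
    obtain ⟨e, he, rfl⟩ := mem_cechCoboundaries_succ.1 hc
    exact mem_cechCoboundaries_succ.2 ⟨_, cechMap_mem φ hφ he, cechD_cechMap x i φ e⟩

theorem ActsWithDegree.pow_smul_mem_cechTermDeg (h : ActsWithDegree x w 𝒩) (j : Fin n) (k : ℕ)
    {i : ℕ} {μ : ℤ} {c : CechTerm x N i} (hc : c ∈ cechTermDeg x w N 𝒩 i μ) :
    x j ^ k • c ∈ cechTermDeg x w N 𝒩 i (μ + k * w j) := by
  have : x j ^ k • c = cechMap x i (x j ^ k • LinearMap.id) c := by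
    ext s : 1
    exact (locMap_smul_id x s.1 _ _).symm
  rw [this]
  refine cechMap_mem _ (fun l u hu => ?_) hc
  rw [add_right_comm]
  exact h.pow_smul_mem j k hu

theorem ActsWithDegree.pow_smul_mem_cocycles (h : ActsWithDegree x w 𝒩) (j : Fin n) (k : ℕ)
    {i : ℕ} {μ : ℤ} {c : CechTerm x N i} (hc : c ∈ cechCocycles x w N 𝒩 i μ) :
    x j ^ k • c ∈ cechCocycles x w N 𝒩 i (μ + k * w j) :=
  mem_cechCocycles.2 ⟨h.pow_smul_mem_cechTermDeg j k hc.1,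
    by rw [map_smul, (mem_cechCocycles.1 hc).2, smul_zero]⟩

/-! ### Local cohomology is torsion -/

theorem exists_pow_smul_eq_zero_of_cechRes {s : Finset (Fin n)} {j : Fin n} {z : CechLoc x N s}
    (hz : cechRes x N (Finset.subset_insert j s) z = 0) : ∃ l, x j ^ l • z = 0 := by
  by_cases hj : j ∈ s
  · have : cechRes x N (Finset.subset_insert j s) z = 0 ↔ z = 0 := by
      obtain ⟨k, u, rfl⟩ := exists_eq_frac x s z
      rw [cechRes_frac, frac_eq_zero, frac_eq_zero]
      simp [hj]
    exact ⟨0, by rw [this.1 hz, smul_zero]⟩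
  · obtain ⟨k, u, rfl⟩ := exists_eq_frac x s z
    rw [cechRes_frac, Finset.insert_sdiff_of_notMem _ hj, Finset.sdiff_self,
      insert_empty_eq, Finset.prod_singleton, frac_eq_zero] at hz
    obtain ⟨l, hl⟩ := hz
    -- The relation reads `(x_j x_s)^l x_j^k u = 0`. The powers of `x_j` are collected into the
    -- multiplier, and `x_s^l` is absorbed by the localization.
    refine ⟨l + k, ?_⟩
    rw [← map_smul, frac_eq_zero]
    refine ⟨l, ?_⟩
    rw [← hl, Finset.prod_insert hj, ← mul_smul, ← mul_smul]
    congr 1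
    ring

theorem exists_pow_smul_eq_zero_of_cechComp {i : ℕ} (j : Fin n) {c : CechTerm x N i}
    (hc : ∀ s : Finset (Fin n), s.card = i → cechComp x c s (insert j s) = 0) :
    ∃ l, x j ^ l • c = 0 := by
  have h1 : ∀ s : {s : Finset (Fin n) // s.card = i}, ∃ l, x j ^ l • c s = 0 := by
    intro s
    apply exists_pow_smul_eq_zero_of_cechRes
    have := hc s.1 s.2
    rwa [cechComp, dif_pos ⟨s.2, Finset.subset_insert _ _⟩] at this
  choose l hl using h1
  refine ⟨Finset.univ.sup l, ?_⟩
  ext s : 1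
  obtain ⟨k, hk⟩ := Nat.exists_eq_add_of_le (Finset.le_sup (f := l) (Finset.mem_univ s))
  rw [Pi.smul_apply, hk, pow_add, mul_comm, mul_smul, hl, smul_zero]
  rfl

theorem cechComp_smul {i : ℕ} (a : A) (c : CechTerm x N i) (s t : Finset (Fin n)) :
    cechComp x (a • c) s t = a • cechComp x c s t := by
  unfold cechComp
  split_ifs <;> simp

/-- The cocycle condition at `s ∪ {j}` is solved for the face that omits `j`; signs are their own
inverses. -/
theorem cechComp_of_cechD_eq_zero {i : ℕ} {c : CechTerm x N i} (hc : cechD x N i c = 0)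
    {s : Finset (Fin n)} (hs : s.card = i) {j : Fin n} (hj : j ∉ s) :
    cechComp x c s (insert j s) = - ∑ k ∈ s, ((cechSign (insert j s) j : A) *
      cechSign (insert j s) k) • cechComp x c (insert j (s.erase k)) (insert j s) := by
  have h := cechComp_cechD x c (s := insert j s) (t := insert j s)
    (by rw [Finset.card_insert_of_notMem hj, hs]) subset_rfl
  rw [hc, cechComp_zero, Finset.sum_insert hj, Finset.erase_insert hj] at h
  have h2 := congrArg (fun z => (cechSign (insert j s) j : A) • z) h
  simp only [smul_zero, smul_add, ← mul_smul, cechSign_mul_self, one_smul, Finset.smul_sum] at h2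
  rw [eq_neg_iff_add_eq_zero, h2]
  congr 1
  refine Finset.sum_congr rfl fun k hk => ?_
  rw [Finset.erase_insert_of_ne (fun h : j = k => hj (h ▸ hk))]

theorem cechSign_insert {s : Finset (Fin n)} {j k : Fin n} (hj : j ∉ s) (hk : k ∈ s) :
    (cechSign s k : A) * cechSign (insert j (s.erase k)) j =
      -(cechSign (insert j s) j * cechSign (insert j s) k) := by
  have hjk : j ≠ k := fun h => hj (h ▸ hk)
  have h := cechSign_erase (A := A) (Finset.mem_insert_self j s) (Finset.mem_insert_of_mem hk) hjk
  rw [Finset.erase_insert hj, Finset.erase_insert_of_ne hjk] at h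
  have h1 := cechSign_mul_self (A := A) (insert j s) j
  have h2 := cechSign_mul_self (A := A) (insert j s) k
  have h3 := cechSign_mul_self (A := A) (insert j (s.erase k)) j
  calc (cechSign s k : A) * cechSign (insert j (s.erase k)) j
      = cechSign (insert j s) j * (cechSign (insert j s) j * cechSign s k)
          * cechSign (insert j (s.erase k)) j := by rw [← mul_assoc, h1, one_mul]
    _ = _ := by
      rw [h]
      linear_combination (-(cechSign (insert j s) j * cechSign (insert j s) k : A)) * h3

/-- The Čech complex becomes contractible once `x_j` is inverted, by the homotopy sending `c` to the
components `± c_{s ∪ {j}}`. Multiplying by a power of `x_j` clears it from the denominators, which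
makes the homotopy available over `N`. The remaining error vanishes after inverting `x_j`, so a
further power of `x_j` kills it. -/
theorem ActsWithDegree.exists_pow_smul_mem_coboundaries (h : ActsWithDegree x w 𝒩) (j : Fin n)
    {i : ℕ} {μ : ℤ} {c : CechTerm x N i} (hc : c ∈ cechCocycles x w N 𝒩 i μ) :
    ∃ k : ℕ, x j ^ k • c ∈ cechCoboundaries x w N 𝒩 i (μ + k * w j) := by
  obtain ⟨hdeg, hd⟩ := mem_cechCocycles.1 hc
  cases i with
  | zero =>
    have : ∀ s : Finset (Fin n), s.card = 0 → cechComp x c s (insert j s) = 0 := by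
      intro s hs
      obtain rfl := Finset.card_eq_zero.1 hs
      rw [cechComp_of_cechD_eq_zero hd rfl (Finset.notMem_empty j),
        Finset.sum_empty, neg_zero]
    obtain ⟨l, hl⟩ := exists_pow_smul_eq_zero_of_cechComp j this
    exact ⟨l, mem_cechCoboundaries_zero.2 hl⟩
  | succ i =>
    have h1 : ∀ s : {s : Finset (Fin n) // s.card = i + 1}, ∃ K : ℕ, ∀ k ≥ K,
        ∃ u ∈ 𝒩 (μ + k * ∑ j ∈ s.1, (w j : ℤ)), c s = frac x s.1 k u :=
      fun s => h.exists_frac_of_mem (hdeg s (Set.mem_univ _))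
    choose K hK using h1
    obtain ⟨k, hk⟩ : ∃ k, ∀ s, K s ≤ k :=
      ⟨Finset.univ.sup K, fun s => Finset.le_sup (f := K) (Finset.mem_univ s)⟩
    choose u hu hcu using fun s => hK s k (hk s)
    -- Since `c_{s ∪ {j}} = u / (x_j x_s)^k`, the fraction `u / x_s^k` represents `x_j^k c_{s ∪
    -- {j}}` inside `N_{x_s}`.
    let e : CechTerm x N i := fun s => if hj : j ∉ s.1 then
      (cechSign (insert j s.1) j : A) • frac x s.1 k
        (u ⟨insert j s.1, by rw [Finset.card_insert_of_notMem hj, s.2]⟩) else 0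
    have he : e ∈ cechTermDeg x w N 𝒩 i (μ + k * w j) := by
      intro s _
      change e s ∈ cechLocDeg x w N 𝒩 s.1 (μ + k * w j)
      by_cases hj : j ∉ s.1
      · simp only [e, dif_pos hj]
        refine cechSign_smul_mem _ _ (frac_mem_cechLocDeg _ _ ?_)
        have := hu ⟨insert j s.1, by rw [Finset.card_insert_of_notMem hj, s.2]⟩
        rw [Finset.sum_insert hj] at this
        rw [add_assoc, ← mul_add]
        exact this
      · simp only [e, dif_neg hj]
        exact zero_mem _
    have hcomp0 : ∀ s t : Finset (Fin n), j ∈ s → cechComp x e s t = 0 := by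
      intro s t hj
      unfold cechComp
      split_ifs with hs
      · simp [e, hj]
      · rfl
    have hcomp : ∀ s t : Finset (Fin n), s.card = i → j ∉ s → insert j s ⊆ t →
        cechComp x e s t =
          ((cechSign (insert j s) j : A) * x j ^ k) • cechComp x c (insert j s) t := by
      intro s t hs hj hst
      have hsi : (insert j s).card = i + 1 := by rw [Finset.card_insert_of_notMem hj, hs]
      have hst' : s ⊆ t := (Finset.subset_insert _ _).trans hst
      rw [cechComp, dif_pos ⟨hs, hst'⟩, cechComp, dif_pos ⟨hsi, hst⟩, hcu ⟨insert j s, hsi⟩]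
      simp only [e, hj, not_false_eq_true, dif_pos, map_smul]
      rw [mul_smul]
      congr 1
      rw [cechRes_frac, cechRes_frac, ← map_smul, ← mul_smul, ← mul_pow]
      congr 3
      rw [← Finset.prod_insert]
      · congr 1
        ext a
        simp only [Finset.mem_insert, Finset.mem_sdiff]
        constructor
        · rintro ⟨ha, hs⟩
          by_cases haj : a = j
          · exact Or.inl haj
          · exact Or.inr ⟨ha, by tauto⟩
        · rintro (rfl | ⟨ha, h⟩)
          · exact ⟨hst (Finset.mem_insert_self _ _), hj⟩
          · exact ⟨ha, by tauto⟩
      · simp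
    -- After `x_j` is inverted, `d e = x_j^k c`. If `j ∈ s`, only the face `s ∖ {j}` contributes. If
    -- `j ∉ s`, the faces of `e` reproduce the expression of `c_s` given by the cocycle condition.
    have hzero : ∀ s : Finset (Fin n), s.card = i + 1 →
        cechComp x (cechD x N i e + (-(x j ^ k)) • c) s (insert j s) = 0 := by
      intro s hs
      have hcard : ∀ a ∈ s, (s.erase a).card = i := fun a ha => by
        rw [Finset.card_erase_of_mem ha, hs, Nat.add_sub_cancel]
      rw [cechComp_add, cechComp_smul, cechComp_cechD x e hs (Finset.subset_insert _ _)]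
      by_cases hj : j ∈ s
      · rw [Finset.sum_eq_single_of_mem j hj]
        · rw [hcomp _ _ (hcard j hj) (Finset.notMem_erase _ _)
            (by rw [Finset.insert_erase hj]; exact Finset.subset_insert _ _),
            Finset.insert_erase hj, ← mul_smul, ← mul_assoc, cechSign_mul_self, one_mul,
            ← add_smul, add_neg_cancel, zero_smul]
        · intro a _ ha
          rw [hcomp0 _ _ (Finset.mem_erase.2 ⟨Ne.symm ha, hj⟩), smul_zero]
      · rw [cechComp_of_cechD_eq_zero hd hs hj, neg_smul, smul_neg, neg_neg, Finset.smul_sum,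
          ← Finset.sum_add_distrib]
        refine Finset.sum_eq_zero fun a ha => ?_
        rw [hcomp _ _ (hcard a ha) (fun h => hj (Finset.mem_of_mem_erase h))
          (Finset.insert_subset_insert _ (Finset.erase_subset _ _)), ← mul_smul, ← mul_smul,
          ← add_smul, ← mul_assoc, cechSign_insert hj ha]
        convert zero_smul A _ using 2
        ring
    obtain ⟨l, hl⟩ := exists_pow_smul_eq_zero_of_cechComp j hzero
    -- The exponent `k` comes from the homotopy, and `l` kills the difference `d e - x_j^k c`.
    refine ⟨l + k, mem_cechCoboundaries_succ.2 ⟨x j ^ l • e, ?_, ?_⟩⟩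
    · have := h.pow_smul_mem_cechTermDeg j l he
      rwa [add_assoc, ← add_mul, add_comm (k : ℤ), ← Nat.cast_add] at this
    · rw [map_smul, pow_add, mul_smul, ← sub_eq_zero, ← smul_sub, sub_eq_add_neg, ← neg_smul]
      exact hl

end Degrees

/-! ### Noetherian subquotients -/

section Noetherian

variable {B C C' P X Y : Type*} [CommRing B] [AddCommGroup C] [Module B C]
  [AddCommGroup C'] [Module B C'] [AddCommGroup P] [Module B P] [AddCommGroup X] [Module B X]
  [AddCommGroup Y] [Module B Y]

/-- Modulo `β(ker α)`, the image of `β` is a quotient of `P / ker α`, that is, of the image of `α`.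
-/
theorem isNoetherian_range_of_ker (α : P →ₗ[B] X) (β : P →ₗ[B] Y)
    (hα : IsNoetherian B (LinearMap.range α))
    (hβ : IsNoetherian B ((LinearMap.ker α).map β)) : IsNoetherian B (LinearMap.range β) := by
  have hle : (LinearMap.ker α).map β ≤ LinearMap.range β := LinearMap.map_le_range
  refine (isNoetherian_iff_submodule_quotient
    (((LinearMap.ker α).map β).submoduleOf (LinearMap.range β))).2 ⟨?_, ?_⟩
  · exact isNoetherian_of_linearEquiv (Submodule.submoduleOfEquivOfLe hle).symm
  · have : IsNoetherian B (P ⧸ LinearMap.ker α) :=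
      isNoetherian_of_linearEquiv α.quotKerEquivRange.symm
    refine isNoetherian_of_surjective (Submodule.mapQ (LinearMap.ker α)
      (((LinearMap.ker α).map β).submoduleOf (LinearMap.range β)) β.rangeRestrict ?_) ?_
    · intro p hp
      exact ⟨p, hp, rfl⟩
    · rw [LinearMap.range_eq_top]
      intro y
      obtain ⟨⟨_, p, rfl⟩, rfl⟩ := Submodule.mkQ_surjective _ y
      exact ⟨Submodule.Quotient.mk p, rfl⟩

/-- The image of `Z` in `C ⧸ D` is Noetherian. -/
def NoetherianMod (Z D : Submodule B C) : Prop := IsNoetherian B (Z.map D.mkQ)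

theorem NoetherianMod.mono {Z Z' D : Submodule B C} (h : NoetherianMod Z D) (hZ : Z' ≤ Z) :
    NoetherianMod Z' D :=
  @isNoetherian_of_le _ _ _ _ _ _ _ h (Submodule.map_mono hZ)

/-- `P` acts as a relation between the subquotients. This handles connecting homomorphisms, whose
construction involves a choice of lift, without defining maps on cohomology. -/
theorem noetherianMod_range_of_ker {Z D : Submodule B C} {Z' D' : Submodule B C'}
    (h : NoetherianMod Z D) (α : P →ₗ[B] C) (β : P →ₗ[B] C')
    (hα : ∀ p, α p ∈ Z) (hβ : ∀ p, α p ∈ D → ∃ z ∈ Z', β p - z ∈ D') (h' : NoetherianMod Z' D') :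
    NoetherianMod (LinearMap.range β) D' := by
  unfold NoetherianMod
  rw [← LinearMap.range_comp]
  refine isNoetherian_range_of_ker (D.mkQ ∘ₗ α) _ ?_ ?_
  · refine @isNoetherian_of_le _ _ _ _ _ _ _ h ?_
    rintro _ ⟨p, rfl⟩
    exact ⟨α p, hα p, rfl⟩
  · refine @isNoetherian_of_le _ _ _ _ _ _ _ h' ?_
    rintro _ ⟨p, hp, rfl⟩
    obtain ⟨z, hz, hd⟩ := hβ p ((Submodule.Quotient.mk_eq_zero _).1 hp)
    exact ⟨z, hz, ((Submodule.Quotient.eq _).2 hd).symm⟩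

theorem NoetherianMod.map {Z D : Submodule B C} (h : NoetherianMod Z D) (f : C →ₗ[B] C')
    {D' : Submodule B C'} (hD : ∀ c ∈ D, f c ∈ D') : NoetherianMod (Z.map f) D' := by
  have h0 : NoetherianMod (⊥ : Submodule B C') D' := by
    unfold NoetherianMod
    rw [Submodule.map_bot]
    infer_instance
  have := noetherianMod_range_of_ker h Z.subtype (f ∘ₗ Z.subtype) (fun p => p.2)
    (fun p hp => ⟨0, zero_mem _, by simpa using hD _ hp⟩) h0
  rwa [LinearMap.range_comp, Submodule.range_subtype] at this

/-- `Z` modulo `D` is controlled by its image under `f` together with the classes that `f` sends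
into `D'`. -/
theorem NoetherianMod.of_map {Z D : Submodule B C} {Z' D' : Submodule B C'}
    (h' : NoetherianMod Z' D') (f : C →ₗ[B] C') (hZ : ∀ c ∈ Z, f c ∈ Z')
    (h : NoetherianMod (Z ⊓ D'.comap f) D) : NoetherianMod Z D := by
  have := noetherianMod_range_of_ker h' (f ∘ₗ Z.subtype) Z.subtype (fun p => hZ _ p.2)
    (fun p hp => ⟨p, Submodule.mem_inf.2 ⟨p.2, hp⟩, by simp⟩) h
  rwa [Submodule.range_subtype] at this

end Noetherian

/-! ### Operators on Čech modules -/

section Operators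

variable {A : Type*} [CommRing A] {n : ℕ} {x : Fin n → A} {w : Fin n → ℕ}
  {N N' N'' : Type*} [AddCommGroup N] [Module A N] [AddCommGroup N'] [Module A N']
  [AddCommGroup N''] [Module A N'']
  {𝒩 : ℤ → AddSubgroup N} {𝒩' : ℤ → AddSubgroup N'} {𝒩'' : ℤ → AddSubgroup N''}
variable {B : Type*} [CommRing B] [Module B N] [SMulCommClass B A N]
  [Module B N'] [SMulCommClass B A N'] [Module B N''] [SMulCommClass B A N'']

/-- Localization as a ring homomorphism on endomorphisms. -/
def locEnd (S : Submonoid A) : Module.End A N →+* Module.End A (LocalizedModule S N) where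
  toFun φ := IsLocalizedModule.map S (LocalizedModule.mkLinearMap S N)
    (LocalizedModule.mkLinearMap S N) φ
  map_one' := IsLocalizedModule.map_id S (LocalizedModule.mkLinearMap S N)
  map_mul' φ ψ := by
    ext z
    induction z using LocalizedModule.induction_on with
    | h u y => simp [IsLocalizedModule.map_LocalizedModules]
  map_zero' := map_zero _
  map_add' φ ψ := map_add _ φ ψ

/-- Operators on `N` that commute with `A` act on the localizations of `N`. -/
@[reducible]
def localizedModuleOperators (S : Submonoid A) : Module B (LocalizedModule S N) :=
  Module.compHom _ ((locEnd S).comp (Module.toModuleEnd A (S := B) N))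

attribute [local instance 10] localizedModuleOperators

theorem smul_eq_locMap (b : B) (s : Finset (Fin n)) (z : CechLoc x N s) :
    b • z = locMap x s (Module.toModuleEnd A N b) z := rfl

theorem smul_eq_cechMap (b : B) (i : ℕ) (c : CechTerm x N i) :
    b • c = cechMap x i (Module.toModuleEnd A N b) c := rfl

theorem locMap_smul_comm (φ : N →ₗ[A] N') (hφ : ∀ (b : B) u, φ (b • u) = b • φ u) (b : B)
    (s : Finset (Fin n)) (z : CechLoc x N s) : locMap x s φ (b • z) = b • locMap x s φ z := by
  rw [smul_eq_locMap, smul_eq_locMap, ← locMap_comp, ← locMap_comp]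
  congr 2
  ext u
  exact hφ b u

/-- The action on Čech modules of a map that is linear over `A` and over `B`. -/
def cechMapOp (i : ℕ) (φ : N →ₗ[A] N') (hφ : ∀ (b : B) u, φ (b • u) = b • φ u) :
    CechTerm x N i →ₗ[B] CechTerm x N' i where
  toFun := cechMap x i φ
  map_add' := map_add _
  map_smul' b c := by
    ext s : 1
    exact locMap_smul_comm φ hφ b s.1 _

theorem cechD_smul (i : ℕ) (b : B) (c : CechTerm x N i) :
    cechD x N i (b • c) = b • cechD x N i c := cechD_cechMap x i _ c

theorem smul_smul_cechTerm (i : ℕ) (a : A) (b : B) (c : CechTerm x N i) :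
    a • b • c = b • a • c := (map_smul (cechMap x i (Module.toModuleEnd A N b)) a c).symm

/-- The homogeneous components are stable under the operators in `B`. -/
def StableUnder (B : Type*) {N : Type*} [CommRing B] [AddCommGroup N] [Module B N]
    (𝒩 : ℤ → AddSubgroup N) : Prop := ∀ (b : B) (μ), ∀ u ∈ 𝒩 μ, b • u ∈ 𝒩 μ

theorem StableUnder.smul_mem_cechTermDeg (hB : StableUnder B 𝒩) {i : ℕ} {μ : ℤ} (b : B)
    {c : CechTerm x N i} (hc : c ∈ cechTermDeg x w N 𝒩 i μ) :
    b • c ∈ cechTermDeg x w N 𝒩 i μ :=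
  cechMap_mem _ (fun _ u hu => hB b _ u hu) hc

variable (x w) in
/-- The module of cocycles of degree `μ`. -/
def cocycles (hB : StableUnder B 𝒩) (i : ℕ) (μ : ℤ) : Submodule B (CechTerm x N i) :=
  { cechCocycles x w N 𝒩 i μ with
    smul_mem' := fun b _ hc => cechMap_mem_cocycles _ (fun _ u hu => hB b _ u hu) hc }

variable (x w) in
/-- The module of coboundaries of degree `μ`. -/
def coboundaries (hB : StableUnder B 𝒩) (i : ℕ) (μ : ℤ) : Submodule B (CechTerm x N i) :=
  { cechCoboundaries x w N 𝒩 i μ with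
    smul_mem' := fun b _ hc => cechMap_mem_coboundaries _ (fun _ u hu => hB b _ u hu) hc }

/-! ### The exact sequence of multiplication by `x_j` -/

/-- `K → N → Q` are the kernel and the cokernel of multiplication by `x_j` on `N`, with their
gradings. -/
structure IsKerCoker (x : Fin n → A) (w : Fin n → ℕ) (j : Fin n) {K Q : Type*} [AddCommGroup K]
    [Module A K] [AddCommGroup Q] [Module A Q] (𝒦 : ℤ → AddSubgroup K)
    (𝒩 : ℤ → AddSubgroup N) (𝒬 : ℤ → AddSubgroup Q) (ι : K →ₗ[A] N) (π : N →ₗ[A] Q) : Prop where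
  injective : Function.Injective ι
  mem_iff : ∀ μ u, ι u ∈ 𝒩 μ ↔ u ∈ 𝒦 μ
  exists_of_smul_eq_zero : ∀ u, x j • u = 0 → ∃ v, ι v = u
  map_mem : ∀ μ, ∀ u ∈ 𝒩 μ, π u ∈ 𝒬 μ
  exists_lift : ∀ μ, ∀ q ∈ 𝒬 μ, ∃ u ∈ 𝒩 μ, π u = q
  map_smul_eq_zero : ∀ u, π (x j • u) = 0
  exists_of_map_eq_zero : ∀ μ, ∀ u ∈ 𝒩 (μ + w j), π u = 0 → ∃ v ∈ 𝒩 μ, x j • v = u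

namespace IsKerCoker

variable {j : Fin n} {K Q : Type*} [AddCommGroup K]
    [Module A K] [AddCommGroup Q] [Module A Q] {𝒦 : ℤ → AddSubgroup K}
    {𝒬 : ℤ → AddSubgroup Q} {ι : K →ₗ[A] N} {π : N →ₗ[A] Q}

theorem exists_cech_lift (h : IsKerCoker x w j 𝒦 𝒩 𝒬 ι π) (h𝒬 : ActsWithDegree x w 𝒬)
    {i : ℕ} {μ : ℤ} {c : CechTerm x Q i} (hc : c ∈ cechTermDeg x w Q 𝒬 i μ) :
    ∃ e ∈ cechTermDeg x w N 𝒩 i μ, cechMap x i π e = c := by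
  have h1 : ∀ s : {s : Finset (Fin n) // s.card = i}, ∃ z ∈ cechLocDeg x w N 𝒩 s.1 μ, locMap x s.1 π z = c s := by
    intro s
    obtain ⟨k, hk⟩ := h𝒬.exists_frac_of_mem (mem_cechTermDeg.1 hc s)
    obtain ⟨u, hu, hcu⟩ := hk k le_rfl
    obtain ⟨v, hv, rfl⟩ := h.exists_lift _ u hu
    exact ⟨_, frac_mem_cechLocDeg s.1 k hv, by rw [locMap_frac, hcu]⟩
  choose e he hec using h1
  exact ⟨e, mem_cechTermDeg.2 he, funext hec⟩

theorem exists_coboundary_lift (h : IsKerCoker x w j 𝒦 𝒩 𝒬 ι π) (h𝒬 : ActsWithDegree x w 𝒬)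
    {i : ℕ} {μ : ℤ} {c : CechTerm x Q i} (hc : c ∈ cechCoboundaries x w Q 𝒬 i μ) :
    ∃ e ∈ cechCoboundaries x w N 𝒩 i μ, cechMap x i π e = c := by
  cases i with
  | zero => exact ⟨0, zero_mem _, by rw [map_zero, mem_cechCoboundaries_zero.1 hc]⟩
  | succ i =>
    obtain ⟨g, hg, rfl⟩ := mem_cechCoboundaries_succ.1 hc
    obtain ⟨e, he, rfl⟩ := h.exists_cech_lift h𝒬 hg
    exact ⟨_, mem_cechCoboundaries_succ.2 ⟨e, he, rfl⟩, (cechD_cechMap x i π e).symm⟩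

theorem exists_cech_of_map_eq_zero (h : IsKerCoker x w j 𝒦 𝒩 𝒬 ι π)
    (h𝒩 : ActsWithDegree x w 𝒩) {i : ℕ} {μ : ℤ} {c : CechTerm x N i}
    (hc : c ∈ cechTermDeg x w N 𝒩 i (μ + w j)) (h0 : cechMap x i π c = 0) :
    ∃ e ∈ cechTermDeg x w N 𝒩 i μ, x j • e = c := by
  have h1 : ∀ s : {s : Finset (Fin n) // s.card = i}, ∃ z ∈ cechLocDeg x w N 𝒩 s.1 μ, x j • z = c s := by
    intro s
    obtain ⟨k, hk⟩ := h𝒩.exists_frac_of_mem (mem_cechTermDeg.1 hc s)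
    obtain ⟨u, hu, hcu⟩ := hk k le_rfl
    have h2 := congrFun h0 s
    rw [cechMap_apply, hcu, locMap_frac, Pi.zero_apply, frac_eq_zero] at h2
    obtain ⟨l, hl⟩ := h2
    rw [← map_smul] at hl
    have hl2 := h𝒩.prod_pow_smul_mem s.1 l hu
    rw [add_assoc, ← add_mul, ← Nat.cast_add, add_right_comm] at hl2
    obtain ⟨v, hv, hvu⟩ := h.exists_of_map_eq_zero _ _ hl2 hl
    refine ⟨_, frac_mem_cechLocDeg s.1 (k + l) hv, ?_⟩
    rw [← map_smul, hvu, frac_raise, hcu]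
  choose e he hec using h1
  exact ⟨e, mem_cechTermDeg.2 he, funext hec⟩

theorem cechMap_injective (h : IsKerCoker x w j 𝒦 𝒩 𝒬 ι π) {i : ℕ} {c : CechTerm x K i}
    (h0 : cechMap x i ι c = 0) : c = 0 := by
  ext s : 1
  have h1 := congrFun h0 s
  obtain ⟨k, u, hcu⟩ := exists_eq_frac x s.1 (c s)
  rw [cechMap_apply, hcu, locMap_frac, Pi.zero_apply, frac_eq_zero] at h1
  obtain ⟨l, hl⟩ := h1
  rw [← map_smul] at hl
  rw [hcu, Pi.zero_apply, frac_eq_zero]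
  exact ⟨l, h.injective (hl.trans (map_zero ι).symm)⟩

theorem exists_cech_of_smul_eq_zero (h : IsKerCoker x w j 𝒦 𝒩 𝒬 ι π)
    (h𝒩 : ActsWithDegree x w 𝒩) {i : ℕ} {μ : ℤ} {c : CechTerm x N i}
    (hc : c ∈ cechTermDeg x w N 𝒩 i μ) (h0 : x j • c = 0) :
    ∃ e ∈ cechTermDeg x w K 𝒦 i μ, cechMap x i ι e = c := by
  have h1 : ∀ s : {s : Finset (Fin n) // s.card = i}, ∃ z ∈ cechLocDeg x w K 𝒦 s.1 μ, locMap x s.1 ι z = c s := by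
    intro s
    obtain ⟨k, hk⟩ := h𝒩.exists_frac_of_mem (mem_cechTermDeg.1 hc s)
    obtain ⟨u, hu, hcu⟩ := hk k le_rfl
    have h2 := congrFun h0 s
    rw [Pi.smul_apply, hcu, ← map_smul, Pi.zero_apply, frac_eq_zero] at h2
    obtain ⟨l, hl⟩ := h2
    rw [smul_comm] at hl
    have hl2 := h𝒩.prod_pow_smul_mem s.1 l hu
    rw [add_assoc, ← add_mul, ← Nat.cast_add] at hl2
    obtain ⟨v, hv⟩ := h.exists_of_smul_eq_zero _ hl
    rw [← hv, h.mem_iff] at hl2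
    refine ⟨_, frac_mem_cechLocDeg s.1 (k + l) hl2, ?_⟩
    rw [locMap_frac, hv, frac_raise, hcu]
  choose e he hec using h1
  exact ⟨e, mem_cechTermDeg.2 he, funext hec⟩

theorem exists_cocycle_of_smul_eq_zero (h : IsKerCoker x w j 𝒦 𝒩 𝒬 ι π)
    (h𝒩 : ActsWithDegree x w 𝒩) {i : ℕ} {μ : ℤ} {c : CechTerm x N i}
    (hc : c ∈ cechCocycles x w N 𝒩 i μ) (h0 : x j • c = 0) :
    ∃ e ∈ cechCocycles x w K 𝒦 i μ, cechMap x i ι e = c := by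
  obtain ⟨e, he, rfl⟩ := h.exists_cech_of_smul_eq_zero h𝒩 hc.1 h0
  refine ⟨e, mem_cechCocycles.2 ⟨he, h.cechMap_injective ?_⟩, rfl⟩
  rw [← cechD_cechMap]
  exact (mem_cechCocycles.1 hc).2

theorem exists_cocycle_sub_mem (h : IsKerCoker x w j 𝒦 𝒩 𝒬 ι π)
    (h𝒩 : ActsWithDegree x w 𝒩) (h𝒬 : ActsWithDegree x w 𝒬) {i : ℕ} {μ : ℤ}
    {c : CechTerm x N (i + 1)} (hc : c ∈ cechCocycles x w N 𝒩 (i + 1) μ)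
    {e : CechTerm x N i} (he : e ∈ cechTermDeg x w N 𝒩 i (μ + w j))
    (hce : x j • c = cechD x N i e)
    (hπ : cechMap x i π e ∈ cechCoboundaries x w Q 𝒬 i (μ + w j)) :
    ∃ z ∈ cechCocycles x w K 𝒦 (i + 1) μ,
      c - cechMap x (i + 1) ι z ∈ cechCoboundaries x w N 𝒩 (i + 1) μ := by
  obtain ⟨g, hg, hge⟩ := h.exists_coboundary_lift h𝒬 hπ
  obtain ⟨hg1, hg2⟩ := mem_cechCocycles.1 (h𝒩.coboundaries_le _ _ hg)
  obtain ⟨y, hy, hye⟩ := h.exists_cech_of_map_eq_zero h𝒩 (sub_mem he hg1)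
    (by rw [map_sub, hge, sub_self])
  have hd : cechD x N i y ∈ cechCoboundaries x w N 𝒩 (i + 1) μ :=
    mem_cechCoboundaries_succ.2 ⟨y, hy, rfl⟩
  obtain ⟨z, hz, hzc⟩ := h.exists_cocycle_of_smul_eq_zero h𝒩
    (sub_mem hc (h𝒩.coboundaries_le _ _ hd))
    (by rw [smul_sub, hce, ← map_smul, hye, map_sub, hg2, sub_zero, sub_self])
  exact ⟨z, hz, by rwa [hzc, sub_sub_cancel]⟩

/-- Here `d(π e) = π(x_j c) = 0`. The class of `π e` is the obstruction to moving the class of `c`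
into the kernel `K`. -/
theorem map_mem_cocycles (h : IsKerCoker x w j 𝒦 𝒩 𝒬 ι π) {i : ℕ} {μ : ℤ}
    {c : CechTerm x N (i + 1)} {e : CechTerm x N i} (he : e ∈ cechTermDeg x w N 𝒩 i μ)
    (hce : x j • c = cechD x N i e) : cechMap x i π e ∈ cechCocycles x w Q 𝒬 i μ := by
  refine mem_cechCocycles.2 ⟨cechMap_mem π (fun _ u hu => h.map_mem _ u hu) he, ?_⟩
  rw [cechD_cechMap, ← hce, map_smul]
  ext s : 1
  obtain ⟨k, u, hcu⟩ := exists_eq_frac x s.1 (c s)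
  rw [Pi.smul_apply, cechMap_apply, hcu, locMap_frac, ← map_smul, ← map_smul, h.map_smul_eq_zero,
    map_zero, Pi.zero_apply]

/-- Injectivity of `x_j` on `H^i(N)_μ` is obstructed only by `H^i(K)_μ` and `H^{i-1}(Q)_{μ + w_j}`.
The second condition is phrased through `i = k + 1`, so that it is empty for `i = 0`. -/
theorem mem_coboundaries_of_smul_mem (h : IsKerCoker x w j 𝒦 𝒩 𝒬 ι π)
    (h𝒩 : ActsWithDegree x w 𝒩) (h𝒬 : ActsWithDegree x w 𝒬) {i : ℕ} {μ : ℤ}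
    (hK : cechCocycles x w K 𝒦 i μ ≤ cechCoboundaries x w K 𝒦 i μ)
    (hQ : ∀ k, i = k + 1 →
      cechCocycles x w Q 𝒬 k (μ + w j) ≤ cechCoboundaries x w Q 𝒬 k (μ + w j))
    {c : CechTerm x N i} (hc : c ∈ cechCocycles x w N 𝒩 i μ)
    (h0 : x j • c ∈ cechCoboundaries x w N 𝒩 i (μ + w j)) :
    c ∈ cechCoboundaries x w N 𝒩 i μ := by
  have hι : ∀ z ∈ cechCocycles x w K 𝒦 i μ,
      cechMap x i ι z ∈ cechCoboundaries x w N 𝒩 i μ := fun z hz =>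
    cechMap_mem_coboundaries ι (fun _ u hu => (h.mem_iff _ u).2 hu) (hK hz)
  cases i with
  | zero =>
    obtain ⟨z, hz, rfl⟩ :=
      h.exists_cocycle_of_smul_eq_zero h𝒩 hc (mem_cechCoboundaries_zero.1 h0)
    exact hι z hz
  | succ i =>
    obtain ⟨e, he, hec⟩ := mem_cechCoboundaries_succ.1 h0
    obtain ⟨z, hz, hzc⟩ := h.exists_cocycle_sub_mem h𝒩 h𝒬 hc he hec.symm
      (hQ i rfl (h.map_mem_cocycles he hec.symm))
    have := add_mem hzc (hι z hz)
    rwa [sub_add_cancel] at this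

variable [Module B K] [SMulCommClass B A K] [Module B Q] [SMulCommClass B A Q]

/-- The kernel of `x_j` on `H^i(N)_μ` is filtered: a part comes from `H^i(K)_μ`, and the rest is a
subquotient of `H^{i-1}(Q)_{μ + w_j}`. -/
theorem noetherianMod_smul_ker (h : IsKerCoker x w j 𝒦 𝒩 𝒬 ι π)
    (hι : ∀ (b : B) u, ι (b • u) = b • ι u) (hπ : ∀ (b : B) u, π (b • u) = b • π u)
    (h𝒩 : ActsWithDegree x w 𝒩) (h𝒬 : ActsWithDegree x w 𝒬)
    (h𝒦B : StableUnder B 𝒦) (h𝒩B : StableUnder B 𝒩) (h𝒬B : StableUnder B 𝒬) {i : ℕ} {μ : ℤ}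
    (hK : NoetherianMod (cocycles x w h𝒦B i μ) (coboundaries x w h𝒦B i μ))
    (hQ : ∀ k, i = k + 1 → NoetherianMod (cocycles x w h𝒬B k (μ + w j))
      (coboundaries x w h𝒬B k (μ + w j)))
    {W : Submodule B (CechTerm x N i)} (hW : W ≤ cocycles x w h𝒩B i μ)
    (hW0 : ∀ c ∈ W, x j • c ∈ cechCoboundaries x w N 𝒩 i (μ + w j)) :
    NoetherianMod W (coboundaries x w h𝒩B i μ) := by
  have hK' : NoetherianMod ((cocycles x w h𝒦B i μ).map (cechMapOp i ι hι))
      (coboundaries x w h𝒩B i μ) :=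
    hK.map _ fun c hc => cechMap_mem_coboundaries ι (fun _ u hu => (h.mem_iff _ u).2 hu) hc
  cases i with
  | zero =>
    refine hK'.mono fun c hc => ?_
    obtain ⟨z, hz, rfl⟩ :=
      h.exists_cocycle_of_smul_eq_zero h𝒩 (hW hc) (mem_cechCoboundaries_zero.1 (hW0 c hc))
    exact ⟨z, hz, rfl⟩
  | succ i =>
    -- The cochain `e` with `d e = x_j c` is not unique, so the passage from `c` to the class of `π
    -- e` is recorded by all pairs `(c, e)`.
    let P : Submodule B (CechTerm x N (i + 1) × CechTerm x N i) :=
      { carrier := {p | p.1 ∈ W ∧ p.2 ∈ cechTermDeg x w N 𝒩 i (μ + w j) ∧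
          x j • p.1 = cechD x N i p.2}
        add_mem' := fun hp hq => ⟨add_mem hp.1 hq.1, add_mem hp.2.1 hq.2.1, by
          rw [Prod.fst_add, Prod.snd_add, smul_add, map_add, hp.2.2, hq.2.2]⟩
        zero_mem' := ⟨zero_mem _, zero_mem _, by
          rw [Prod.fst_zero, Prod.snd_zero, smul_zero, map_zero]⟩
        smul_mem' := fun b p hp => ⟨W.smul_mem b hp.1, h𝒩B.smul_mem_cechTermDeg b hp.2.1, by
          rw [Prod.smul_fst, Prod.smul_snd, cechD_smul, ← hp.2.2, smul_smul_cechTerm]⟩ }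
    have := noetherianMod_range_of_ker (hQ i rfl)
      (cechMapOp i π hπ ∘ₗ LinearMap.snd B _ _ ∘ₗ P.subtype)
      (LinearMap.fst B _ _ ∘ₗ P.subtype)
      (fun p => h.map_mem_cocycles p.2.2.1 p.2.2.2) (fun p hp => ?_) hK'
    · refine this.mono fun c hc => ?_
      obtain ⟨e, he, hec⟩ := mem_cechCoboundaries_succ.1 (hW0 c hc)
      exact ⟨⟨(c, e), hc, he, hec.symm⟩, rfl⟩
    · obtain ⟨z, hz, hzc⟩ := h.exists_cocycle_sub_mem h𝒩 h𝒬 (hW p.2.1) p.2.2.1 p.2.2.2 hp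
      exact ⟨_, ⟨z, hz, rfl⟩, hzc⟩

end IsKerCoker

end Operators

/-! ### Gradings given by projections, and their passage to kernels and quotients -/

section Gradings

variable {N : Type*} [AddCommGroup N] {𝒩 : ℤ → AddSubgroup N}

/-- A grading of an abelian group, given by the projections to the homogeneous components. -/
structure GradingProj {N : Type*} [AddCommGroup N] (𝒩 : ℤ → AddSubgroup N) where
  /-- The projection to a homogeneous component. -/
  proj : ℤ → N →+ N
  proj_mem : ∀ μ u, proj μ u ∈ 𝒩 μ
  proj_of_mem : ∀ μ, ∀ u ∈ 𝒩 μ, proj μ u = u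
  proj_of_ne : ∀ μ ν, ν ≠ μ → ∀ u ∈ 𝒩 ν, proj μ u = 0
  mem_closure : ∀ u, u ∈ AddSubgroup.closure {v | ∃ μ, v ∈ 𝒩 μ}

namespace GradingProj

variable (p : GradingProj 𝒩)
include p

@[elab_as_elim]
theorem induction {P : N → Prop} (h1 : ∀ μ, ∀ u ∈ 𝒩 μ, P u) (h2 : ∀ u v, P u → P v → P (u + v))
    (u : N) : P u := by
  have := p.mem_closure u
  induction this using AddSubgroup.closure_induction'' with
  | mem u hu => obtain ⟨μ, hu⟩ := hu; exact h1 μ u hu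
  | neg_mem u hu => obtain ⟨μ, hu⟩ := hu; exact h1 μ _ (neg_mem hu)
  | zero => exact h1 0 0 (zero_mem _)
  | add u v _ _ hu hv => exact h2 u v hu hv

theorem exists_sum_eq (u : N) : ∃ F : Finset ℤ, ∀ F', F ⊆ F' → ∑ μ ∈ F', p.proj μ u = u := by
  induction u using p.induction with
  | h1 μ u hu =>
    refine ⟨{μ}, fun F' hF => ?_⟩
    rw [Finset.sum_eq_single_of_mem μ (hF (Finset.mem_singleton_self μ)), p.proj_of_mem μ u hu]
    intro ν _ hν
    exact p.proj_of_ne ν μ (Ne.symm hν) u hu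
  | h2 u v hu hv =>
    classical
    obtain ⟨F, hF⟩ := hu
    obtain ⟨G, hG⟩ := hv
    refine ⟨F ∪ G, fun F' hF' => ?_⟩
    simp only [map_add, Finset.sum_add_distrib]
    rw [hF F' (Finset.subset_union_left.trans hF'), hG F' (Finset.subset_union_right.trans hF')]

theorem proj_map {T : N →+ N} {δ : ℤ} (hT : ∀ μ, ∀ u ∈ 𝒩 μ, T u ∈ 𝒩 (μ + δ)) (μ : ℤ) (u : N) :
    p.proj (μ + δ) (T u) = T (p.proj μ u) := by
  induction u using p.induction with
  | h1 ν u hu =>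
    by_cases h : ν = μ
    · subst h
      rw [p.proj_of_mem _ u hu, p.proj_of_mem _ _ (hT _ u hu)]
    · rw [p.proj_of_ne _ _ h u hu, p.proj_of_ne _ _ (fun h' => h (add_right_cancel h')) _ (hT _ u hu),
        map_zero]
  | h2 u v hu hv => rw [map_add, map_add, map_add, map_add, hu, hv]

theorem exists_bound (u : N) : ∃ D : ℤ, ∀ μ > D, p.proj μ u = 0 := by
  induction u using p.induction with
  | h1 ν u hu => exact ⟨ν, fun μ hμ => p.proj_of_ne μ ν (ne_of_lt hμ) u hu⟩
  | h2 u v hu hv =>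
    obtain ⟨D, hD⟩ := hu
    obtain ⟨E, hE⟩ := hv
    refine ⟨max D E, fun μ hμ => ?_⟩
    rw [map_add, hD μ (lt_of_le_of_lt (le_max_left _ _) hμ),
      hE μ (lt_of_le_of_lt (le_max_right _ _) hμ), add_zero]

variable {S : Type*} [CommRing S] [Module S N]

/-- The induced grading on a homogeneous submodule. -/
def ofSubmodule (K : Submodule S N) (hK : ∀ μ, ∀ u ∈ K, p.proj μ u ∈ K) :
    GradingProj fun μ => (𝒩 μ).comap K.subtype.toAddMonoidHom where
  proj μ := ((p.proj μ).comp K.subtype.toAddMonoidHom).codRestrict K.toAddSubgroup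
    fun u => hK μ u u.2
  proj_mem μ u := p.proj_mem μ u
  proj_of_mem μ u hu := Subtype.ext (p.proj_of_mem μ u hu)
  proj_of_ne μ ν h u hu := Subtype.ext (p.proj_of_ne μ ν h u hu)
  mem_closure u := by
    obtain ⟨F, hF⟩ := p.exists_sum_eq u
    have : u = ∑ μ ∈ F, ⟨p.proj μ u, hK μ u u.2⟩ := by
      apply Subtype.ext
      rw [AddSubmonoidClass.coe_finsetSum]
      exact (hF F subset_rfl).symm
    rw [this]
    exact sum_mem fun μ _ => AddSubgroup.subset_closure ⟨μ, p.proj_mem μ u⟩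

/-- The induced grading on the quotient by a homogeneous submodule. -/
def ofQuotient (K : Submodule S N) (hK : ∀ μ, ∀ u ∈ K, p.proj μ u ∈ K) :
    GradingProj fun μ => (𝒩 μ).map K.mkQ.toAddMonoidHom where
  proj μ := QuotientAddGroup.map K.toAddSubgroup K.toAddSubgroup (p.proj μ) fun u hu => hK μ u hu
  proj_mem μ u := by
    obtain ⟨u, rfl⟩ := K.mkQ_surjective u
    exact ⟨_, p.proj_mem μ u, rfl⟩
  proj_of_mem := by
    rintro μ _ ⟨u, hu, rfl⟩
    exact congrArg K.mkQ (p.proj_of_mem μ u hu)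
  proj_of_ne := by
    rintro μ ν h _ ⟨u, hu, rfl⟩
    exact (congrArg K.mkQ (p.proj_of_ne μ ν h u hu)).trans (map_zero _)
  mem_closure u := by
    obtain ⟨u, rfl⟩ := K.mkQ_surjective u
    obtain ⟨F, hF⟩ := p.exists_sum_eq u
    rw [← hF F subset_rfl, map_sum]
    exact sum_mem fun μ _ => AddSubgroup.subset_closure ⟨μ, _, p.proj_mem μ u, rfl⟩

theorem proj_smul {T : S} {δ : ℤ} (hT : ∀ μ, ∀ u ∈ 𝒩 μ, T • u ∈ 𝒩 (μ + δ)) (μ : ℤ) (u : N) :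
    p.proj (μ + δ) (T • u) = T • p.proj μ u :=
  p.proj_map (T := DistribSMul.toAddMonoidHom N T) hT μ u

theorem proj_mem_ker {T : S} {δ : ℤ} (hT : ∀ μ, ∀ u ∈ 𝒩 μ, T • u ∈ 𝒩 (μ + δ)) (μ : ℤ) (u : N)
    (hu : u ∈ LinearMap.ker (LinearMap.lsmul S N T)) :
    p.proj μ u ∈ LinearMap.ker (LinearMap.lsmul S N T) := by
  rw [LinearMap.mem_ker, LinearMap.lsmul_apply] at hu ⊢
  rw [← p.proj_smul hT, hu, map_zero]

theorem proj_mem_range {T : S} {δ : ℤ} (hT : ∀ μ, ∀ u ∈ 𝒩 μ, T • u ∈ 𝒩 (μ + δ)) (μ : ℤ) (u : N)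
    (hu : u ∈ LinearMap.range (LinearMap.lsmul S N T)) :
    p.proj μ u ∈ LinearMap.range (LinearMap.lsmul S N T) := by
  obtain ⟨v, rfl⟩ := hu
  refine ⟨p.proj (μ - δ) v, ?_⟩
  rw [LinearMap.lsmul_apply, LinearMap.lsmul_apply, ← p.proj_smul hT, sub_add_cancel]

/-- The projection of an arbitrary preimage is a homogeneous preimage, because projections commute
with homogeneous operators up to the shift. -/
theorem exists_smul_eq {T : S} {δ : ℤ} (hT : ∀ μ, ∀ u ∈ 𝒩 μ, T • u ∈ 𝒩 (μ + δ)) {μ : ℤ} {u : N}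
    (hu : u ∈ 𝒩 (μ + δ)) (h : u ∈ LinearMap.range (LinearMap.lsmul S N T)) :
    ∃ v ∈ 𝒩 μ, T • v = u := by
  obtain ⟨v, rfl⟩ := h
  exact ⟨p.proj μ v, p.proj_mem μ v, by rw [← p.proj_smul hT]; exact p.proj_of_mem _ _ hu⟩

end GradingProj

end Gradings

/-! ### Components of finite modules on which every `x_j` acts as zero -/

section Devissage

variable {A B S : Type*} [CommRing A] [CommRing B] [CommRing S] [Algebra A S] [Algebra B S]
  {n : ℕ} {x : Fin n → A} {w : Fin n → ℕ} {κ : Type*} {τ : κ → S} {δ : κ → ℕ}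

/-- A graded module over `S`, where the `x_j` have degree `w_j`, the elements `τ_l` have degree
`-δ_l`, and `B` has degree zero. -/
structure OperatorGrading (x : Fin n → A) (w : Fin n → ℕ) (τ : κ → S) (δ : κ → ℕ) (B : Type*)
    [CommRing B] {N : Type*} [AddCommGroup N] [Module S N] [Module A N] [Module B N]
    (𝒩 : ℤ → AddSubgroup N) extends GradingProj 𝒩 where
  acts : ActsWithDegree x w 𝒩
  stable : StableUnder B 𝒩
  lower : ∀ l μ, ∀ u ∈ 𝒩 μ, τ l • u ∈ 𝒩 (μ + -(δ l : ℤ))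

namespace OperatorGrading

variable {N : Type*} [AddCommGroup N] [Module S N] [Module A N] [Module B N]
  [IsScalarTower A S N] [IsScalarTower B S N] {𝒩 : ℤ → AddSubgroup N}

/-- The induced structure on a homogeneous submodule. -/
def ofSubmodule (p : OperatorGrading x w τ δ B 𝒩) (K : Submodule S N)
    (hK : ∀ μ, ∀ u ∈ K, p.proj μ u ∈ K) :
    OperatorGrading x w τ δ B fun μ => (𝒩 μ).comap K.subtype.toAddMonoidHom where
  toGradingProj := p.toGradingProj.ofSubmodule K hK
  acts j μ u hu := p.acts j μ u hu
  stable b μ u hu := p.stable b μ u hu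
  lower l μ u hu := p.lower l μ u hu

/-- The induced structure on the quotient by a homogeneous submodule. -/
def ofQuotient (p : OperatorGrading x w τ δ B 𝒩) (K : Submodule S N)
    (hK : ∀ μ, ∀ u ∈ K, p.proj μ u ∈ K) :
    OperatorGrading x w τ δ B fun μ => (𝒩 μ).map K.mkQ.toAddMonoidHom where
  toGradingProj := p.toGradingProj.ofQuotient K hK
  acts := by
    rintro j μ _ ⟨u, hu, rfl⟩
    exact ⟨_, p.acts j μ u hu, rfl⟩
  stable := by
    rintro b μ _ ⟨u, hu, rfl⟩
    exact ⟨_, p.stable b μ u hu, rfl⟩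
  lower := by
    rintro l μ _ ⟨u, hu, rfl⟩
    exact ⟨_, p.lower l μ u hu, rfl⟩

omit [Algebra B S] [IsScalarTower B S N] in
theorem smul_mem (p : OperatorGrading x w τ δ B 𝒩) (j : Fin n) (μ : ℤ) (u : N) (hu : u ∈ 𝒩 μ) :
    algebraMap A S (x j) • u ∈ 𝒩 (μ + w j) := by
  rw [algebraMap_smul]
  exact p.acts j μ u hu

/-- Every `S`-module operation is built from the generators. -/
theorem exists_bound (p : OperatorGrading x w τ δ B 𝒩) [Module.Finite S N]
    (hgen : Algebra.adjoin B (Set.range (algebraMap A S ∘ x) ∪ Set.range τ) = ⊤)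
    (hx : ∀ j (u : N), x j • u = 0) : ∃ D : ℤ, ∀ μ > D, ∀ u ∈ 𝒩 μ, u = 0 := by
  obtain ⟨G, hG⟩ := (Module.Finite.fg_top : (⊤ : Submodule S N).FG)
  choose D hD using p.toGradingProj.exists_bound
  obtain ⟨E, hE⟩ : ∃ E, ∀ g ∈ G, D g ≤ E := by
    obtain ⟨E, hE⟩ := (G.image D).bddAbove
    exact ⟨E, fun g hg => hE (Finset.mem_coe.2 (Finset.mem_image_of_mem D hg))⟩
  -- No generator of `S` raises degrees here: the `x_j` act as zero, the `τ_l` lower degrees and `B`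
  -- preserves them. The bound `E` for the module generators therefore holds everywhere.
  have hs : ∀ s : S, ∀ u, (∀ μ > E, p.proj μ u = 0) → ∀ μ > E, p.proj μ (s • u) = 0 := by
    intro s
    have : s ∈ Algebra.adjoin B (Set.range (algebraMap A S ∘ x) ∪ Set.range τ) :=
      hgen ▸ Algebra.mem_top
    induction this using Algebra.adjoin_induction with
    | mem s hs =>
      intro u hu μ hμ
      rcases hs with ⟨j, rfl⟩ | ⟨l, rfl⟩
      · rw [Function.comp_apply, algebraMap_smul, hx, map_zero]
      · have := p.toGradingProj.proj_smul (p.lower l) (μ + δ l) u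
        rw [add_neg_cancel_right] at this
        rw [this, hu _ (by omega), smul_zero]
    | algebraMap b =>
      intro u hu μ hμ
      have := p.toGradingProj.proj_map (T := DistribSMul.toAddMonoidHom N b) (δ := 0)
        (fun μ u hu => by rw [add_zero]; exact p.stable b μ u hu) μ u
      rw [add_zero, hu μ hμ, map_zero] at this
      rw [algebraMap_smul]
      exact this
    | add s s' _ _ h h' =>
      intro u hu μ hμ
      rw [add_smul, map_add, h u hu μ hμ, h' u hu μ hμ, add_zero]
    | mul s s' _ _ h h' =>
      intro u hu μ hμ
      rw [mul_smul]
      exact h _ (h' u hu) μ hμ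
  have hall : ∀ u : N, ∀ μ > E, p.proj μ u = 0 := by
    intro u
    have hu : u ∈ Submodule.span S (G : Set N) := hG ▸ Submodule.mem_top
    induction hu using Submodule.span_induction with
    | mem g hg => exact fun μ hμ => hD g μ (lt_of_le_of_lt (hE g hg) hμ)
    | zero => exact fun μ _ => map_zero _
    | add u v _ _ hu hv => exact fun μ hμ => by rw [map_add, hu μ hμ, hv μ hμ, add_zero]
    | smul s u _ hu => exact hs s u hu
  exact ⟨E, fun μ hμ u hu => by rw [← p.proj_of_mem μ u hu, hall u μ hμ]⟩

/-- A homogeneous component as a module over `B`. -/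
def component (hB : StableUnder B 𝒩) (μ : ℤ) : Submodule B N :=
  { 𝒩 μ with smul_mem' := fun b u hu => hB b μ u hu }

omit [Module A N] [IsScalarTower A S N] in
-- When the algebra generators of `S` act as zero, module generators over `S` already generate over
-- `B`.
theorem isNoetherian_of_annihilated [IsNoetherianRing B] [Module.Finite S N]
    (Y : Set S) (hgen : Algebra.adjoin B Y = ⊤) (hY : ∀ y ∈ Y, ∀ u : N, y • u = 0) :
    IsNoetherian B N := by
  obtain ⟨G, hG⟩ := (Module.Finite.fg_top : (⊤ : Submodule S N).FG)
  have hs : ∀ s : S, ∀ u ∈ Submodule.span B (G : Set N), s • u ∈ Submodule.span B (G : Set N) := by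
    intro s
    have : s ∈ Algebra.adjoin B Y := hgen ▸ Algebra.mem_top
    induction this using Algebra.adjoin_induction with
    | mem s hs => intro u _; rw [hY s hs]; exact zero_mem _
    | algebraMap b => intro u hu; rw [algebraMap_smul]; exact Submodule.smul_mem _ b hu
    | add s s' _ _ h h' => intro u hu; rw [add_smul]; exact add_mem (h u hu) (h' u hu)
    | mul s s' _ _ h h' => intro u hu; rw [mul_smul]; exact h _ (h' u hu)
  have : Module.Finite B N := by
    refine ⟨⟨G, top_unique fun u _ => ?_⟩⟩
    have hu : u ∈ Submodule.span S (G : Set N) := hG ▸ Submodule.mem_top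
    induction hu using Submodule.span_induction with
    | mem g hg => exact Submodule.subset_span hg
    | zero => exact zero_mem _
    | add u v _ _ hu hv => exact add_mem (hu trivial) (hv trivial)
    | smul s u _ hu => exact hs s u (hu trivial)
  infer_instance

end OperatorGrading

/-- The degrees are bounded above but not below, so inductions on the degree start beyond the bound
and descend in steps of `δ`. -/
theorem int_descending_induction {P : ℤ → Prop} (D : ℤ) (h1 : ∀ μ > D, P μ) (δ : ℕ) (hδ : 0 < δ)
    (h2 : ∀ μ, P (μ + δ) → P μ) (μ : ℤ) : P μ := by
  have : ∀ k : ℕ, ∀ μ, μ > D - k → P μ := by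
    intro k
    induction k with
    | zero => intro μ hμ; exact h1 μ (by simpa using hμ)
    | succ k ih => intro μ hμ; exact h2 μ (ih _ (by push_cast at hμ; omega))
  exact this (D - μ + 1).toNat μ (by omega)

open OperatorGrading in
-- Induction on the set of `τ_l` that may act nontrivially, for all modules at once since the step
-- passes to `N / τ_l N`. The component `N_μ` is an extension of a submodule of `(N / τ_l N)_μ` by
-- `τ_l N_{μ + δ_l}`. The latter is an image of a component of higher degree, which is Noetherian by
-- descending induction.
theorem isNoetherian_component [IsNoetherianRing B] [IsNoetherianRing S]
    (hgen : Algebra.adjoin B (Set.range (algebraMap A S ∘ x) ∪ Set.range τ) = ⊤)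
    (hδ : ∀ l, 0 < δ l) (F : Finset κ) :
    ∀ (N : Type v) [AddCommGroup N] [Module S N] [Module A N] [Module B N]
      [IsScalarTower A S N] [IsScalarTower B S N] [Module.Finite S N] (𝒩 : ℤ → AddSubgroup N)
      (p : OperatorGrading x w τ δ B 𝒩) (_ : ∀ j (u : N), x j • u = 0)
      (_ : ∀ l ∉ F, ∀ u : N, τ l • u = 0) (μ : ℤ), IsNoetherian B (component p.stable μ) := by
  classical
  induction F using Finset.induction_on with
  | empty =>
    intro N _ _ _ _ _ _ _ 𝒩 p hx hF μ
    have : IsNoetherian B N := by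
      refine isNoetherian_of_annihilated _ hgen ?_
      rintro _ (⟨j, rfl⟩ | ⟨l, rfl⟩) u
      · rw [Function.comp_apply, algebraMap_smul, hx]
      · exact hF l (Finset.notMem_empty l) u
    infer_instance
  | insert l F hl ih =>
    intro N _ _ _ _ _ _ _ 𝒩 p hx hF μ
    obtain ⟨D, hD⟩ := p.exists_bound hgen hx
    refine int_descending_induction (P := fun μ => IsNoetherian B (component p.stable μ)) D
      (fun μ hμ => ?_) (δ l) (hδ l) (fun μ hμ => ?_) μ
    · have : component p.stable μ = ⊥ := (Submodule.eq_bot_iff _).2 (hD μ hμ)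
      rw [this]
      infer_instance
    · let K := LinearMap.range (LinearMap.lsmul S N (τ l))
      let q := p.ofQuotient K (p.toGradingProj.proj_mem_range (p.lower l))
      have hq : IsNoetherian B (component q.stable μ) := by
        refine ih (N ⧸ K) _ q ?_ ?_ μ
        · intro j u
          obtain ⟨u, rfl⟩ := K.mkQ_surjective u
          have h1 : K.mkQ (x j • u) = 0 := by rw [hx, map_zero]
          exact h1
        · intro l' hl' u
          obtain ⟨u, rfl⟩ := K.mkQ_surjective u
          rw [← map_smul]
          by_cases h : l' = l
          · subst h
            exact (Submodule.Quotient.mk_eq_zero K).2 ⟨u, rfl⟩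
          · rw [hF l' (by simp [h, hl']), map_zero]
      have h3 := isNoetherian_range_of_ker
        ((K.mkQ.restrictScalars B) ∘ₗ (component p.stable μ).subtype)
        (component p.stable μ).subtype ?_ ?_
      · rwa [Submodule.range_subtype] at h3
      · refine @isNoetherian_of_le _ _ _ _ _ _ _ hq ?_
        rintro _ ⟨u, rfl⟩
        exact ⟨u, u.2, rfl⟩
      · have h4 : IsNoetherian B ((component p.stable (μ + δ l)).map
            ((LinearMap.lsmul S N (τ l)).restrictScalars B)) := by
          have := hμ
          exact isNoetherian_of_surjective
            (((LinearMap.lsmul S N (τ l)).restrictScalars B).submoduleMap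
              (component p.stable (μ + δ l))) (LinearMap.range_eq_top.2
                (LinearMap.submoduleMap_surjective _ _))
        refine @isNoetherian_of_le _ _ _ _ _ _ _ h4 ?_
        rintro _ ⟨u, hu, rfl⟩
        have hu1 : (u : N) ∈ K := (Submodule.Quotient.mk_eq_zero K).1 hu
        have hu2 : (u : N) ∈ 𝒩 (μ + δ l + -(δ l : ℤ)) := by
          rw [add_neg_cancel_right]
          exact u.2
        obtain ⟨v, hv, hvu⟩ := p.toGradingProj.exists_smul_eq (p.lower l) hu2 hu1
        exact ⟨v, hv, hvu⟩

end Devissage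

attribute [local instance 10] localizedModuleOperators

/-! ### Finiteness of the cohomology by dévissage along the `x_j` -/

section Devissage

variable {A B S : Type*} [CommRing A] [CommRing B] [CommRing S] [Algebra A S] [Algebra B S]
  {n : ℕ} {x : Fin n → A} {w : Fin n → ℕ} {κ : Type*} {τ : κ → S} {δ : κ → ℕ}

namespace OperatorGrading

variable {N : Type*} [AddCommGroup N] [Module S N] [Module A N] [Module B N]
  [IsScalarTower A S N] [IsScalarTower B S N] [SMulCommClass B A N] {𝒩 : ℤ → AddSubgroup N}

/-- The cohomology of a graded module is Noetherian over `B` in each degree, and zero in large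
degrees. -/
structure FiniteCohomology (x : Fin n → A) (w : Fin n → ℕ) (hB : StableUnder B 𝒩) : Prop where
  noetherian : ∀ i μ, NoetherianMod (cocycles x w hB i μ) (coboundaries x w hB i μ)
  vanishing : ∀ i, ∃ D : ℤ, ∀ μ > D, cechCocycles x w N 𝒩 i μ ≤ cechCoboundaries x w N 𝒩 i μ

omit [Module B N] [SMulCommClass B A N] in
-- For nonempty `s`, some `x_j` is both zero and invertible on `N_{x_s}`.
theorem cechTerm_succ_eq_zero (hx : ∀ j (u : N), x j • u = 0) (i : ℕ)
    (c : CechTerm x N (i + 1)) : c = 0 := by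
  ext s : 1
  obtain ⟨k, u, hc⟩ := exists_eq_frac x s.1 (c s)
  rw [hc, Pi.zero_apply, frac_eq_zero]
  obtain ⟨j, hj⟩ : s.1.Nonempty := Finset.card_pos.1 (by rw [s.2]; omega)
  refine ⟨1, ?_⟩
  rw [pow_one, ← Finset.mul_prod_erase _ _ hj, mul_smul, hx]

/-- The identification of `N` with the term `C^0`. -/
def cechZero (x : Fin n → A) (N : Type*) [AddCommGroup N] [Module A N] [Module B N]
    [SMulCommClass B A N] : N →ₗ[B] CechTerm x N 0 where
  toFun u s := frac x s.1 0 u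
  map_add' u v := by ext s : 1; exact map_add _ _ _
  map_smul' b u := by
    ext s : 1
    exact (locMap_frac x s.1 (Module.toModuleEnd A N b) 0 u).symm

theorem exists_cechZero_eq (hw : ActsWithDegree x w 𝒩) {μ : ℤ} {c : CechTerm x N 0}
    (hc : c ∈ cechTermDeg x w N 𝒩 0 μ) : ∃ u ∈ 𝒩 μ, cechZero (B := B) x N u = c := by
  obtain ⟨K, hK⟩ := hw.exists_frac_of_mem (mem_cechTermDeg.1 hc ⟨∅, rfl⟩)
  obtain ⟨u, hu, hcu⟩ := hK K le_rfl
  rw [Finset.sum_empty, mul_zero, add_zero] at hu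
  refine ⟨u, hu, ?_⟩
  ext s : 1
  obtain ⟨s, hs⟩ := s
  obtain rfl := Finset.card_eq_zero.1 hs
  rw [hcu]
  have h1 : (∏ j ∈ (∅ : Finset (Fin n)), x j) ^ K • u = u := by
    rw [Finset.prod_empty, one_pow, one_smul]
  have h2 := frac_raise x ∅ 0 K u
  rw [h1, zero_add] at h2
  exact h2.symm

theorem noetherianMod_cocycles_zero (hB : StableUnder B 𝒩) (hw : ActsWithDegree x w 𝒩) (μ : ℤ)
    (h : IsNoetherian B (component hB μ)) :
    NoetherianMod (cocycles x w hB 0 μ) (coboundaries x w hB 0 μ) := by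
  have h1 : NoetherianMod (component hB μ) (⊥ : Submodule B N) :=
    isNoetherian_of_surjective ((⊥ : Submodule B N).mkQ.submoduleMap (component hB μ))
      (LinearMap.range_eq_top.2 (LinearMap.submoduleMap_surjective _ _))
  refine (h1.map (cechZero x N) (D' := coboundaries x w hB 0 μ) ?_).mono ?_
  · rintro u rfl
    rw [map_zero]
    exact zero_mem _
  · intro c hc
    obtain ⟨u, hu, hcu⟩ := exists_cechZero_eq (B := B) hw (mem_cechCocycles.1 hc).1
    exact ⟨u, hu, hcu⟩

theorem finiteCohomology_of_annihilated (hB : StableUnder B 𝒩) (hw : ActsWithDegree x w 𝒩)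
    (hx : ∀ j (u : N), x j • u = 0) (h : ∀ μ, IsNoetherian B (component hB μ))
    (h0 : ∃ D : ℤ, ∀ μ > D, ∀ u ∈ 𝒩 μ, u = 0) : FiniteCohomology x w hB := by
  constructor
  · intro i μ
    cases i with
    | zero => exact noetherianMod_cocycles_zero hB hw μ (h μ)
    | succ i =>
      have : (cocycles x w hB (i + 1) μ) = ⊥ :=
        (Submodule.eq_bot_iff _).2 fun c _ => cechTerm_succ_eq_zero hx i c
      unfold NoetherianMod
      rw [this, Submodule.map_bot]
      infer_instance
  · intro i
    cases i with
    | zero =>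
      obtain ⟨D, hD⟩ := h0
      refine ⟨D, fun μ hμ c hc => ?_⟩
      obtain ⟨u, hu, rfl⟩ := exists_cechZero_eq (B := B) hw (mem_cechCocycles.1 hc).1
      rw [hD μ hμ u hu, map_zero]
      exact zero_mem _
    | succ i =>
      refine ⟨0, fun μ _ c _ => ?_⟩
      rw [cechTerm_succ_eq_zero hx i c]
      exact zero_mem _

/-- Above the bounds for `K` and `Q`, multiplication by `x_j` is injective on `H^i(N)`. As every
class is killed by a power of `x_j`, the cohomology is zero there. Below, descending induction
applies: `x_j` maps `H^i(N)_μ` to the Noetherian `H^i(N)_{μ + w_j}`, with a Noetherian kernel. -/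
theorem _root_.PowersCohomology.IsKerCoker.finiteCohomology {j : Fin n} {K Q : Type*}
    [AddCommGroup K] [Module A K] [AddCommGroup Q] [Module A Q] [Module B K] [SMulCommClass B A K]
    [Module B Q] [SMulCommClass B A Q] {𝒦 : ℤ → AddSubgroup K} {𝒬 : ℤ → AddSubgroup Q}
    {ι : K →ₗ[A] N} {π : N →ₗ[A] Q} (h : IsKerCoker x w j 𝒦 𝒩 𝒬 ι π)
    (hι : ∀ (b : B) u, ι (b • u) = b • ι u) (hπ : ∀ (b : B) u, π (b • u) = b • π u)
    (h𝒩 : ActsWithDegree x w 𝒩) (h𝒬 : ActsWithDegree x w 𝒬) (hw : 0 < w j)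
    {h𝒦B : StableUnder B 𝒦} (h𝒩B : StableUnder B 𝒩) {h𝒬B : StableUnder B 𝒬}
    (hK : FiniteCohomology x w h𝒦B) (hQ : FiniteCohomology x w h𝒬B) :
    FiniteCohomology x w h𝒩B := by
  have hvan : ∀ i, ∃ D : ℤ, ∀ μ > D,
      cechCocycles x w N 𝒩 i μ ≤ cechCoboundaries x w N 𝒩 i μ := by
    intro i
    obtain ⟨D1, hD1⟩ := hK.vanishing i
    -- For `i = 0` the truncated index is harmless: the vanishing for `Q` is used only when `i = l +
    -- 1`.
    obtain ⟨D2, hD2⟩ := hQ.vanishing (i - 1)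
    refine ⟨max D1 D2, fun μ hμ c hc => ?_⟩
    obtain ⟨k, hk⟩ := h𝒩.exists_pow_smul_mem_coboundaries j hc
    -- The factors `x_j` are cancelled one at a time; since `k w_j ≥ 0`, every cancellation takes
    -- place above the bounds.
    induction k with
    | zero => simpa using hk
    | succ k ih =>
      refine ih (h.mem_coboundaries_of_smul_mem h𝒩 h𝒬 (hD1 _ ?_) ?_
        (h𝒩.pow_smul_mem_cocycles j k hc) ?_)
      · have := le_max_left D1 D2
        have hk0 : (0 : ℤ) ≤ k * w j := by positivity
        omega
      · rintro l rfl
        refine hD2 _ ?_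
        have := le_max_right D1 D2
        have hk0 : (0 : ℤ) ≤ k * w j := by positivity
        rw [Nat.add_sub_cancel] at *
        omega
      · rwa [← mul_smul, ← pow_succ', add_assoc, ← add_one_mul, ← Nat.cast_succ]
  refine ⟨fun i μ => ?_, hvan⟩
  obtain ⟨D, hD⟩ := hvan i
  refine int_descending_induction (P := fun μ => NoetherianMod (cocycles x w h𝒩B i μ)
    (coboundaries x w h𝒩B i μ)) D (fun μ hμ => ?_) (w j) hw (fun μ hμ => ?_) μ
  · unfold NoetherianMod
    have : (cocycles x w h𝒩B i μ).map (coboundaries x w h𝒩B i μ).mkQ = ⊥ := by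
      rw [Submodule.eq_bot_iff]
      rintro _ ⟨c, hc, rfl⟩
      exact (Submodule.Quotient.mk_eq_zero _).2 (hD μ hμ hc)
    rw [this]
    infer_instance
  · let f : CechTerm x N i →ₗ[B] CechTerm x N i :=
      { toFun := fun c => x j • c
        map_add' := smul_add _
        map_smul' := fun b c => smul_smul_cechTerm i (x j) b c }
    refine hμ.of_map f (fun c hc => ?_) ?_
    · have := h𝒩.pow_smul_mem_cocycles j 1 hc
      rwa [pow_one, Nat.cast_one, one_mul] at this
    · exact h.noetherianMod_smul_ker hι hπ h𝒩 h𝒬 h𝒦B h𝒩B h𝒬B (hK.noetherian i μ)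
        (fun k _ => hQ.noetherian k _) (W := cocycles x w h𝒩B i μ ⊓
          (coboundaries x w h𝒩B i (μ + w j)).comap f) inf_le_left (fun c hc => hc.2)

end OperatorGrading

open OperatorGrading in
-- Induction on the set of `x_j` that may act nontrivially. The kernel and cokernel of `x_j` are
-- annihilated by `x_j`, and they stay finite over the Noetherian ring `S`.
theorem finiteCohomology_of_finite [IsNoetherianRing B] [IsNoetherianRing S] [Finite κ]
    (hgen : Algebra.adjoin B (Set.range (algebraMap A S ∘ x) ∪ Set.range τ) = ⊤)
    (hδ : ∀ l, 0 < δ l) (hw : ∀ j, 0 < w j) (F : Finset (Fin n)) :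
    ∀ (N : Type v) [AddCommGroup N] [Module S N] [Module A N] [Module B N]
      [IsScalarTower A S N] [IsScalarTower B S N] [SMulCommClass B A N] [Module.Finite S N]
      (𝒩 : ℤ → AddSubgroup N) (p : OperatorGrading x w τ δ B 𝒩)
      (_ : ∀ j ∉ F, ∀ u : N, x j • u = 0), FiniteCohomology x w p.stable := by
  induction F using Finset.induction_on with
  | empty =>
    intro N _ _ _ _ _ _ _ _ 𝒩 p hF
    have := Fintype.ofFinite κ
    have hx : ∀ j (u : N), x j • u = 0 := fun j => hF j (Finset.notMem_empty j)
    exact finiteCohomology_of_annihilated p.stable p.acts hx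
      (isNoetherian_component hgen hδ Finset.univ N 𝒩 p hx fun l hl =>
        absurd (Finset.mem_univ l) hl) (p.exists_bound hgen hx)
  | insert j F hj ih =>
    intro N _ _ _ _ _ _ _ _ 𝒩 p hF
    let T := LinearMap.lsmul S N (algebraMap A S (x j))
    have hT : ∀ u, T u = x j • u := fun u => algebraMap_smul S (x j) u
    let K := LinearMap.ker T
    let R := LinearMap.range T
    have hdeg := p.smul_mem j
    let pK := p.ofSubmodule K (p.toGradingProj.proj_mem_ker hdeg)
    let pQ := p.ofQuotient R (p.toGradingProj.proj_mem_range hdeg)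
    have : SMulCommClass B A K := ⟨fun b a u => Subtype.ext (smul_comm b a (u : N))⟩
    have : SMulCommClass B A (N ⧸ R) := ⟨fun b a u => by
      obtain ⟨u, rfl⟩ := R.mkQ_surjective u
      exact congrArg R.mkQ (smul_comm b a u)⟩
    have hK := ih K _ pK fun l hl u => by
      by_cases h : l = j
      · subst h
        exact Subtype.ext ((hT u).symm.trans u.2)
      · exact Subtype.ext (hF l (by simp [h, hl]) u)
    have hQ := ih (N ⧸ R) _ pQ fun l hl u => by
      obtain ⟨u, rfl⟩ := R.mkQ_surjective u
      by_cases h : l = j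
      · subst h
        exact (Submodule.Quotient.mk_eq_zero R).2 ⟨u, hT u⟩
      · exact (congrArg R.mkQ (hF l (by simp [h, hl]) u)).trans (map_zero _)
    have hker : IsKerCoker x w j (fun μ => (𝒩 μ).comap K.subtype.toAddMonoidHom) 𝒩
        (fun μ => (𝒩 μ).map R.mkQ.toAddMonoidHom) (K.subtype.restrictScalars A)
        (R.mkQ.restrictScalars A) :=
      { injective := Subtype.val_injective
        mem_iff := fun μ u => Iff.rfl
        exists_of_smul_eq_zero := fun u hu => ⟨⟨u, (hT u).trans hu⟩, rfl⟩
        map_mem := fun μ u hu => ⟨u, hu, rfl⟩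
        exists_lift := fun μ q hq => hq
        map_smul_eq_zero := fun u => (Submodule.Quotient.mk_eq_zero R).2 ⟨u, hT u⟩
        exists_of_map_eq_zero := fun μ u hu h => by
          obtain ⟨v, hv, hvu⟩ := p.toGradingProj.exists_smul_eq hdeg hu
            ((Submodule.Quotient.mk_eq_zero R).1 h)
          exact ⟨v, hv, by rw [← hvu, algebraMap_smul]⟩ }
    exact hker.finiteCohomology (fun b u => rfl) (fun b u => rfl) p.acts pQ.acts (hw j) p.stable
      hK hQ

end Devissage

/-! ### Homogeneous powers, and the Noetherian property of `A_0` -/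

section GradedPowers

variable {A : Type*} [CommRing A] {𝒜 : ℤ → AddSubgroup A} [GradedRing 𝒜]
  {M : Type*} [AddCommGroup M] [Module A M] {ℳ : ℤ → AddSubgroup M}

variable (ℳ) in
/-- The projections of a decomposition. -/
def gradingProj [DirectSum.Decomposition ℳ] : GradingProj ℳ where
  proj μ := ((ℳ μ).subtype.comp (DFinsupp.evalAddMonoidHom μ)).comp
    (DirectSum.decomposeAddEquiv ℳ).toAddMonoidHom
  proj_mem μ u := (DirectSum.decompose ℳ u μ).2
  proj_of_mem μ u hu := DirectSum.decompose_of_mem_same ℳ hu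
  proj_of_ne μ ν h u hu := DirectSum.decompose_of_mem_ne ℳ hu h
  mem_closure u := by
    classical
    rw [← DirectSum.sum_support_decompose ℳ u]
    exact sum_mem fun μ _ => AddSubgroup.subset_closure ⟨μ, (DirectSum.decompose ℳ u μ).2⟩

omit [GradedRing 𝒜] in
theorem smul_mem_graded [SetLike.GradedSMul 𝒜 ℳ] {k μ : ℤ} {a : A} {u : M} (ha : a ∈ 𝒜 k)
    (hu : u ∈ ℳ μ) : a • u ∈ ℳ (μ + k) := by
  have := SetLike.GradedSMul.smul_mem ha hu
  rwa [vadd_eq_add, add_comm] at this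

theorem isHomogeneous_pow {I : Ideal A} (hI : I.IsHomogeneous 𝒜) (t : ℕ) :
    (I ^ t).IsHomogeneous 𝒜 := by
  induction t with
  | zero =>
    rw [pow_zero, Ideal.one_eq_top]
    exact fun _ _ _ => Submodule.mem_top
  | succ t ih =>
    rw [pow_succ]
    exact ih.mul hI

theorem proj_mem_smul_top [DirectSum.Decomposition ℳ] [SetLike.GradedSMul 𝒜 ℳ] {I : Ideal A}
    (hI : I.IsHomogeneous 𝒜) (μ : ℤ) {u : M} (hu : u ∈ I • (⊤ : Submodule A M)) :
    (gradingProj ℳ).proj μ u ∈ I • (⊤ : Submodule A M) := by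
  classical
  induction hu using Submodule.smul_induction_on' with
  | smul a ha u _ =>
    rw [← DirectSum.sum_support_decompose 𝒜 a, Finset.sum_smul, map_sum]
    refine sum_mem fun k _ => ?_
    have := (gradingProj ℳ).proj_smul (T := (DirectSum.decompose 𝒜 a k : A)) (δ := k)
      (fun μ u hu => smul_mem_graded (DirectSum.decompose 𝒜 a k).2 hu) (μ - k) u
    rw [sub_add_cancel] at this
    rw [this]
    exact Submodule.smul_mem_smul (hI k ha) Submodule.mem_top
  | add u _ v _ hu hv =>
    rw [map_add]
    exact add_mem hu hv

variable (𝒜) in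
-- The projection `A → A_0` is an `A_0`-linear retraction, so an ideal of `A_0` is the contraction
-- of its extension. Extension thus embeds the ideals of `A_0` into those of `A`.
theorem isNoetherianRing_degZero [IsNoetherianRing A] : IsNoetherianRing (degZero 𝒜) := by
  have key : ∀ 𝔞 : Ideal (degZero 𝒜), (𝔞.map (algebraMap (degZero 𝒜) A)).comap
      (algebraMap (degZero 𝒜) A) = 𝔞 := by
    intro 𝔞
    refine le_antisymm (fun a ha => ?_) Ideal.le_comap_map
    -- The multiplier `r` makes the claim stable under scalars from `A`: a factor `r'` of `c` is
    -- absorbed into `r`.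
    have h1 : ∀ c ∈ 𝔞.map (algebraMap (degZero 𝒜) A), ∀ r : A,
        (⟨(gradingProj 𝒜).proj 0 (r * c), (gradingProj 𝒜).proj_mem 0 _⟩ : degZero 𝒜) ∈ 𝔞 := by
      intro c hc
      induction hc using Submodule.span_induction with
      | mem c hc =>
        obtain ⟨b, hb, rfl⟩ := hc
        intro r
        have h2 := (gradingProj 𝒜).proj_smul (T := (b : A)) (δ := 0) (fun μ u hu =>
          smul_mem_graded (𝒜 := 𝒜) b.2 hu) 0 r
        rw [add_zero, smul_eq_mul, smul_eq_mul, mul_comm] at h2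
        have : (⟨(gradingProj 𝒜).proj 0 (r * (algebraMap (degZero 𝒜) A b)),
            (gradingProj 𝒜).proj_mem 0 _⟩ : degZero 𝒜) =
            b * ⟨(gradingProj 𝒜).proj 0 r, (gradingProj 𝒜).proj_mem 0 _⟩ := Subtype.ext h2
        rw [this]
        exact 𝔞.mul_mem_right _ hb
      | zero =>
        intro r
        convert 𝔞.zero_mem using 1
        exact Subtype.ext ((congrArg _ (mul_zero r)).trans (map_zero _))
      | add c c' _ _ h h' =>
        intro r
        convert 𝔞.add_mem (h r) (h' r)
        refine Subtype.ext ?_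
        simp [mul_add]
      | smul r' c _ h =>
        intro r
        convert h (r * r') using 3
        rw [smul_eq_mul, mul_assoc]
    have h2 := h1 _ ha 1
    convert h2
    refine Subtype.ext ?_
    rw [one_mul]
    exact ((gradingProj 𝒜).proj_of_mem 0 _ a.2).symm
  have hmono : StrictMono fun 𝔞 : Ideal (degZero 𝒜) => 𝔞.map (algebraMap (degZero 𝒜) A) :=
    Monotone.strictMono_of_injective (fun _ _ h => Ideal.map_mono h)
      (Function.LeftInverse.injective key)
  exact isNoetherian_iff'.2 hmono.wellFoundedGT

end GradedPowers

/-! ### The Rees module as a finite module over `A[T_1, …, T_r]` -/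

section ReesOperators

variable {A : Type*} [CommRing A] (𝒜 : ℤ → AddSubgroup A) [GradedRing 𝒜]
  {m r : ℕ} (hmr : m ≤ r) {I : Ideal A} (f : Fin r → I)
  (M : Type*) [AddCommGroup M] [Module A M]

/-- `A[T_1, …, T_r]` as an algebra over `A_0[T_1, …, T_m]`. -/
@[reducible]
def bInclAlgebra : Algebra (BRing 𝒜 m) (MvPolynomial (Fin r) A) := (bIncl 𝒜 hmr).toAlgebra

namespace ReesModule

instance : IsScalarTower A (MvPolynomial (Fin r) A) (ReesModule hmr f M) where
  smul_assoc a s u := by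
    rw [Algebra.smul_def, mul_smul]
    rfl

instance : SMulCommClass (BRing 𝒜 m) A (ReesModule hmr f M) where
  smul_comm b a u := smul_comm (bIncl 𝒜 hmr b) (MvPolynomial.C a : MvPolynomial (Fin r) A) u

variable {M}

theorem smul_def (s : MvPolynomial (Fin r) A) (u : ReesModule hmr f M) :
    (s • u).1 = (reesMap f s : Polynomial A) • u.1 := rfl

theorem coeff_smul (a : A) (u : ReesModule hmr f M) (t : ℕ) :
    (a • u).1.coeff t = a • u.1.coeff t := by
  change ((MvPolynomial.C a : MvPolynomial (Fin r) A) • u).1.coeff t = _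
  rw [smul_def, reesMap, MvPolynomial.aeval_C]
  change (Polynomial.monomial 0 a • u.1).coeff t = _
  rw [PolynomialModule.monomial_smul_apply, if_pos (Nat.zero_le t), Nat.sub_zero]

theorem coeff_X_smul_succ (l : Fin r) (u : ReesModule hmr f M) (t : ℕ) :
    ((MvPolynomial.X l : MvPolynomial (Fin r) A) • u).1.coeff (t + 1) =
      (f l : A) • u.1.coeff t := by
  rw [smul_def, reesMap, MvPolynomial.aeval_X, PolynomialModule.monomial_smul_apply,
    if_pos (by omega), Nat.add_sub_cancel]

theorem coeff_X_smul_zero (l : Fin r) (u : ReesModule hmr f M) :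
    ((MvPolynomial.X l : MvPolynomial (Fin r) A) • u).1.coeff 0 = 0 := by
  rw [smul_def, reesMap, MvPolynomial.aeval_X, PolynomialModule.monomial_smul_apply,
    if_neg (by omega)]

theorem coeff_mem (u : ReesModule hmr f M) (t : ℕ) :
    u.1.coeff t ∈ I ^ t • (⊤ : Submodule A M) := u.2 t

theorem coeff_add (u v : ReesModule hmr f M) (t : ℕ) :
    (u + v).1.coeff t = u.1.coeff t + v.1.coeff t := rfl

variable {hmr f} in
theorem ext {u v : ReesModule hmr f M} (h : ∀ t, u.1.coeff t = v.1.coeff t) : u = v :=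
  Subtype.ext (PolynomialModule.coeff_injective (Finsupp.ext h))

/-- The projection to a summand of the Rees module. -/
def proj (t : ℕ) : ReesModule hmr f M →ₗ[A] (I ^ t • (⊤ : Submodule A M) : Submodule A M) where
  toFun u := ⟨u.1.coeff t, coeff_mem hmr f u t⟩
  map_add' _ _ := rfl
  map_smul' a u := Subtype.ext (coeff_smul hmr f a u t)

/-- The inclusion of a summand of the Rees module. -/
def incl (t : ℕ) : (I ^ t • (⊤ : Submodule A M) : Submodule A M) →ₗ[A] ReesModule hmr f M where
  toFun v := ⟨PolynomialModule.single A t (v : M), fun s => by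
    rw [PolynomialModule.coeff_single, Finsupp.single_apply]
    split_ifs with h
    · exact h ▸ v.2
    · exact zero_mem _⟩
  map_add' v v' := Subtype.ext (PolynomialModule.single_add t _ _)
  map_smul' a v := by
    refine ext fun s => ?_
    refine Eq.trans ?_ (coeff_smul hmr f a _ s).symm
    change (Finsupp.single t (a • (v : M))) s = a • (Finsupp.single t (v : M)) s
    rw [← Finsupp.smul_single, Finsupp.smul_apply]

theorem coeff_incl (t s : ℕ) (v : (I ^ t • (⊤ : Submodule A M) : Submodule A M)) :
    (incl hmr f t v).1.coeff s = if t = s then (v : M) else 0 := by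
  change (Finsupp.single t (v : M)) s = _
  rw [Finsupp.single_apply]

theorem proj_incl (t : ℕ) (v : (I ^ t • (⊤ : Submodule A M) : Submodule A M)) :
    proj hmr f t (incl hmr f t v) = v :=
  Subtype.ext ((coeff_incl hmr f t t v).trans (if_pos rfl))

theorem sum_incl_proj (u : ReesModule hmr f M) (F : Finset ℕ)
    (hF : ∀ t ∉ F, u.1.coeff t = 0) : ∑ t ∈ F, incl hmr f t (proj hmr f t u) = u := by
  refine ext fun s => ?_
  have h1 : ∀ F : Finset ℕ, (∑ t ∈ F, incl hmr f t (proj hmr f t u)).1.coeff s =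
      ∑ t ∈ F, if t = s then u.1.coeff t else 0 := by
    intro F
    induction F using Finset.induction_on with
    | empty => rfl
    | insert a F ha ih =>
      rw [Finset.sum_insert ha, Finset.sum_insert ha, coeff_add, ih, coeff_incl]
      rfl
  rw [h1, Finset.sum_ite_eq']
  split_ifs with hs
  · rfl
  · exact (hF s hs).symm

theorem X_smul_incl (l : Fin r) (t : ℕ) (v : (I ^ t • (⊤ : Submodule A M) : Submodule A M))
    (v' : (I ^ (t + 1) • (⊤ : Submodule A M) : Submodule A M)) (h : (v' : M) = (f l : A) • (v : M)) :
    (MvPolynomial.X l : MvPolynomial (Fin r) A) • incl hmr f t v = incl hmr f (t + 1) v' := by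
  refine ext fun s => ?_
  cases s with
  | zero => rw [coeff_X_smul_zero, coeff_incl, if_neg (by omega)]
  | succ s =>
    rw [coeff_X_smul_succ, coeff_incl, coeff_incl]
    by_cases hs : t = s
    · rw [if_pos hs, if_pos (by omega), h]
    · rw [if_neg hs, if_neg (by omega), smul_zero]

variable (M) in
-- From `t = p` on, each summand is obtained from the previous one by multiplying with the `f_l`,
-- which is the action of the `T_l`. The summands with `t ≤ p` thus generate, and each is finite
-- over the Noetherian ring `A`.
theorem finite [IsNoetherianRing A] [Module.Finite A M] {J : Ideal A}
    (hJ : J = Ideal.span (Set.range fun l => (f l : A)))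
    (hred : ∃ p : ℕ, (J * I ^ p) • (⊤ : Submodule A M) = I ^ (p + 1) • (⊤ : Submodule A M)) :
    Module.Finite (MvPolynomial (Fin r) A) (ReesModule hmr f M) := by
  obtain ⟨p, hp⟩ := hred
  -- Multiplying the equality `J I^p M = I^{p+1} M` by `I^k` propagates it to all larger exponents.
  have hp' : ∀ k, I ^ (p + k + 1) • (⊤ : Submodule A M) =
      J • (I ^ (p + k) • (⊤ : Submodule A M)) := by
    intro k
    rw [show p + k + 1 = k + (p + 1) by ring, pow_add I k, ← smul_eq_mul, Submodule.smul_assoc,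
      ← hp, ← Submodule.smul_assoc, ← Submodule.smul_assoc]
    congr 1
    simp only [smul_eq_mul]
    ring
  let G : Submodule (MvPolynomial (Fin r) A) (ReesModule hmr f M) :=
    ⨆ t ∈ Finset.range (p + 1),
      Submodule.span _ (Set.range (incl (hmr := hmr) (f := f) (M := M) t))
  have hfg : G.FG := by
    refine Submodule.fg_biSup _ _ fun t _ => ?_
    obtain ⟨g, hg⟩ := (IsNoetherian.noetherian (⊤ : Submodule A
      (I ^ t • (⊤ : Submodule A M) : Submodule A M)))
    classical
    refine ⟨g.image (incl hmr f t), le_antisymm (Submodule.span_mono ?_)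
      (Submodule.span_le.2 ?_)⟩
    · intro _ hu
      obtain ⟨v, _, rfl⟩ := Finset.mem_image.1 (Finset.mem_coe.1 hu)
      exact ⟨v, rfl⟩
    · rintro _ ⟨v, rfl⟩
      have hv : v ∈ Submodule.span A (g : Set _) := hg ▸ Submodule.mem_top
      induction hv using Submodule.span_induction with
      | mem v hv =>
        exact Submodule.subset_span (Finset.mem_coe.2 (Finset.mem_image_of_mem _ hv))
      | zero => rw [map_zero]; exact zero_mem _
      | add v v' _ _ hv hv' => rw [map_add]; exact add_mem hv hv'
      | smul a v _ hv =>
        rw [map_smul, ← algebraMap_smul (MvPolynomial (Fin r) A) a (incl hmr f t v)]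
        exact Submodule.smul_mem _ _ hv
  have hG0 : ∀ t ≤ p, ∀ v, incl hmr f t v ∈ G := fun t ht v =>
    (le_biSup (fun t => Submodule.span (MvPolynomial (Fin r) A)
      (Set.range (incl (hmr := hmr) (f := f) (M := M) t)))
      (Finset.mem_range.2 (Nat.lt_succ_of_le ht))) (Submodule.subset_span ⟨v, rfl⟩)
  have hG : ∀ k, ∀ v, incl hmr f (p + k) v ∈ G := by
    intro k
    induction k with
    | zero => exact fun v => hG0 _ (by omega) v
    | succ k ih =>
      have h1 : ∀ v ∈ J • (I ^ (p + k) • (⊤ : Submodule A M)), ∀ hv, incl hmr f (p + k + 1) ⟨v, hv⟩ ∈ G := by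
        intro v hv
        have hle := (hp' k).ge
        induction hv using Submodule.smul_induction_on' with
        | smul a ha v hv =>
          rw [hJ] at ha
          induction ha using Submodule.span_induction with
          | mem a ha =>
            obtain ⟨l, rfl⟩ := ha
            intro hv'
            rw [← X_smul_incl hmr f l (p + k) ⟨v, hv⟩ _ rfl]
            exact Submodule.smul_mem _ _ (ih _)
          | zero =>
            intro hv'
            have : (⟨(0 : A) • v, hv'⟩ : (I ^ (p + k + 1) • (⊤ : Submodule A M) : Submodule A M)) = 0 :=
              Subtype.ext (zero_smul A v)
            rw [this, map_zero]
            exact zero_mem _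
          | add a a' ha ha' h h' =>
            intro hv'
            have h2 := hle (Submodule.smul_mem_smul (hJ ▸ ha : a ∈ J) hv)
            have h3 := hle (Submodule.smul_mem_smul (hJ ▸ ha' : a' ∈ J) hv)
            have : (⟨(a + a') • v, hv'⟩ : (I ^ (p + k + 1) • (⊤ : Submodule A M) : Submodule A M)) =
              ⟨a • v, h2⟩ + ⟨a' • v, h3⟩ := Subtype.ext (add_smul a a' v)
            rw [this, map_add]
            exact add_mem (h h2) (h' h3)
          | smul b a ha h =>
            intro hv'
            have h2 := hle (Submodule.smul_mem_smul (hJ ▸ ha : a ∈ J) hv)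
            have : (⟨(b • a) • v, hv'⟩ : (I ^ (p + k + 1) • (⊤ : Submodule A M) : Submodule A M)) =
              b • ⟨a • v, h2⟩ := Subtype.ext (smul_assoc b a v)
            rw [this, map_smul, ← algebraMap_smul (MvPolynomial (Fin r) A) b (incl hmr f _ _)]
            exact Submodule.smul_mem _ _ (h h2)
        | add v hv v' hv' h h' =>
          intro hvv
          have : (⟨v + v', hvv⟩ : (I ^ (p + k + 1) • (⊤ : Submodule A M) : Submodule A M)) =
            ⟨v, hle hv⟩ + ⟨v', hle hv'⟩ := rfl
          rw [this, map_add]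
          exact add_mem (h _) (h' _)
      exact fun v => h1 v ((hp' k).le v.2) v.2
  refine ⟨?_⟩
  convert hfg
  refine (top_unique fun u _ => ?_).symm
  rw [← sum_incl_proj hmr f u u.1.coeff.support fun t ht => Finsupp.notMem_support_iff.1 ht]
  refine sum_mem fun t _ => ?_
  rcases le_total t p with h | h
  · exact hG0 t h _
  · obtain ⟨k, rfl⟩ := Nat.exists_eq_add_of_le h
    exact hG k _

end ReesModule

end ReesOperators

/-! ### Čech cohomology commutes with localization at a prime -/

section Stalks

variable {A R : Type*} [CommRing A] [CommRing R] {n : ℕ} {x : Fin n → A} {w : Fin n → ℕ}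
  {N : Type*} [AddCommGroup N] [Module A N] [Module R N] [SMulCommClass R A N]
  {𝒩 : ℤ → AddSubgroup N} (q : Ideal R) [q.IsPrime]

/-- Multiplication by an element of the localization. -/
def tensorMul (A : Type*) [CommRing A] (N : Type*) [AddCommGroup N] [Module A N] [Module R N]
    [SMulCommClass R A N] (c : Localization.AtPrime q) :
    (N ⊗[R] Localization.AtPrime q) →ₗ[A] (N ⊗[R] Localization.AtPrime q) where
  toFun := LinearMap.lTensor N (LinearMap.mulLeft R c)
  map_add' := map_add _
  map_smul' a z := by
    induction z using TensorProduct.induction_on with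
    | zero => simp
    | tmul u c' =>
      rw [TensorProduct.smul_tmul', LinearMap.lTensor_tmul, LinearMap.lTensor_tmul,
        RingHom.id_apply, TensorProduct.smul_tmul']
    | add z z' h h' => rw [smul_add, map_add, h, h', map_add, smul_add]

@[simp]
theorem tensorMul_tmul (c c' : Localization.AtPrime q) (u : N) :
    tensorMul q A N c (u ⊗ₜ c') = u ⊗ₜ (c * c') := rfl

theorem tensorMul_mul (c c' : Localization.AtPrime q) (z : N ⊗[R] Localization.AtPrime q) :
    tensorMul q A N (c * c') z = tensorMul q A N c (tensorMul q A N c' z) := by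
  induction z using TensorProduct.induction_on with
  | zero => simp
  | tmul u d => simp [mul_assoc]
  | add z z' h h' => rw [map_add, h, h', map_add, map_add]

theorem tensorMul_one : tensorMul q A N 1 = LinearMap.id := by
  ext z
  induction z using TensorProduct.induction_on with
  | zero => simp
  | tmul u d => simp
  | add z z' h h' => rw [map_add, h, h', map_add]

/-- The map `u ↦ u ⊗ 1`. -/
def toStalk (A : Type*) [CommRing A] (N : Type*) [AddCommGroup N] [Module A N] [Module R N]
    [SMulCommClass R A N] : N →ₗ[A] (N ⊗[R] Localization.AtPrime q) where
  toFun u := u ⊗ₜ 1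
  map_add' u v := TensorProduct.add_tmul u v 1
  map_smul' a u := (TensorProduct.smul_tmul' a u 1).symm

theorem tensorMul_algebraMap_toStalk (b : R) (u : N) :
    tensorMul q A N (algebraMap R _ b) (toStalk q A N u) = toStalk q A N (b • u) := by
  change u ⊗ₜ (algebraMap R (Localization.AtPrime q) b * 1) = (b • u) ⊗ₜ 1
  rw [mul_one, Algebra.algebraMap_eq_smul_one, TensorProduct.tmul_smul, TensorProduct.smul_tmul']

theorem exists_smul_eq_zero_of_toStalk {u : N} (h : toStalk q A N u = 0) :
    ∃ b ∉ q, b • u = 0 := by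
  have h1 : TensorProduct.mk R (Localization.AtPrime q) N 1 u = 0 := by
    have := congrArg (TensorProduct.comm R N (Localization.AtPrime q)) h
    rw [map_zero] at this
    exact this
  obtain ⟨b, hb⟩ := (IsLocalizedModule.eq_zero_iff q.primeCompl
    (TensorProduct.mk R (Localization.AtPrime q) N 1)).1 h1
  exact ⟨b, b.2, hb⟩

variable (𝒩) in
/-- The grading of `N ⊗ R_q` with `R_q` in degree zero. -/
def stalkDeg (μ : ℤ) : AddSubgroup (N ⊗[R] Localization.AtPrime q) :=
  AddSubgroup.closure {z | ∃ u ∈ 𝒩 μ, ∃ c : Localization.AtPrime q, z = u ⊗ₜ c}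

theorem toStalk_mem {μ : ℤ} {u : N} (hu : u ∈ 𝒩 μ) : toStalk q A N u ∈ stalkDeg 𝒩 q μ :=
  AddSubgroup.subset_closure ⟨u, hu, 1, rfl⟩

theorem tensorMul_mem (c : Localization.AtPrime q) {μ : ℤ} {z : N ⊗[R] Localization.AtPrime q}
    (hz : z ∈ stalkDeg 𝒩 q μ) : tensorMul q A N c z ∈ stalkDeg 𝒩 q μ := by
  induction hz using AddSubgroup.closure_induction with
  | mem z hz =>
    obtain ⟨u, hu, d, rfl⟩ := hz
    exact AddSubgroup.subset_closure ⟨u, hu, c * d, rfl⟩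
  | zero => rw [map_zero]; exact zero_mem _
  | add z z' _ _ hz hz' => rw [map_add]; exact add_mem hz hz'
  | neg z _ hz => rw [map_neg]; exact neg_mem hz

theorem ActsWithDegree.stalk (h : ActsWithDegree x w 𝒩) :
    ActsWithDegree x w (stalkDeg 𝒩 q) := by
  intro j μ z hz
  induction hz using AddSubgroup.closure_induction with
  | mem z hz =>
    obtain ⟨u, hu, d, rfl⟩ := hz
    exact AddSubgroup.subset_closure ⟨_, h j μ u hu, d, TensorProduct.smul_tmul' _ _ _⟩
  | zero => rw [smul_zero]; exact zero_mem _
  | add z z' _ _ hz hz' => rw [smul_add]; exact add_mem hz hz'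
  | neg z _ hz => rw [smul_neg]; exact neg_mem hz

/-- Clearing denominators preserves the degree, because the operators from `R` have degree zero. -/
theorem exists_tensorMul_eq (hR : StableUnder R 𝒩) {μ : ℤ} {z : N ⊗[R] Localization.AtPrime q}
    (hz : z ∈ stalkDeg 𝒩 q μ) : ∃ b ∉ q, ∃ u ∈ 𝒩 μ,
      tensorMul q A N (algebraMap R _ b) z = toStalk q A N u := by
  induction hz using AddSubgroup.closure_induction with
  | mem z hz =>
    obtain ⟨u, hu, d, rfl⟩ := hz
    obtain ⟨⟨a, b⟩, hab⟩ := IsLocalization.surj q.primeCompl d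
    refine ⟨b, b.2, a • u, hR a μ u hu, ?_⟩
    rw [tensorMul_tmul, mul_comm, hab, ← tensorMul_algebraMap_toStalk]
    change _ = u ⊗ₜ (algebraMap R (Localization.AtPrime q) a * 1)
    rw [mul_one]
  | zero => exact ⟨1, q.one_notMem, 0, zero_mem _, by rw [map_zero, map_zero]⟩
  | add z z' _ _ hz hz' =>
    obtain ⟨b, hb, u, hu, h⟩ := hz
    obtain ⟨b', hb', u', hu', h'⟩ := hz'
    refine ⟨b * b', fun h => ((‹q.IsPrime›.mem_or_mem h).elim hb hb'), b' • u + b • u',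
      add_mem (hR _ _ _ hu) (hR _ _ _ hu'), ?_⟩
    rw [map_add, map_add, ← tensorMul_algebraMap_toStalk, ← tensorMul_algebraMap_toStalk, ← h, ← h',
      ← tensorMul_mul, ← tensorMul_mul, map_mul, mul_comm (algebraMap R _ b')]
  | neg z _ hz =>
    obtain ⟨b, hb, u, hu, h⟩ := hz
    exact ⟨b, hb, -u, neg_mem hu, by rw [map_neg, map_neg, h]⟩

/-- The product of finitely many elements outside a prime stays outside it. This gives one
denominator for all components of a cochain, or for all generators. -/
theorem exists_notMem_forall {ι : Type*} [Finite ι] {P : ι → R → Prop}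
    (h : ∀ s, ∃ b ∉ q, P s b) (hP : ∀ s b c, c ∉ q → P s b → P s (c * b)) :
    ∃ b ∉ q, ∀ s, P s b := by
  classical
  have := Fintype.ofFinite ι
  choose b hb hPb using h
  have hprod : ∀ F : Finset ι, ∏ s ∈ F, b s ∉ q := by
    intro F
    induction F using Finset.induction_on with
    | empty => simpa using q.one_notMem
    | insert a F ha ih =>
      rw [Finset.prod_insert ha]
      exact fun h => (‹q.IsPrime›.mem_or_mem h).elim (hb a) ih
  refine ⟨_, hprod Finset.univ, fun s => ?_⟩
  rw [← Finset.mul_prod_erase _ _ (Finset.mem_univ s), mul_comm]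
  exact hP s _ _ (hprod _) (hPb s)

theorem exists_cechMap_tensorMul_eq (hR : StableUnder R 𝒩) (hw : ActsWithDegree x w 𝒩) {i : ℕ}
    {μ : ℤ} {z : CechTerm x (N ⊗[R] Localization.AtPrime q) i}
    (hz : z ∈ cechTermDeg x w _ (stalkDeg 𝒩 q) i μ) :
    ∃ b ∉ q, ∃ c ∈ cechTermDeg x w N 𝒩 i μ,
      cechMap x i (tensorMul q A N (algebraMap R _ b)) z = cechMap x i (toStalk q A N) c := by
  have h1 := exists_notMem_forall q
    (P := fun (s : {s : Finset (Fin n) // s.card = i}) b => ∃ c ∈ cechLocDeg x w N 𝒩 s.1 μ,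
      locMap x s.1 (tensorMul q A N (algebraMap R _ b)) (z s) = locMap x s.1 (toStalk q A N) c)
    (fun s => ?_) (fun s b b' hb' ⟨c, hc, h⟩ => ?_)
  · obtain ⟨b, hb, h⟩ := h1
    choose c hc hcz using h
    exact ⟨b, hb, c, mem_cechTermDeg.2 hc, funext hcz⟩
  · obtain ⟨k, hk⟩ := (hw.stalk q).exists_frac_of_mem (mem_cechTermDeg.1 hz s)
    obtain ⟨v, hv, hzv⟩ := hk k le_rfl
    obtain ⟨b, hb, u, hu, h⟩ := exists_tensorMul_eq (A := A) q hR hv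
    exact ⟨b, hb, _, frac_mem_cechLocDeg s.1 k hu, by rw [hzv, locMap_frac, locMap_frac, h]⟩
  · refine ⟨locMap x s.1 (Module.toModuleEnd A N b') c, locMap_mem _ (fun _ u hu => hR b' _ u hu) hc,
      ?_⟩
    have e1 : tensorMul q A N (algebraMap R _ (b' * b)) =
        tensorMul q A N (algebraMap R _ b') ∘ₗ tensorMul q A N (algebraMap R _ b) := by
      ext z
      rw [map_mul, tensorMul_mul]
      rfl
    have e2 : tensorMul q A N (algebraMap R _ b') ∘ₗ toStalk q A N =
        toStalk q A N ∘ₗ Module.toModuleEnd A N b' := by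
      ext u
      exact tensorMul_algebraMap_toStalk q b' u
    rw [e1, locMap_comp, h, ← locMap_comp, ← locMap_comp, e2]

theorem cechMap_tensorMul_toStalk (i : ℕ) (b : R) (c : CechTerm x N i) :
    cechMap x i (tensorMul q A N (algebraMap R _ b)) (cechMap x i (toStalk q A N) c) =
      cechMap x i (toStalk q A N) (b • c) := by
  rw [smul_eq_cechMap, ← cechMap_comp, ← cechMap_comp]
  congr 2
  ext u
  exact tensorMul_algebraMap_toStalk q b u

theorem exists_smul_eq_zero_of_cechMap_toStalk {i : ℕ} {c : CechTerm x N i}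
    (h : cechMap x i (toStalk q A N) c = 0) : ∃ b ∉ q, b • c = 0 := by
  have h1 := exists_notMem_forall q
    (P := fun (s : {s : Finset (Fin n) // s.card = i}) b => b • c s = 0)
    (fun s => ?_) (fun s b b' _ hb => ?_)
  · obtain ⟨b, hb, h⟩ := h1
    exact ⟨b, hb, funext h⟩
  · obtain ⟨k, u, hcu⟩ := exists_eq_frac x s.1 (c s)
    have h2 := congrFun h s
    rw [cechMap_apply, hcu, locMap_frac, Pi.zero_apply, frac_eq_zero] at h2
    obtain ⟨l, hl⟩ := h2
    rw [← map_smul] at hl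
    obtain ⟨b, hb, hbu⟩ := exists_smul_eq_zero_of_toStalk q hl
    refine ⟨b, hb, ?_⟩
    rw [hcu, smul_eq_locMap, locMap_frac, frac_eq_zero]
    refine ⟨l, ?_⟩
    rw [← hbu]
    exact (smul_comm b _ u).symm
  · rw [mul_smul, hb, smul_zero]

theorem nontrivial_cechCohomology_iff (i : ℕ) (μ : ℤ) :
    Nontrivial (CechCohomology x w N 𝒩 i μ) ↔
      ¬ cechCocycles x w N 𝒩 i μ ≤ cechCoboundaries x w N 𝒩 i μ := by
  rw [← not_subsingleton_iff_nontrivial, QuotientAddGroup.subsingleton_iff,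
    AddSubgroup.addSubgroupOf_eq_top]

/-- Both sides say that the localization of `H^i(N)_μ` at `q` is zero. Flatness enters by hand:
cochains and relations in the stalk come from `N` after multiplication by elements outside `q`. -/
theorem cocycles_stalk_le_iff (hR : StableUnder R 𝒩) (hw : ActsWithDegree x w 𝒩) (i : ℕ) (μ : ℤ) :
    cechCocycles x w _ (stalkDeg 𝒩 q) i μ ≤ cechCoboundaries x w _ (stalkDeg 𝒩 q) i μ ↔
      ∀ c ∈ cechCocycles x w N 𝒩 i μ, ∃ b ∉ q, b • c ∈ cechCoboundaries x w N 𝒩 i μ := by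
  have hmul : ∀ {b b' : R}, b ∉ q → b' ∉ q → b * b' ∉ q := fun hb hb' h =>
    (‹q.IsPrime›.mem_or_mem h).elim hb hb'
  constructor
  · intro h c hc
    have h1 := h (cechMap_mem_cocycles (toStalk q A N) (fun _ u hu => toStalk_mem q hu) hc)
    cases i with
    | zero =>
      obtain ⟨b, hb, hbc⟩ :=
        exists_smul_eq_zero_of_cechMap_toStalk q (mem_cechCoboundaries_zero.1 h1)
      exact ⟨b, hb, hbc ▸ zero_mem _⟩
    | succ i =>
      obtain ⟨z, hz, hzc⟩ := mem_cechCoboundaries_succ.1 h1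
      obtain ⟨b, hb, e, he, hbe⟩ := exists_cechMap_tensorMul_eq q hR hw hz
      have h2 : cechMap x (i + 1) (toStalk q A N) (b • c - cechD x N i e) = 0 := by
        rw [map_sub, ← cechMap_tensorMul_toStalk, ← hzc, ← cechD_cechMap, ← cechD_cechMap, hbe,
          sub_self]
      obtain ⟨b', hb', h3⟩ := exists_smul_eq_zero_of_cechMap_toStalk q h2
      refine ⟨b' * b, hmul hb' hb, mem_cechCoboundaries_succ.2
        ⟨b' • e, hR.smul_mem_cechTermDeg b' he, ?_⟩⟩
      rw [cechD_smul, mul_smul]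
      rw [smul_sub, sub_eq_zero] at h3
      exact h3.symm
  · intro h z hz
    obtain ⟨hz1, hz2⟩ := mem_cechCocycles.1 hz
    obtain ⟨b, hb, c, hc, hbc⟩ := exists_cechMap_tensorMul_eq q hR hw hz1
    have h1 : cechMap x (i + 1) (toStalk q A N) (cechD x N i c) = 0 := by
      rw [← cechD_cechMap, ← hbc, cechD_cechMap, hz2, map_zero]
    obtain ⟨b', hb', h2⟩ := exists_smul_eq_zero_of_cechMap_toStalk q h1
    have hc' : b' • c ∈ cechCocycles x w N 𝒩 i μ := mem_cechCocycles.2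
      ⟨hR.smul_mem_cechTermDeg b' hc, by rw [cechD_smul, h2]⟩
    obtain ⟨b'', hb'', h3⟩ := h _ hc'
    have h4 := cechMap_mem_coboundaries (𝒩' := stalkDeg 𝒩 q) (μ' := μ) (toStalk q A N)
      (fun _ u hu => toStalk_mem q hu) h3
    rw [← mul_smul, ← cechMap_tensorMul_toStalk, ← hbc, ← cechMap_comp] at h4
    -- Three multipliers were used: `b` lifts `z`, `b'` makes the lift a cocycle, and `b''` makes
    -- that cocycle a coboundary. Their product is invertible in `R_q`, so it can be undone.
    have hu : IsUnit (algebraMap R (Localization.AtPrime q) (b'' * b' * b)) :=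
      IsLocalization.map_units (Localization.AtPrime q)
        (⟨_, hmul (hmul hb'' hb') hb⟩ : q.primeCompl)
    obtain ⟨a, ha⟩ := hu.exists_left_inv
    have h5 := cechMap_mem_coboundaries (𝒩' := stalkDeg 𝒩 q) (μ' := μ) (tensorMul q A N a)
      (fun _ u hu => tensorMul_mem q a hu) h4
    rw [← cechMap_comp] at h5
    have h6 : tensorMul q A N a ∘ₗ tensorMul q A N (algebraMap R _ (b'' * b')) ∘ₗ
        tensorMul q A N (algebraMap R _ b) = LinearMap.id := by
      ext z
      rw [← tensorMul_one, ← ha, map_mul _ (b'' * b') b, tensorMul_mul, tensorMul_mul]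
      rfl
    rwa [h6, cechMap_id] at h5

end Stalks

/-! ### The first grading of the Rees module, and finiteness of its cohomology -/

section ReesGrading

variable {A : Type*} [CommRing A] {𝒜 : ℤ → AddSubgroup A} [GradedRing 𝒜]
  {m r : ℕ} (hmr : m ≤ r) {I : Ideal A} (f : Fin r → I)
  {M : Type*} [AddCommGroup M] [Module A M] {ℳ : ℤ → AddSubgroup M}
  [DirectSum.Decomposition ℳ] [SetLike.GradedSMul 𝒜 ℳ]

namespace ReesModule

/-- The projection of the Rees module to the elements of degree `μ`. -/
def degProj (hI : I.IsHomogeneous 𝒜) (d : ℕ) (μ : ℤ) :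
    ReesModule hmr f M →+ ReesModule hmr f M where
  toFun u := ⟨.ofCoeff A (Finsupp.onFinset u.1.coeff.support
    (fun t => (gradingProj ℳ).proj (μ + t * d) (u.1.coeff t)) fun t ht =>
      Finsupp.mem_support_iff.2 fun h => ht (by rw [h, map_zero])),
    fun t => proj_mem_smul_top (isHomogeneous_pow hI t) _ (u.2 t)⟩
  map_zero' := ext fun t => map_zero ((gradingProj ℳ).proj (μ + t * d))
  map_add' u v := ext fun t => map_add ((gradingProj ℳ).proj (μ + t * d)) _ _

omit [DirectSum.Decomposition ℳ] [GradedRing 𝒜] [SetLike.GradedSMul 𝒜 ℳ] in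
theorem incl_mem_reesDeg {d : ℕ} {μ : ℤ} (t : ℕ)
    {v : (I ^ t • (⊤ : Submodule A M) : Submodule A M)} (hv : (v : M) ∈ ℳ (μ + t * d)) :
    incl hmr f t v ∈ reesDeg hmr f ℳ d μ := by
  intro s
  rw [coeff_incl]
  split_ifs with h
  · exact h ▸ hv
  · exact zero_mem _

/-- The grading of the Rees module by the first degree. -/
def reesGradingProj (hI : I.IsHomogeneous 𝒜) (d : ℕ) :
    GradingProj (reesDeg hmr f ℳ d) where
  proj := degProj hmr f hI d
  proj_mem μ u t := (gradingProj ℳ).proj_mem _ _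
  proj_of_mem μ u hu := ext fun t => (gradingProj ℳ).proj_of_mem _ _ (hu t)
  proj_of_ne μ ν h u hu := ext fun t =>
    (gradingProj ℳ).proj_of_ne _ _ (fun h' => h (add_right_cancel h')) _ (hu t)
  mem_closure u := by
    rw [← sum_incl_proj hmr f u u.1.coeff.support fun t ht => Finsupp.notMem_support_iff.1 ht]
    refine sum_mem fun t _ => ?_
    obtain ⟨F, hF⟩ := (gradingProj ℳ).exists_sum_eq (u.1.coeff t)
    have h1 : proj hmr f t u = ∑ μ ∈ F, ⟨(gradingProj ℳ).proj μ (u.1.coeff t),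
        proj_mem_smul_top (isHomogeneous_pow hI t) _ (u.2 t)⟩ := by
      apply Subtype.ext
      rw [AddSubmonoidClass.coe_finsetSum]
      exact (hF F subset_rfl).symm
    rw [h1, map_sum]
    refine sum_mem fun μ _ => AddSubgroup.subset_closure ⟨μ - t * d, incl_mem_reesDeg hmr f t ?_⟩
    rw [sub_add_cancel]
    exact (gradingProj ℳ).proj_mem _ _

omit [DirectSum.Decomposition ℳ] [GradedRing 𝒜] in
-- Multiplication by `f_l` adds `k` to the degree in `M`, while passing from the summand `t` to `t +
-- 1` moves the reference degree by `d`. The net degree `k - d` is zero for the forms of top degree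
-- and negative for the others.
theorem X_smul_mem_reesDeg {d k : ℕ} {l : Fin r} (hl : (f l : A) ∈ 𝒜 k) {μ : ℤ}
    {u : ReesModule hmr f M} (hu : u ∈ reesDeg hmr f ℳ d μ) :
    (MvPolynomial.X l : MvPolynomial (Fin r) A) • u ∈ reesDeg hmr f ℳ d (μ + (k - d)) := by
  intro t
  cases t with
  | zero => rw [coeff_X_smul_zero]; exact zero_mem _
  | succ t =>
    rw [coeff_X_smul_succ]
    have := smul_mem_graded (𝒜 := 𝒜) hl (hu t)
    convert this using 2
    push_cast
    ring

omit [DirectSum.Decomposition ℳ] [GradedRing 𝒜] in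
theorem smul_mem_reesDeg {d k : ℕ} {a : A} (ha : a ∈ 𝒜 k) {μ : ℤ}
    {u : ReesModule hmr f M} (hu : u ∈ reesDeg hmr f ℳ d μ) :
    a • u ∈ reesDeg hmr f ℳ d (μ + k) := by
  intro t
  rw [coeff_smul, add_right_comm]
  exact smul_mem_graded (𝒜 := 𝒜) ha (hu t)

omit [DirectSum.Decomposition ℳ] in
theorem stableUnder_reesDeg {d : ℕ} (hf : ∀ l : Fin m, (f (Fin.castLE hmr l) : A) ∈ 𝒜 d) :
    StableUnder (BRing 𝒜 m) (reesDeg hmr f ℳ d) := by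
  intro b
  change ∀ μ, ∀ u ∈ reesDeg hmr f ℳ d μ, (bIncl 𝒜 hmr b) • u ∈ reesDeg hmr f ℳ d μ
  induction b using MvPolynomial.induction_on with
  | C c =>
    intro μ u hu
    have h1 : bIncl 𝒜 hmr (MvPolynomial.C c) = MvPolynomial.C (c : A) := by
      simp [bIncl]
      rfl
    rw [h1]
    have := smul_mem_reesDeg (𝒜 := 𝒜) (k := 0) hmr f c.2 hu
    rwa [Nat.cast_zero, add_zero] at this
  | add p q hp hq =>
    intro μ u hu
    rw [map_add, add_smul]
    exact add_mem (hp μ u hu) (hq μ u hu)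
  | mul_X p l hp =>
    intro μ u hu
    have h1 : bIncl 𝒜 hmr (MvPolynomial.X l) = MvPolynomial.X (Fin.castLE hmr l) := by
      simp [bIncl]
    rw [map_mul, mul_smul, h1]
    refine hp μ _ ?_
    have := X_smul_mem_reesDeg hmr f (hf l) hu
    rwa [sub_self, add_zero] at this

variable {n : ℕ} {x : Fin n → A} {w : Fin n → ℕ}

omit [DirectSum.Decomposition ℳ] [GradedRing 𝒜] in
theorem actsWithDegree_reesDeg (hx : ∀ j, x j ∈ 𝒜 (w j)) (d : ℕ) :
    ActsWithDegree x w (reesDeg hmr f ℳ d) := fun j _ _ hu =>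
  smul_mem_reesDeg hmr f (hx j) hu

/-- The Rees module as a graded module over `A[T_1, …, T_r]`. -/
def reesOperatorGrading (hI : I.IsHomogeneous 𝒜) (hx : ∀ j, x j ∈ 𝒜 (w j)) {d : ℕ}
    {deg : Fin r → ℕ} (hf : ∀ l, (f l : A) ∈ 𝒜 (deg l)) (hd : ∀ l : Fin r, (l : ℕ) < m → deg l = d)
    (hd' : ∀ l : Fin r, m ≤ l → deg l < d) :
    OperatorGrading x w (fun l : {l : Fin r // m ≤ l} => (MvPolynomial.X l.1 : MvPolynomial (Fin r) A))
      (fun l => d - deg l.1) (BRing 𝒜 m) (reesDeg hmr f ℳ d) where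
  toGradingProj := reesGradingProj hmr f hI d
  acts := actsWithDegree_reesDeg hmr f hx d
  stable := stableUnder_reesDeg hmr f fun l => hd (Fin.castLE hmr l) l.2 ▸ hf (Fin.castLE hmr l)
  lower l μ u hu := by
    have := X_smul_mem_reesDeg hmr f (hf l.1) hu
    rwa [Nat.cast_sub (hd' l.1 l.2).le, neg_sub]

variable (𝒜 M) in
omit [SetLike.GradedSMul 𝒜 ℳ] in
theorem adjoin_eq_top (hgen : Algebra.adjoin (degZero 𝒜) (Set.range x) = ⊤) :
      letI := bInclAlgebra 𝒜 hmr
    Algebra.adjoin (BRing 𝒜 m) (Set.range (algebraMap A (MvPolynomial (Fin r) A) ∘ x) ∪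
      Set.range (fun l : {l : Fin r // m ≤ l} => (MvPolynomial.X l.1 : MvPolynomial (Fin r) A))) =
        ⊤ := by
  let _ := bInclAlgebra 𝒜 hmr
  set T := Algebra.adjoin (BRing 𝒜 m) (Set.range (algebraMap A (MvPolynomial (Fin r) A) ∘ x) ∪
      Set.range (fun l : {l : Fin r // m ≤ l} => (MvPolynomial.X l.1 : MvPolynomial (Fin r) A)))
    with hT
  have hC : ∀ a : A, (MvPolynomial.C a : MvPolynomial (Fin r) A) ∈ T := by
    intro a
    have ha : a ∈ Algebra.adjoin (degZero 𝒜) (Set.range x) := hgen ▸ Algebra.mem_top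
    induction ha using Algebra.adjoin_induction with
    | mem a ha =>
      obtain ⟨j, rfl⟩ := ha
      exact Algebra.subset_adjoin (Or.inl ⟨j, rfl⟩)
    | algebraMap c =>
      have : (MvPolynomial.C (algebraMap (degZero 𝒜) A c) : MvPolynomial (Fin r) A) =
          algebraMap (BRing 𝒜 m) _ (MvPolynomial.C c) := by
        change _ = bIncl 𝒜 hmr (MvPolynomial.C c)
        simp [bIncl]
      rw [this]
      exact T.algebraMap_mem _
    | add a b _ _ h h' => rw [map_add]; exact add_mem h h'
    | mul a b _ _ h h' => rw [map_mul]; exact mul_mem h h'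
  have hX : ∀ l : Fin r, (MvPolynomial.X l : MvPolynomial (Fin r) A) ∈ T := by
    intro l
    by_cases hl : (l : ℕ) < m
    · have : (MvPolynomial.X l : MvPolynomial (Fin r) A) =
          algebraMap (BRing 𝒜 m) _ (MvPolynomial.X ⟨l, hl⟩) := by
        change _ = bIncl 𝒜 hmr (MvPolynomial.X ⟨l, hl⟩)
        simp [bIncl]
      rw [this]
      exact T.algebraMap_mem _
    · exact Algebra.subset_adjoin (Or.inr ⟨⟨l, not_lt.1 hl⟩, rfl⟩)
  refine top_unique fun p _ => ?_
  induction p using MvPolynomial.induction_on with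
  | C a => exact hC a
  | add p q hp hq => exact add_mem (hp trivial) (hq trivial)
  | mul_X p l hp => exact mul_mem (hp trivial) (hX l)

/-- The dévissage is applied over `S = A[T_1, …, T_r]`, with the `T_l` for `l > m` as the operators
that lower degrees by `d - d_l`. -/
theorem finiteCohomology [IsNoetherianRing A] [Module.Finite A M]
    (hw : ∀ j, 0 < w j) (hI : I.IsHomogeneous 𝒜)
    (hx : ∀ j, x j ∈ 𝒜 (w j)) (hgen : Algebra.adjoin (degZero 𝒜) (Set.range x) = ⊤)
    {J : Ideal A} (hJ : J = Ideal.span (Set.range fun l => (f l : A)))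
    (hred : ∃ p : ℕ, (J * I ^ p) • (⊤ : Submodule A M) = I ^ (p + 1) • (⊤ : Submodule A M)) {d : ℕ}
    {deg : Fin r → ℕ} (hf : ∀ l, (f l : A) ∈ 𝒜 (deg l)) (hd : ∀ l : Fin r, (l : ℕ) < m → deg l = d)
    (hd' : ∀ l : Fin r, m ≤ l → deg l < d)
    (hB : StableUnder (BRing 𝒜 m) (reesDeg hmr f ℳ d)) :
    OperatorGrading.FiniteCohomology x w hB := by
  let _ := bInclAlgebra 𝒜 hmr
  have : IsScalarTower (BRing 𝒜 m) (MvPolynomial (Fin r) A) (ReesModule hmr f M) :=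
    ⟨fun b s u => mul_smul (bIncl 𝒜 hmr b) s u⟩
  have := isNoetherianRing_degZero 𝒜
  have := finite hmr f M hJ hred
  exact finiteCohomology_of_finite (adjoin_eq_top 𝒜 hmr hgen)
    (fun l => Nat.sub_pos_of_lt (hd' l.1 l.2)) hw Finset.univ (ReesModule hmr f M) _
    (reesOperatorGrading hmr f hI hx hf hd hd') fun j hj => absurd (Finset.mem_univ j) hj

end ReesModule

end ReesGrading

/-! ### Arithmetic of operators acting on cochains -/

section OperatorArithmetic

variable {A : Type*} [CommRing A] {n : ℕ} {x : Fin n → A} {N : Type*} [AddCommGroup N]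
  [Module A N] {B : Type*} [CommRing B] [Module B N] [SMulCommClass B A N] {i : ℕ}

theorem add_smul_cechTerm (b b' : B) (c : CechTerm x N i) : (b + b') • c = b • c + b' • c :=
  add_smul b b' c

theorem mul_smul_cechTerm (b b' : B) (c : CechTerm x N i) : (b * b') • c = b • b' • c :=
  mul_smul b b' c

theorem smul_add_cechTerm (b : B) (c c' : CechTerm x N i) : b • (c + c') = b • c + b • c' :=
  smul_add b c c'

theorem smul_zero_cechTerm (b : B) : b • (0 : CechTerm x N i) = 0 :=
  smul_zero b

/-- An additive property of the multiples of the generators holds on their span. -/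
theorem forall_mem_span_of_smul {P : CechTerm x N i → Prop} {G : Set (CechTerm x N i)}
    (h0 : P 0) (hadd : ∀ c c', P c → P c' → P (c + c')) (hG : ∀ (b : B), ∀ g ∈ G, P (b • g))
    {y : CechTerm x N i} (hy : y ∈ Submodule.span B G) : P y := by
  have : ∀ b : B, P (b • y) := by
    induction hy using Submodule.span_induction with
    | mem g hg => exact fun b => hG b g hg
    | zero => intro b; rwa [smul_zero]
    | add a b _ _ ha hb => intro c; rw [smul_add]; exact hadd _ _ (ha c) (hb c)
    | smul a y _ hy => intro b; rw [smul_smul]; exact hy _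
  simpa using this 1

end OperatorArithmetic

/-! ### The second grading, by `t`, on cochains of the Rees module -/

namespace ReesModule

section Components

variable {A : Type*} [CommRing A] {𝒜 : ℤ → AddSubgroup A} [GradedRing 𝒜]
  {m r : ℕ} {hmr : m ≤ r} {I : Ideal A} {f : Fin r → I}
  {M : Type*} [AddCommGroup M] [Module A M] {ℳ : ℤ → AddSubgroup M}
  {n : ℕ} {x : Fin n → A} {w : Fin n → ℕ} {d : ℕ}

variable (hmr f M) in
/-- The projection to the summand `M I^t`, as an endomorphism of the Rees module. -/
def comp (t : ℕ) : ReesModule hmr f M →ₗ[A] ReesModule hmr f M := incl hmr f t ∘ₗ proj hmr f t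

theorem coeff_comp (t s : ℕ) (u : ReesModule hmr f M) :
    (comp hmr f M t u).1.coeff s = if t = s then u.1.coeff s else 0 := by
  refine (coeff_incl hmr f t s _).trans ?_
  split_ifs with h
  · subst h; rfl
  · rfl

theorem coeff_bRing_smul_of_isHomogeneous {b : BRing 𝒜 m} {k : ℕ} (hb : b.IsHomogeneous k)
    (u : ReesModule hmr f M) (t : ℕ) : (b • u).1.coeff t =
      if k ≤ t then (reesMap f (bIncl 𝒜 hmr b) : Polynomial A).coeff k • u.1.coeff (t - k)
      else 0 := by
  change ((reesMap f (bIncl 𝒜 hmr b) : Polynomial A) • u.1).coeff t = _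
  have h := reesMap_bIncl_homogeneousComponent 𝒜 hmr f b k
  rw [MvPolynomial.homogeneousComponent_of_mem hb, if_pos rfl] at h
  rw [h, PolynomialModule.monomial_smul_apply, Polynomial.coeff_monomial_same]

/-- Forms of degree `k` shift the summands by `k`. -/
theorem comp_add_smul {b : BRing 𝒜 m} {k : ℕ} (hb : b.IsHomogeneous k) (t : ℕ)
    (u : ReesModule hmr f M) : comp hmr f M (t + k) (b • u) = b • comp hmr f M t u := by
  refine ext fun s => ?_
  rw [coeff_comp, coeff_bRing_smul_of_isHomogeneous hb, coeff_bRing_smul_of_isHomogeneous hb,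
    coeff_comp]
  split_ifs <;> first | rfl | omega | simp

theorem comp_smul_of_lt {b : BRing 𝒜 m} {k : ℕ} (hb : b.IsHomogeneous k) {t : ℕ} (ht : t < k)
    (u : ReesModule hmr f M) : comp hmr f M t (b • u) = 0 := by
  refine ext fun s => ?_
  rw [coeff_comp, coeff_bRing_smul_of_isHomogeneous hb]
  split_ifs
  · omega
  · rfl
  · rfl

/-- The homogeneous components of `b` are recovered from the action of `b` on the summands. -/
theorem homogeneousComponent_smul_comp (b : BRing 𝒜 m) (k t : ℕ) (u : ReesModule hmr f M) :
    MvPolynomial.homogeneousComponent k b • comp hmr f M t u =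
      comp hmr f M (t + k) (b • comp hmr f M t u) := by
  refine ext fun s => ?_
  rw [coeff_bRing_smul_of_isHomogeneous (MvPolynomial.homogeneousComponent_isHomogeneous k b),
    reesMap_bIncl_homogeneousComponent, Polynomial.coeff_monomial_same, coeff_comp, coeff_comp]
  have h : (b • comp hmr f M t u).1.coeff s = if t ≤ s then
      (reesMap f (bIncl 𝒜 hmr b) : Polynomial A).coeff (s - t) • u.1.coeff t else 0 :=
    PolynomialModule.smul_single_apply t _ _ s
  rw [h]
  by_cases hs : t + k = s
  · subst hs
    rw [if_pos rfl, if_pos (by omega), if_pos (by omega), if_pos (by omega), Nat.add_sub_cancel_left,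
      Nat.add_sub_cancel]
  · rw [if_neg hs]
    split_ifs
    · omega
    · rw [smul_zero]
    · rfl

theorem comp_mem (t : ℕ) {μ : ℤ} {u : ReesModule hmr f M} (hu : u ∈ reesDeg hmr f ℳ d μ) :
    comp hmr f M t u ∈ reesDeg hmr f ℳ d μ := incl_mem_reesDeg hmr f t (hu t)

variable (x) in
/-- The action of `comp` on Čech cochains. -/
abbrev cechPart (i t : ℕ) : CechTerm x (ReesModule hmr f M) i →ₗ[A]
    CechTerm x (ReesModule hmr f M) i := cechMap x i (comp hmr f M t)

theorem cechPart_add_smul {b : BRing 𝒜 m} {k : ℕ} (hb : b.IsHomogeneous k) (i t : ℕ)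
    (c : CechTerm x (ReesModule hmr f M) i) :
    cechPart x i (t + k) (b • c) = b • cechPart x i t c := by
  rw [smul_eq_cechMap, smul_eq_cechMap, ← cechMap_comp, ← cechMap_comp]
  congr 2
  exact LinearMap.ext fun u => comp_add_smul hb t u

theorem cechPart_smul_of_lt {b : BRing 𝒜 m} {k : ℕ} (hb : b.IsHomogeneous k) (i : ℕ) {t : ℕ}
    (ht : t < k) (c : CechTerm x (ReesModule hmr f M) i) : cechPart x i t (b • c) = 0 := by
  rw [smul_eq_cechMap, ← cechMap_comp, ← cechMap_zero x i c]
  congr 2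
  exact LinearMap.ext fun u => comp_smul_of_lt hb ht u

theorem homogeneousComponent_smul_cechPart (b : BRing 𝒜 m) (i k t : ℕ)
    (c : CechTerm x (ReesModule hmr f M) i) :
    MvPolynomial.homogeneousComponent k b • cechPart x i t c =
      cechPart x i (t + k) (b • cechPart x i t c) := by
  rw [smul_eq_cechMap, smul_eq_cechMap, ← cechMap_comp, ← cechMap_comp, ← cechMap_comp]
  congr 2
  exact LinearMap.ext fun u => homogeneousComponent_smul_comp b k t u

theorem cechPart_mem_cocycles {i : ℕ} (t : ℕ) {μ : ℤ} {c : CechTerm x (ReesModule hmr f M) i}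
    (hc : c ∈ cechCocycles x w _ (reesDeg hmr f ℳ d) i μ) :
    cechPart x i t c ∈ cechCocycles x w _ (reesDeg hmr f ℳ d) i μ :=
  cechMap_mem_cocycles _ (fun _ _ hu => comp_mem t hu) hc

theorem cechPart_mem_coboundaries {i : ℕ} (t : ℕ) {μ : ℤ} {c : CechTerm x (ReesModule hmr f M) i}
    (hc : c ∈ cechCoboundaries x w _ (reesDeg hmr f ℳ d) i μ) :
    cechPart x i t c ∈ cechCoboundaries x w _ (reesDeg hmr f ℳ d) i μ :=
  cechMap_mem_coboundaries _ (fun _ _ hu => comp_mem t hu) hc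

/-- A cochain is the sum of its finitely many parts. -/
theorem exists_sum_cechPart {i : ℕ} (c : CechTerm x (ReesModule hmr f M) i) :
    ∃ T, (∀ t ≥ T, cechPart x i t c = 0) ∧ ∑ t ∈ Finset.range T, cechPart x i t c = c := by
  have h1 : ∀ s : {s : Finset (Fin n) // s.card = i}, ∃ T : ℕ, ∃ k u,
      c s = frac x s.1 k u ∧ ∀ t ≥ T, (u : ReesModule hmr f M).1.coeff t = 0 := by
    intro s
    obtain ⟨k, u, hu⟩ := exists_eq_frac x s.1 (c s)
    refine ⟨u.1.coeff.support.sup id + 1, k, u, hu, fun t ht => ?_⟩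
    by_contra h
    have := Finset.le_sup (f := id) (Finsupp.mem_support_iff.2 h)
    simp only [id] at this
    omega
  choose T k u hcu hu using h1
  refine ⟨Finset.univ.sup T, fun t ht => ?_, ?_⟩
  · ext s : 1
    have hs : T s ≤ t := (Finset.le_sup (Finset.mem_univ s)).trans ht
    rw [cechMap_apply, hcu, locMap_frac]
    have : comp hmr f M t (u s) = 0 := ext fun s' => by
      rw [coeff_comp]
      split_ifs with h
      · rw [← h, hu s t hs]; rfl
      · rfl
    rw [this, map_zero, Pi.zero_apply]
  · rw [← cechMap_sum]
    ext s : 1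
    rw [cechMap_apply, hcu, locMap_frac, LinearMap.sum_apply]
    congr 1
    refine sum_incl_proj hmr f (u s) _ fun t ht => hu s t ?_
    rw [Finset.mem_range, not_lt] at ht
    exact (Finset.le_sup (Finset.mem_univ s)).trans ht

theorem mem_coboundaries_of_cechPart {i : ℕ} {μ : ℤ} {c : CechTerm x (ReesModule hmr f M) i}
    (h : ∀ t, cechPart x i t c ∈ cechCoboundaries x w _ (reesDeg hmr f ℳ d) i μ) :
    c ∈ cechCoboundaries x w _ (reesDeg hmr f ℳ d) i μ := by
  obtain ⟨T, _, hT⟩ := exists_sum_cechPart c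
  rw [← hT]
  exact sum_mem fun t _ => h t

/-- The cohomology of `M I^t` in terms of the cohomology of the Rees module. -/
theorem cocycles_powDeg_le_iff (i t : ℕ) (μ : ℤ) :
    cechCocycles x w _ (powDeg I ℳ t) i (μ + t * d) ≤
        cechCoboundaries x w _ (powDeg I ℳ t) i (μ + t * d) ↔
      ∀ c ∈ cechCocycles x w _ (reesDeg hmr f ℳ d) i μ,
        cechPart x i t c ∈ cechCoboundaries x w _ (reesDeg hmr f ℳ d) i μ := by
  -- The projection and inclusion of the `t`-th summand shift degrees by `td` in opposite
  -- directions, and thus match degree `μ` of the Rees module with degree `μ + td` of `MI^t`.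
  have hproj : ∀ k, ∀ u ∈ reesDeg hmr f ℳ d (μ + k),
      proj hmr f t u ∈ powDeg I ℳ t (μ + t * d + k) := by
    intro k u hu
    have := hu t
    rw [add_right_comm] at this
    exact this
  have hincl : ∀ k, ∀ v ∈ powDeg I ℳ t (μ + t * d + k),
      incl hmr f t v ∈ reesDeg hmr f ℳ d (μ + k) := by
    intro k v hv
    refine incl_mem_reesDeg hmr f t ?_
    rw [add_right_comm]
    exact hv
  constructor
  · intro h c hc
    rw [cechPart, comp, cechMap_comp]
    exact cechMap_mem_coboundaries _ hincl (h (cechMap_mem_cocycles _ hproj hc))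
  · intro h z hz
    have h1 := cechMap_mem_coboundaries _ hproj (h _ (cechMap_mem_cocycles _ hincl hz))
    rw [cechPart, ← cechMap_comp, ← cechMap_comp] at h1
    have h2 : proj hmr f t ∘ₗ (comp hmr f M t ∘ₗ incl hmr f t) = LinearMap.id := by
      refine LinearMap.ext fun v => ?_
      change proj hmr f t (incl hmr f t (proj hmr f t (incl hmr f t v))) = v
      rw [proj_incl, proj_incl]
    rw [LinearMap.comp_assoc] at h1
    rwa [h2, cechMap_id] at h1

end Components

/-! ### Behaviour of a strand for large `t` -/

section Strands

variable {A : Type*} [CommRing A] {𝒜 : ℤ → AddSubgroup A} [GradedRing 𝒜]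
  {m r : ℕ} {hmr : m ≤ r} {I : Ideal A} {f : Fin r → I}
  {M : Type*} [AddCommGroup M] [Module A M] {ℳ : ℤ → AddSubgroup M}
  {n : ℕ} {x : Fin n → A} {w : Fin n → ℕ} {d : ℕ}
  (hB : StableUnder (BRing 𝒜 m) (reesDeg hmr f ℳ d)) {i : ℕ} {μ : ℤ}
  (hfin : NoetherianMod (cocycles x w hB i μ) (coboundaries x w hB i μ))

include hfin

/-- Finitely many cocycles generate the cohomology. -/
theorem exists_generators : ∃ G : Finset (CechTerm x (ReesModule hmr f M) i),
    (∀ g ∈ G, g ∈ cocycles x w hB i μ) ∧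
      cocycles x w hB i μ ≤ Submodule.span (BRing 𝒜 m) G ⊔ coboundaries x w hB i μ := by
  classical
  have hfg : ((cocycles x w hB i μ).map (coboundaries x w hB i μ).mkQ).FG :=
    isNoetherian_submodule.1 hfin _ le_rfl
  obtain ⟨G, hG⟩ := hfg
  have h1 : ∀ g ∈ G, ∃ c ∈ cocycles x w hB i μ, (coboundaries x w hB i μ).mkQ c = g := fun g hg =>
    (hG ▸ Submodule.subset_span hg : g ∈ (cocycles x w hB i μ).map (coboundaries x w hB i μ).mkQ)
  choose! c hc hcg using h1
  refine ⟨G.image c, ?_, fun z hz => ?_⟩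
  · intro g hg
    obtain ⟨g', hg', rfl⟩ := Finset.mem_image.1 hg
    exact hc g' hg'
  · have h2 : (coboundaries x w hB i μ).mkQ z ∈
        (Submodule.span (BRing 𝒜 m) ((G.image c : Finset _) : Set _)).map
          (coboundaries x w hB i μ).mkQ := by
      rw [Submodule.map_span, Finset.coe_image, ← Set.image_comp]
      have h3 : ((coboundaries x w hB i μ).mkQ ∘ c) '' (G : Set _) = G := by
        ext g
        constructor
        · rintro ⟨g, hg, rfl⟩
          rw [Function.comp_apply, hcg g hg]
          exact hg
        · intro hg
          exact ⟨g, hg, hcg g hg⟩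
      rw [h3, hG]
      exact ⟨z, hz, rfl⟩
    obtain ⟨y, hy, hyz⟩ := h2
    have h3 : z - y ∈ coboundaries x w hB i μ :=
      (Submodule.Quotient.eq _).1 hyz.symm
    rw [← add_sub_cancel y z]
    exact Submodule.add_mem_sup hy h3

/-- A strand of the cohomology vanishes in all large degrees or in no large degree. -/
theorem eventually_or_eventually :
    (∃ T, ∀ t ≥ T, ∀ c ∈ cechCocycles x w _ (reesDeg hmr f ℳ d) i μ,
      cechPart x i t c ∈ cechCoboundaries x w _ (reesDeg hmr f ℳ d) i μ) ∨
    (∃ T, ∀ t ≥ T, ¬ ∀ c ∈ cechCocycles x w _ (reesDeg hmr f ℳ d) i μ,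
      cechPart x i t c ∈ cechCoboundaries x w _ (reesDeg hmr f ℳ d) i μ) := by
  obtain ⟨G, hGZ, hG⟩ := exists_generators hB hfin
  obtain ⟨T, hT⟩ : ∃ T, ∀ g ∈ G, ∀ t ≥ T, cechPart x i t g = 0 := by
    choose T hT _ using fun c : CechTerm x (ReesModule hmr f M) i => exists_sum_cechPart c
    exact ⟨G.sup T, fun g hg t ht => hT g t ((Finset.le_sup hg).trans ht)⟩
  -- Beyond the parts of the generators, everything in part `t + 1` is obtained from part `t` by the
  -- variables, so vanishing at `t` propagates. Constants contribute nothing, since the generators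
  -- have no part `t + 1`.
  have hstep : ∀ t ≥ T, (∀ c ∈ cechCocycles x w _ (reesDeg hmr f ℳ d) i μ,
      cechPart x i t c ∈ cechCoboundaries x w _ (reesDeg hmr f ℳ d) i μ) →
      ∀ c ∈ cechCocycles x w _ (reesDeg hmr f ℳ d) i μ,
        cechPart x i (t + 1) c ∈ cechCoboundaries x w _ (reesDeg hmr f ℳ d) i μ := by
    intro t ht h
    have hb : ∀ b : BRing 𝒜 m, ∀ c ∈ cocycles x w hB i μ,
        cechPart x i (t + 1) c ∈ coboundaries x w hB i μ →
        cechPart x i (t + 1) (b • c) ∈ coboundaries x w hB i μ := by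
      intro b
      induction b using MvPolynomial.induction_on with
      | C a =>
        intro c _ hc'
        have := cechPart_add_smul (MvPolynomial.isHomogeneous_C (Fin m) a) i (t + 1) c
        rw [add_zero] at this
        rw [this]
        exact Submodule.smul_mem _ _ hc'
      | add p q hp hq =>
        intro c hc hc'
        rw [add_smul_cechTerm, map_add]
        exact add_mem (hp c hc hc') (hq c hc hc')
      | mul_X p l hp =>
        intro c hc hc'
        rw [mul_comm, mul_smul_cechTerm, cechPart_add_smul (MvPolynomial.isHomogeneous_X _ l)]
        exact Submodule.smul_mem _ _ (h _ (Submodule.smul_mem _ p hc))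
    intro c hc
    obtain ⟨y, hy, z, hz, rfl⟩ := Submodule.mem_sup.1 (hG hc)
    rw [map_add]
    refine add_mem ?_ (cechPart_mem_coboundaries _ hz)
    refine forall_mem_span_of_smul (P := fun y => cechPart x i (t + 1) y ∈ coboundaries x w hB i μ)
      ?_ (fun a b ha hb => ?_) (fun b g hg => hb b g (hGZ g hg) ?_) hy
    · rw [map_zero]
      exact zero_mem _
    · rw [map_add]
      exact add_mem ha hb
    · rw [hT g hg _ (by omega)]
      exact zero_mem _
  by_cases h : ∃ t ≥ T, ∀ c ∈ cechCocycles x w _ (reesDeg hmr f ℳ d) i μ,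
      cechPart x i t c ∈ cechCoboundaries x w _ (reesDeg hmr f ℳ d) i μ
  · obtain ⟨t, ht, h⟩ := h
    refine Or.inl ⟨t, fun s hs => ?_⟩
    induction s, hs using Nat.le_induction with
    | base => exact h
    | succ s hs ih => exact hstep s (ht.trans hs) ih
  · exact Or.inr ⟨T, fun t ht h' => h ⟨t, ht, h'⟩⟩

/-- If every variable acts nilpotently on a strand, then it vanishes in large degrees. -/
theorem eventually_of_pow_X_smul (h : ∀ l : Fin m, ∃ k, ∀ c ∈ cocycles x w hB i μ,
      (MvPolynomial.X l ^ k : BRing 𝒜 m) • c ∈ coboundaries x w hB i μ) :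
    ∃ T, ∀ t ≥ T, ∀ c ∈ cechCocycles x w _ (reesDeg hmr f ℳ d) i μ,
      cechPart x i t c ∈ cechCoboundaries x w _ (reesDeg hmr f ℳ d) i μ := by
  obtain ⟨G, hGZ, hG⟩ := exists_generators hB hfin
  obtain ⟨T, hT⟩ : ∃ T, ∀ g ∈ G, ∀ t ≥ T, cechPart x i t g = 0 := by
    choose T hT _ using fun c : CechTerm x (ReesModule hmr f M) i => exists_sum_cechPart c
    exact ⟨G.sup T, fun g hg t ht => hT g t ((Finset.le_sup hg).trans ht)⟩
  choose k hk using h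
  -- A monomial with some exponent at least `k l` sends the generators to coboundaries. Any other
  -- monomial has degree at most `∑ l, k l`, so it cannot move parts below `T` to a part `t ≥ T + ∑
  -- l, k l`.
  refine ⟨T + ∑ l, k l, fun t ht c hc => ?_⟩
  obtain ⟨y, hy, z, hz, rfl⟩ := Submodule.mem_sup.1 (hG hc)
  rw [map_add]
  refine add_mem ?_ (cechPart_mem_coboundaries _ hz)
  have hmon : ∀ b : BRing 𝒜 m, ∀ g ∈ G, cechPart x i t (b • g) ∈ coboundaries x w hB i μ := by
    intro b g hg
    induction b using MvPolynomial.induction_on' with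
    | add p q hp hq =>
      rw [add_smul_cechTerm, map_add]
      exact add_mem hp hq
    | monomial e a =>
      by_cases he : ∃ l, k l ≤ e l
      · obtain ⟨l, hl⟩ := he
        have h1 : (MvPolynomial.monomial e a : BRing 𝒜 m) =
            MvPolynomial.monomial (e - Finsupp.single l (k l)) a * MvPolynomial.X l ^ k l := by
          rw [MvPolynomial.X_pow_eq_monomial, MvPolynomial.monomial_mul, mul_one,
            tsub_add_cancel_of_le (Finsupp.single_le_iff.2 hl)]
        rw [h1, mul_smul_cechTerm]
        exact cechPart_mem_coboundaries _
          (Submodule.smul_mem _ _ (hk l g (hGZ g hg)))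
      · push Not at he
        have h1 : e.degree ≤ ∑ l, k l := by
          rw [Finsupp.degree_eq_sum]
          exact Finset.sum_le_sum fun l _ => (he l).le
        obtain ⟨s, rfl⟩ := Nat.exists_eq_add_of_le' (show e.degree ≤ t by omega)
        rw [cechPart_add_smul (MvPolynomial.isHomogeneous_monomial a rfl), hT g hg s (by omega),
          smul_zero_cechTerm]
        exact zero_mem _
  refine forall_mem_span_of_smul (P := fun y => cechPart x i t y ∈ coboundaries x w hB i μ)
    ?_ (fun a b ha hb => ?_) hmon hy
  · rw [map_zero]
    exact zero_mem _
  · rw [map_add]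
    exact add_mem ha hb

end Strands

end ReesModule

/-! ### The annihilator of a strand -/

section Annihilator

variable {A : Type*} [CommRing A] {n : ℕ} {x : Fin n → A} {w : Fin n → ℕ}
  {N : Type*} [AddCommGroup N] [Module A N] {𝒩 : ℤ → AddSubgroup N}
  {R : Type*} [CommRing R] [Module R N] [SMulCommClass R A N]

variable (x w) in
/-- The annihilator of the degree `μ` part of the cohomology. -/
def cohomologyAnnihilator (hR : StableUnder R 𝒩) (i : ℕ) (μ : ℤ) : Ideal R where
  carrier := {b | ∀ c ∈ cocycles x w hR i μ, b • c ∈ coboundaries x w hR i μ}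
  add_mem' {a b} ha hb c hc := by
    rw [add_smul]
    exact add_mem (ha c hc) (hb c hc)
  zero_mem' c _ := by
    rw [zero_smul]
    exact zero_mem _
  smul_mem' a b hb c hc := by
    rw [smul_eq_mul, mul_smul]
    exact Submodule.smul_mem _ a (hb c hc)

theorem mem_cohomologyAnnihilator {hR : StableUnder R 𝒩} {i : ℕ} {μ : ℤ} {b : R} :
    b ∈ cohomologyAnnihilator x w hR i μ ↔ ∀ c ∈ cechCocycles x w N 𝒩 i μ,
      b • c ∈ cechCoboundaries x w N 𝒩 i μ := Iff.rfl

end Annihilator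

/-! ### Strands and the points of `Proj(B')` -/

namespace ReesModule

variable {A : Type*} [CommRing A] {𝒜 : ℤ → AddSubgroup A} [GradedRing 𝒜]
  {m r : ℕ} {hmr : m ≤ r} {I : Ideal A} {f : Fin r → I}
  {M : Type*} [AddCommGroup M] [Module A M] {ℳ : ℤ → AddSubgroup M}
  {n : ℕ} {x : Fin n → A} {w : Fin n → ℕ} {d : ℕ}

instance : CommRing (BPrime 𝒜 hmr f M) := Ideal.Quotient.commRing _

variable (𝒜 hmr f M) in
/-- The projection from `B` to `B'`. -/
def toBPrime : BRing 𝒜 m →+* BPrime 𝒜 hmr f M := Ideal.Quotient.mk _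

theorem toBPrime_surjective : Function.Surjective (toBPrime 𝒜 hmr f M) :=
  Ideal.Quotient.mk_surjective

theorem toBPrime_smul_cechTerm (b : BRing 𝒜 m) {i : ℕ} (c : CechTerm x (ReesModule hmr f M) i) :
    toBPrime 𝒜 hmr f M b • c = b • c := rfl

theorem stableUnder_bPrime (hB : StableUnder (BRing 𝒜 m) (reesDeg hmr f ℳ d)) :
    StableUnder (BPrime 𝒜 hmr f M) (reesDeg hmr f ℳ d) := by
  intro b μ u hu
  obtain ⟨b, rfl⟩ := toBPrime_surjective b
  exact hB b μ u hu

variable (𝒜 hmr f M) in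
theorem coe_decompose_mk (b : BRing 𝒜 m) (k : ℕ) :
    ((DirectSum.decompose (bPrimeGrading 𝒜 hmr f M) (toBPrime 𝒜 hmr f M b) k :
      bPrimeGrading 𝒜 hmr f M k) : BPrime 𝒜 hmr f M) =
        toBPrime 𝒜 hmr f M (MvPolynomial.homogeneousComponent k b) := by
  let _ := MvPolynomial.gradedAlgebra (σ := Fin m) (R := degZero 𝒜)
  have key : ((DirectSum.decompose (MvPolynomial.homogeneousSubmodule (Fin m) (degZero 𝒜)) b) k :
      BRing 𝒜 m) = MvPolynomial.homogeneousComponent k b :=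
    MvPolynomial.decomposition.decompose'_apply b k
  rw [← key]
  rfl

variable (q : ProjBPrime 𝒜 hmr f M)

/-- The classes of the variables generate `B'_+`, so a prime containing all of them would contain
`B'_+`. -/
theorem exists_mk_X_notMem : ∃ l : Fin m,
    toBPrime 𝒜 hmr f M (MvPolynomial.X l) ∉
      q.asHomogeneousIdeal.toIdeal := by
  by_contra! h
  refine q.not_irrelevant_le fun b hb => ?_
  obtain ⟨b, rfl⟩ := toBPrime_surjective b
  -- The constant coefficient of `b` is only known to vanish in `B'`, not in `B`; it is subtracted
  -- so that the remainder lies in the ideal of the variables.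
  have h0 : toBPrime 𝒜 hmr f M (MvPolynomial.homogeneousComponent 0 b) = 0 := by
    rw [← coe_decompose_mk]
    exact hb
  rw [MvPolynomial.homogeneousComponent_zero] at h0
  have h1 : b - MvPolynomial.C (b.coeff 0) ∈
      Ideal.span (MvPolynomial.X '' (Set.univ : Set (Fin m)) : Set (BRing 𝒜 m)) := by
    rw [MvPolynomial.mem_ideal_span_X_image]
    intro e he
    by_contra! h2
    have h3 : e = 0 := Finsupp.ext fun l => h2 l trivial
    rw [h3, MvPolynomial.mem_support_iff] at he
    simp at he
  have h2 : toBPrime 𝒜 hmr f M b =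
      toBPrime 𝒜 hmr f M (b - MvPolynomial.C (b.coeff 0)) := by
    rw [map_sub, h0, sub_zero]
  rw [h2]
  have h3 : Ideal.span (MvPolynomial.X '' (Set.univ : Set (Fin m)) : Set (BRing 𝒜 m)) ≤
      q.asHomogeneousIdeal.toIdeal.comap (toBPrime 𝒜 hmr f M):= by
    rw [Ideal.span_le]
    rintro _ ⟨l, _, rfl⟩
    exact h l
  exact h3 h1

/-- Some `T_l` is invertible in the stalk, and `T_l ^ T` moves every class into parts `t ≥ T`, where
the strand is zero. -/
theorem cocycles_stalk_le (hB : StableUnder (BRing 𝒜 m) (reesDeg hmr f ℳ d))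
    (hx : ActsWithDegree x w (reesDeg hmr f ℳ d)) {i : ℕ} {μ : ℤ}
    (h : ∃ T, ∀ t ≥ T, ∀ c ∈ cechCocycles x w _ (reesDeg hmr f ℳ d) i μ,
      cechPart x i t c ∈ cechCoboundaries x w _ (reesDeg hmr f ℳ d) i μ) :
    cechCocycles x w _ (reesStalkDeg 𝒜 hmr f M q ℳ d) i μ ≤
      cechCoboundaries x w _ (reesStalkDeg 𝒜 hmr f M q ℳ d) i μ := by
  refine (cocycles_stalk_le_iff q.asHomogeneousIdeal.toIdeal (stableUnder_bPrime hB) hx i μ).2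
    fun c hc => ?_
  obtain ⟨T, hT⟩ := h
  obtain ⟨l, hl⟩ := exists_mk_X_notMem q
  refine ⟨toBPrime 𝒜 hmr f M (MvPolynomial.X l ^ T), ?_, ?_⟩
  · rw [map_pow]
    exact fun h => hl (q.isPrime.mem_of_pow_mem _ h)
  · rw [toBPrime_smul_cechTerm]
    refine mem_coboundaries_of_cechPart fun t => ?_
    rcases lt_or_ge t T with ht | ht
    · rw [cechPart_smul_of_lt (MvPolynomial.isHomogeneous_X_pow l T) i ht]
      exact zero_mem _
    · exact hT t ht _ (Submodule.smul_mem (cocycles x w hB i μ) _ hc)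

/-- The strand is graded by `t`. On a cocycle concentrated in part `t`, the component of degree `k`
of `b` acts as `b` followed by projection to part `t + k`. -/
theorem isHomogeneous_cohomologyAnnihilator
    (hB : StableUnder (BRing 𝒜 m) (reesDeg hmr f ℳ d)) (i : ℕ) (μ : ℤ) :
    (cohomologyAnnihilator x w (stableUnder_bPrime hB) i μ).IsHomogeneous
      (bPrimeGrading 𝒜 hmr f M) := by
  intro k b hb
  obtain ⟨b, rfl⟩ := toBPrime_surjective b
  rw [coe_decompose_mk]
  rw [mem_cohomologyAnnihilator] at hb ⊢
  intro c hc
  rw [toBPrime_smul_cechTerm]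
  obtain ⟨T, _, hT⟩ := exists_sum_cechPart c
  rw [← hT, smul_eq_cechMap, map_sum]
  refine sum_mem fun t _ => ?_
  rw [← smul_eq_cechMap, homogeneousComponent_smul_cechPart]
  exact cechPart_mem_coboundaries _ (hb _ (cechPart_mem_cocycles t hc))

/-- If every variable were nilpotent on the strand, the strand would die for large `t`. So some
`T_l` lies outside the radical of the homogeneous annihilator, and a homogeneous prime containing
the annihilator misses `T_l`. It belongs to the support because the strand is finitely generated. -/
theorem exists_not_cocycles_stalk_le (hB : StableUnder (BRing 𝒜 m) (reesDeg hmr f ℳ d))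
    (hx : ActsWithDegree x w (reesDeg hmr f ℳ d)) {i : ℕ} {μ : ℤ}
    (hfin : NoetherianMod (cocycles x w hB i μ) (coboundaries x w hB i μ))
    (h : ¬ ∃ T, ∀ t ≥ T, ∀ c ∈ cechCocycles x w _ (reesDeg hmr f ℳ d) i μ,
      cechPart x i t c ∈ cechCoboundaries x w _ (reesDeg hmr f ℳ d) i μ) :
    ∃ q : ProjBPrime 𝒜 hmr f M, ¬ cechCocycles x w _ (reesStalkDeg 𝒜 hmr f M q ℳ d) i μ ≤
      cechCoboundaries x w _ (reesStalkDeg 𝒜 hmr f M q ℳ d) i μ := by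
  have h1 : ∃ l : Fin m, ∀ k, ¬ ∀ c ∈ cocycles x w hB i μ,
      (MvPolynomial.X l ^ k : BRing 𝒜 m) • c ∈ coboundaries x w hB i μ := by
    by_contra! h1
    exact h (eventually_of_pow_X_smul hB hfin h1)
  obtain ⟨l, hl⟩ := h1
  have h2 : toBPrime 𝒜 hmr f M (MvPolynomial.X l) ∉
      (cohomologyAnnihilator x w (stableUnder_bPrime hB) i μ).radical := by
    rintro ⟨k, hk⟩
    rw [← map_pow] at hk
    exact hl k hk
  rw [(isHomogeneous_cohomologyAnnihilator hB i μ).radical_eq, Ideal.mem_sInf] at h2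
  push Not at h2
  obtain ⟨p, ⟨hp, hle, hprime⟩, hlp⟩ := h2
  refine ⟨⟨⟨p, hp⟩, hprime, fun h3 => hlp (h3 ?_)⟩, fun h3 => ?_⟩
  -- `T_l` lies in the irrelevant ideal, as its component of degree zero vanishes; hence `p` is a
  -- point of `Proj(B')`.
  · change ((DirectSum.decompose (bPrimeGrading 𝒜 hmr f M) (toBPrime 𝒜 hmr f M (MvPolynomial.X l)) 0 :
      bPrimeGrading 𝒜 hmr f M 0) : BPrime 𝒜 hmr f M) = 0
    rw [coe_decompose_mk, MvPolynomial.homogeneousComponent_of_mem (MvPolynomial.isHomogeneous_X _ l),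
      if_neg zero_ne_one, map_zero]
  · have h4 := (cocycles_stalk_le_iff p (stableUnder_bPrime hB) hx i μ).1 h3
    obtain ⟨G, hGZ, hG⟩ := exists_generators hB hfin
    -- If the stalk at `p` vanished, a single `b ∉ p` would kill all generators and hence the
    -- strand, although `p` contains the annihilator.
    obtain ⟨b, hb, hbG⟩ := exists_notMem_forall p
      (P := fun (g : G) b => b • g.1 ∈ coboundaries x w (stableUnder_bPrime hB) i μ)
      (fun g => h4 g.1 (hGZ g.1 g.2))
      (fun g b b' _ hg => by
        rw [mul_smul_cechTerm]
        exact Submodule.smul_mem _ b' hg)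
    refine hb (hle (mem_cohomologyAnnihilator.2 fun c hc => ?_))
    obtain ⟨y, hy, z, hz, rfl⟩ := Submodule.mem_sup.1 (hG hc)
    rw [smul_add_cechTerm]
    refine add_mem ?_ (Submodule.smul_mem (coboundaries x w (stableUnder_bPrime hB) i μ) b hz)
    refine forall_mem_span_of_smul
      (P := fun y => b • y ∈ cechCoboundaries x w _ (reesDeg hmr f ℳ d) i μ)
      ?_ (fun a a' ha ha' => ?_) (fun b' g hg => ?_) hy
    · rw [smul_zero_cechTerm]
      exact zero_mem _
    · rw [smul_add_cechTerm]
      exact add_mem ha ha'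
    · rw [← toBPrime_smul_cechTerm, ← mul_smul_cechTerm, mul_comm, mul_smul_cechTerm]
      exact Submodule.smul_mem (coboundaries x w (stableUnder_bPrime hB) i μ) _ (hbG ⟨g, hg⟩)

end ReesModule

/-! ### Limits of suprema of sets of integers -/

section Suprema

theorem iSup_int_eq_of_isGreatest {S : Set ℤ} {k : ℤ} (h : IsGreatest S k) :
    ⨆ μ ∈ S, ((μ : ℝ) : EReal) = ((k : ℝ) : EReal) :=
  le_antisymm (iSup₂_le fun μ hμ => by exact_mod_cast h.2 hμ)
    (le_iSup₂ (f := fun (μ : ℤ) (_ : μ ∈ S) => ((μ : ℝ) : EReal)) k h.1)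

theorem iSup_int_eq_bot_iff {S : Set ℤ} : ⨆ μ ∈ S, ((μ : ℝ) : EReal) = ⊥ ↔ S = ∅ := by
  rw [iSup₂_eq_bot, Set.eq_empty_iff_forall_notMem]
  exact forall₂_congr fun μ _ => by simp

theorem iSup_int_sub (S : Set ℤ) (a : ℤ) :
    (⨆ μ ∈ S, ((μ : ℝ) : EReal)) - ((a : ℝ) : EReal) =
      ⨆ μ ∈ {μ : ℤ | μ + a ∈ S}, ((μ : ℝ) : EReal) := by
  apply le_antisymm
  · rw [EReal.sub_le_iff_le_add (Or.inl (EReal.coe_ne_bot _)) (Or.inl (EReal.coe_ne_top _))]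
    refine iSup₂_le fun μ hμ => ?_
    have h1 : ((μ : ℝ) : EReal) = (((μ - a : ℤ) : ℝ) : EReal) + ((a : ℝ) : EReal) := by
      rw [← EReal.coe_add, ← Int.cast_add, sub_add_cancel]
    rw [h1]
    gcongr
    exact le_iSup₂ (f := fun (μ : ℤ) (_ : μ ∈ {μ : ℤ | μ + a ∈ S}) => ((μ : ℝ) : EReal)) (μ - a)
      (by simpa using hμ)
  · refine iSup₂_le fun μ hμ => ?_
    rw [EReal.le_sub_iff_add_le (Or.inl (EReal.coe_ne_bot _)) (Or.inl (EReal.coe_ne_top _)),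
      ← EReal.coe_add, ← Int.cast_add]
    exact le_iSup₂ (f := fun (μ : ℤ) (_ : μ ∈ S) => ((μ : ℝ) : EReal)) (μ + a) hμ

/-- The suprema of a sequence of uniformly bounded sets of integers converge if membership of
every integer is eventually constant. -/
theorem tendsto_iSup_int {S : ℕ → Set ℤ} {G : Set ℤ} {D : ℤ} (hD : ∀ t, ∀ μ ∈ S t, μ ≤ D)
    (hG : ∀ μ ∈ G, ∀ᶠ t in atTop, μ ∈ S t) (hG' : ∀ μ ∉ G, ∀ᶠ t in atTop, μ ∉ S t) :
    Tendsto (fun t => ⨆ μ ∈ S t, ((μ : ℝ) : EReal)) atTop (𝓝 (⨆ μ ∈ G, ((μ : ℝ) : EReal))) ∧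
      (G = ∅ ∨ ∃ k, IsGreatest G k) := by
  rcases G.eq_empty_or_nonempty with rfl | hne
  · refine ⟨?_, Or.inl rfl⟩
    rw [iSup_int_eq_bot_iff.2 rfl, EReal.tendsto_nhds_bot_iff_real]
    intro c
    -- The uniform bound `D` leaves finitely many integers from `⌊c⌋` up, and each is eventually
    -- absent. The supremum is then at most `⌊c⌋ - 1 < c`.
    have h1 : ∀ᶠ t in atTop, ∀ μ ∈ Finset.Icc (⌊c⌋) D, μ ∉ S t :=
      (Filter.eventually_all_finset _).2 fun μ _ => hG' μ (Set.notMem_empty μ)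
    filter_upwards [h1] with t ht
    refine lt_of_le_of_lt (b := (((⌊c⌋ - 1 : ℤ) : ℝ) : EReal)) (iSup₂_le fun μ hμ => ?_) ?_
    · have h2 : μ ≤ ⌊c⌋ - 1 := by
        by_contra h
        exact ht μ (Finset.mem_Icc.2 ⟨by omega, hD t μ hμ⟩) hμ
      exact_mod_cast h2
    · rw [EReal.coe_lt_coe_iff]
      push_cast
      linarith [Int.floor_le c]
  · have hbdd : BddAbove G := ⟨D, fun μ hμ => by
      obtain ⟨t, ht⟩ := (hG μ hμ).exists
      exact hD t μ ht⟩
    have hk : IsGreatest G (sSup G) := ⟨Int.csSup_mem hne hbdd, fun μ hμ => le_csSup hbdd hμ⟩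
    refine ⟨?_, Or.inr ⟨_, hk⟩⟩
    rw [iSup_int_eq_of_isGreatest hk]
    refine tendsto_nhds_of_eventually_eq ?_
    -- The finitely many integers above `sSup G` and up to `D` eventually disappear, while `sSup G`
    -- itself is eventually present. The suprema are thus eventually constant.
    have h1 : ∀ᶠ t in atTop, ∀ μ ∈ Finset.Ioc (sSup G) D, μ ∉ S t :=
      (Filter.eventually_all_finset _).2 fun μ hμ => hG' μ fun h =>
        absurd (hk.2 h) (not_le.2 (Finset.mem_Ioc.1 hμ).1)
    filter_upwards [h1, hG _ hk.1] with t ht ht'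
    refine iSup_int_eq_of_isGreatest ⟨ht', fun μ hμ => ?_⟩
    by_contra h
    exact ht μ (Finset.mem_Ioc.2 ⟨not_le.1 h, hD t μ hμ⟩) hμ

end Suprema

end PowersCohomology

end

/-! ### The limit formula -/

theorem proposition5p1 {A : Type*} [CommRing A] [IsNoetherianRing A]
    -- `A` is a positively graded ring, generated over `A_0` by the forms `x_j` of degrees `w_j > 0`
    (𝒜 : ℤ → AddSubgroup A) [GradedRing 𝒜] (h𝒜 : ∀ k < 0, 𝒜 k = ⊥)
    {n : ℕ} (x : Fin n → A) (w : Fin n → ℕ) (hw : ∀ j, 0 < w j) (hx : ∀ j, x j ∈ 𝒜 (w j))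
    (hgen : Algebra.adjoin (degZero 𝒜) (Set.range x) = ⊤)
    -- `M` is a finitely generated graded module
    {M : Type*} [AddCommGroup M] [Module A M] [Module.Finite A M]
    (ℳ : ℤ → AddSubgroup M) [DirectSum.Decomposition ℳ] [SetLike.GradedSMul 𝒜 ℳ]
    -- `J ⊆ I` are graded ideals with `J I^p M = I^{p+1} M` for some `p`
    (I J : Ideal A) (hI : I.IsHomogeneous 𝒜) (hJI : J ≤ I)
    (hred : ∃ p : ℕ, (J * I ^ p) • (⊤ : Submodule A M) = I ^ (p + 1) • (⊤ : Submodule A M))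
    -- `J` is generated by forms `f_1, …, f_r` of degrees `d = d_1 = ⋯ = d_m > d_{m+1} ≥ ⋯ ≥ d_r`
    {m r : ℕ} (hm : 0 < m) (hmr : m ≤ r) (f : Fin r → I)
    (hJ : J = Ideal.span (Set.range fun l => (f l : A)))
    (deg : Fin r → ℕ) (hf : ∀ l, (f l : A) ∈ 𝒜 (deg l)) (hanti : Antitone deg)
    (d : ℕ) (hd : ∀ l : Fin r, deg l = d ↔ (l : ℕ) < m)
    (i : ℕ) :
    ∃ L : EReal,
      Tendsto (fun t : ℕ =>
          aInv x w (I ^ t • (⊤ : Submodule A M) : Submodule A M) (powDeg I ℳ t) i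
            - ((t * d : ℝ) : EReal))
        atTop (𝓝 L) ∧
      (L = ⊥ ∨ ∃ k : ℤ, L = ((k : ℝ) : EReal)) ∧
      (Nonempty (ProjBPrime 𝒜 hmr f M) →
        IsGreatest (Set.range fun q : ProjBPrime 𝒜 hmr f M =>
          aInv x w (ReesStalk 𝒜 hmr f M q) (reesStalkDeg 𝒜 hmr f M q ℳ d) i) L) ∧
      (IsEmpty (ProjBPrime 𝒜 hmr f M) → L = ⊥) := by
  have hd0 : ∀ l : Fin r, (l : ℕ) < m → deg l = d := fun l => (hd l).2
  have hd' : ∀ l : Fin r, m ≤ l → deg l < d := by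
    intro l hl
    have h0 : deg ⟨0, by omega⟩ = d := (hd ⟨0, by omega⟩).2 hm
    have h1 : deg l ≤ deg ⟨0, by omega⟩ := hanti (Fin.mk_le_of_le_val (Nat.zero_le _))
    have h2 : deg l ≠ d := fun h => absurd ((hd l).1 h) (not_lt.2 hl)
    omega
  have hB := ReesModule.stableUnder_reesDeg (ℳ := ℳ) hmr f
    fun l => hd0 (Fin.castLE hmr l) l.2 ▸ hf (Fin.castLE hmr l)
  have hacts := ReesModule.actsWithDegree_reesDeg (𝒜 := 𝒜) (ℳ := ℳ) hmr f hx d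
  have hfin := ReesModule.finiteCohomology hmr f hw hI hx hgen hJ hred hf hd0 hd' hB
  obtain ⟨D, hD⟩ := hfin.vanishing i
  -- `G` collects the degrees whose strand survives for large `t`; `S t` below collects those whose
  -- strand is nonzero in part `t`.
  set G : Set ℤ := {μ | ¬ ∃ T, ∀ t ≥ T, ∀ c ∈ cechCocycles x w _ (reesDeg hmr f ℳ d) i μ,
    ReesModule.cechPart x i t c ∈ cechCoboundaries x w _ (reesDeg hmr f ℳ d) i μ} with hG
  set S : ℕ → Set ℤ := fun t => {μ | ¬ ∀ c ∈ cechCocycles x w _ (reesDeg hmr f ℳ d) i μ,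
    ReesModule.cechPart x i t c ∈ cechCoboundaries x w _ (reesDeg hmr f ℳ d) i μ} with hS
  have hlim := tendsto_iSup_int (S := S) (G := G) (D := D)
    (fun t μ hμ => not_lt.1 fun h => hμ fun c hc =>
      ReesModule.cechPart_mem_coboundaries t (hD μ h hc))
    (fun μ hμ => by
      rcases ReesModule.eventually_or_eventually hB (hfin.noetherian i μ) with h | h
      · exact absurd h hμ
      · exact eventually_atTop.2 h)
    (fun μ hμ => by
      obtain ⟨T, hT⟩ := not_not.1 hμ
      exact eventually_atTop.2 ⟨T, fun t ht h => h (hT t ht)⟩)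
  have haS : ∀ t : ℕ, aInv x w (I ^ t • (⊤ : Submodule A M) : Submodule A M) (powDeg I ℳ t) i
      - ((t * d : ℝ) : EReal) = ⨆ μ ∈ S t, ((μ : ℝ) : EReal) := by
    intro t
    have h1 : ((t * d : ℝ) : EReal) = (((t * d : ℤ) : ℝ) : EReal) := by push_cast; rfl
    rw [aInv, h1, iSup_int_sub]
    have h2 : {μ : ℤ | μ + t * d ∈ {μ | Nontrivial (CechCohomology x w
        (I ^ t • (⊤ : Submodule A M) : Submodule A M) (powDeg I ℳ t) i μ)}} = S t := by
      ext μ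
      exact (nontrivial_cechCohomology_iff i _).trans
        (not_congr (ReesModule.cocycles_powDeg_le_iff i t μ))
    rw [h2]
  have hstalk : ∀ (q : ProjBPrime 𝒜 hmr f M) (μ : ℤ),
      Nontrivial (CechCohomology x w _ (reesStalkDeg 𝒜 hmr f M q ℳ d) i μ) → μ ∈ G := by
    intro q μ hμ hT
    exact (nontrivial_cechCohomology_iff i μ).1 hμ (ReesModule.cocycles_stalk_le q hB hacts hT)
  have hexists : ∀ μ ∈ G, ∃ q : ProjBPrime 𝒜 hmr f M,
      Nontrivial (CechCohomology x w _ (reesStalkDeg 𝒜 hmr f M q ℳ d) i μ) := by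
    intro μ hμ
    obtain ⟨q, hq⟩ := ReesModule.exists_not_cocycles_stalk_le hB hacts (hfin.noetherian i μ) hμ
    exact ⟨q, (nontrivial_cechCohomology_iff i μ).2 hq⟩
  have hle : ∀ q : ProjBPrime 𝒜 hmr f M, aInv x w (ReesStalk 𝒜 hmr f M q)
      (reesStalkDeg 𝒜 hmr f M q ℳ d) i ≤ ⨆ μ ∈ G, ((μ : ℝ) : EReal) := fun q =>
    iSup₂_le fun μ hμ =>
      le_iSup₂ (f := fun (μ : ℤ) (_ : μ ∈ G) => ((μ : ℝ) : EReal)) μ (hstalk q μ hμ)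
  refine ⟨⨆ μ ∈ G, ((μ : ℝ) : EReal), ?_, ?_, ?_, ?_⟩
  · simpa only [haS] using hlim.1
  · rcases hlim.2 with h | ⟨k, hk⟩
    · exact Or.inl (iSup_int_eq_bot_iff.2 h)
    · exact Or.inr ⟨k, iSup_int_eq_of_isGreatest hk⟩
  · rintro ⟨q⟩
    refine ⟨?_, ?_⟩
    · rcases hlim.2 with h | ⟨k, hk⟩
      -- No strand survives, so every stalk has invariant `-∞` and any `q` attains the maximum.
      · refine ⟨q, le_antisymm (hle q) ?_⟩
        rw [iSup_int_eq_bot_iff.2 h]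
        exact bot_le
      -- A stalk with cohomology in the largest surviving degree `k` attains the maximum.
      · obtain ⟨q, hq⟩ := hexists k hk.1
        refine ⟨q, le_antisymm (hle q) ?_⟩
        rw [iSup_int_eq_of_isGreatest hk]
        exact le_iSup₂ (f := fun (μ : ℤ) (_ : μ ∈ {μ : ℤ | Nontrivial (CechCohomology x w
          (ReesStalk 𝒜 hmr f M q) (reesStalkDeg 𝒜 hmr f M q ℳ d) i μ)}) => ((μ : ℝ) : EReal)) k hq
    · rintro _ ⟨q, rfl⟩
      exact hle q
  · intro hempty
    refine iSup_int_eq_bot_iff.2 (Set.eq_empty_iff_forall_notMem.2 fun μ hμ => ?_)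
    obtain ⟨q, _⟩ := hexists μ hμ
    exact hempty.false q
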